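/- **Setting.** Let $\Theta\subset\mathbb R^p$ and let $f(\cdot;\theta)$, $\theta\in\Theta$, be strictly positive probability densities with respect to a $\sigma$-finite measure on a sample space $\mathcal Y$. Write $S(\theta;y)=\partial\log f(y;\theta)/\partial\theta$, $I(\theta;y)=-\partial^2\log f(y;\theta)/\partial\theta\,\partial\theta^{\mathrm T}$ and $\mathcal I(\theta)=E\{I(\theta;Y)\}$, where expectations in $Y$ are under $f(\cdot;\theta_0)$. For each $N$, the finite population $U_N$ has values $y_1,\dots,y_N$ that are i.i.d. from $f(\cdot;\theta_0)$, and a sample $A$ of size $n=|A|$ is drawn by Poisson sampling: given $U_N$ (values, design information and the known inclusion probabilities $\pi_i$, which may depend on the values), unit $i$ enters $A$ with probability $\pi_i$, independently over the units. The sum $n_0=\sum_{i=1}^N\pi_i$ is non-random. Put $w_i=\pi_i^{-1}$, $l_w(\theta)=N^{-1}\sum_{i\in A}w_i\log f(y_i;\theta)$, $\hat S_w(\theta)=N^{-1}\sum_{i\in A}w_iS(\theta;y_i)$, $\hat I_w(\theta)=N^{-1}\sum_{i\in A}w_iI(\theta;y_i)$. Let $\hat\theta$ be a maximizer of $l_w$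 over $\Theta$ (it is enough that it is one with probability tending to $1$). **Bootstrap.** Given the sample, $(N_i^*)_{i\in A}$ is multinomial with $N$ trials and probabilities $p_i=w_i/\sum_{j\in A}w_j$; given $(N_i^*)$, the $m_i^*\sim\mathrm{Bin}(N_i^*,\pi_i)$ are independent; $w_i^*=w_im_i^*$ and $l_w^*(\theta)=N^{-1}\sum_{i\in A}w_i^*\log f(y_i;\theta)$. Let $\hat\theta^*$ be a maximizer of $l_w^*$ over $\Theta$ (it is enough that the bootstrap probability, given the sample, that it is not one tends to $0$ in probability). **Conditions.** There is a closed neighborhood $\mathcal B$ of $\theta_0$, contained in the interior of $\Theta$, such that: 1. For every $y$, $f(y;\cdot)$ is twice continuously differentiable in the interior of $\Theta$; $\sup_{\theta\in\mathcal B}|I_{jk}(\theta;y)|\le G(y)$ for all $j,k$ (and almost all $y$) with $E\{G(Y)\}<\infty$; and $\mathcal I(\theta_0)$ is invertible. 2. $\sup_{\theta\in\mathcal B}E\{\|S(\theta;Y)\|^6\}<\infty$. 3. For $\theta\in\mathcal B$, $n_0\,\mathrm{var}\{\hat S_w(\theta)\}$ converges to a positive definite matrix $\Sigma_S(\theta)$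 (variance under the joint distribution of super-population and sampling). 4. For $\theta\in\mathcal B$, $\hat I_w(\theta)\to\mathcal I(\theta)$ in probability. 5. $\mathrm{var}\{\hat S_w(\theta_0)\}^{-1/2}\hat S_w(\theta_0)\to N(0,I)$ in distribution. 6. $n_0\to\infty$, $n_0/N\to0$, and $C_1\le Nn_0^{-1}\pi_i\le C_2$ for positive constants $C_1,C_2$. 7. (Identifiability of $\theta_0$.) For every neighborhood $\mathcal U$ of $\theta_0$, $\Theta\setminus\mathcal U$ is covered by finitely many sets $T_1,\dots,T_r$ for which there are integrable functions $g_j$ with $E\{g_j(Y)\}<0$ and $\log f(y;\theta)-\log f(y;\theta_0)\le g_j(y)$ for almost all $y$ and all $\theta\in\Theta\cap T_j$. **Lemma 1.** Let $\Sigma_\theta=\mathcal I(\theta_0)^{-1}\Sigma_S(\theta_0)\{\mathcal I(\theta_0)^{-1}\}^{\mathrm T}$. Then, as $N\to\infty$, conditionally on the sample $A$, $$\sqrt n(\hat\theta^*-\hat\theta)\mid A\longrightarrow N(0,\Sigma_\theta)\quad\text{in distribution, in probability},$$ that is, for every bounded continuous $g:\mathbb R^p\to\mathbb R$, the bootstrap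 expectation $E_*[g\{\sqrt n(\hat\theta^*-\hat\theta)\}\mid A]$ converges in probability to $\int g\,dN(0,\Sigma_\theta)$. This is also the limit distribution of the estimator itself: $\sqrt n(\hat\theta-\theta_0)\to N(0,\Sigma_\theta)$ in distribution under the joint distribution of super-population and sampling. -/

import Mathlib

open MeasureTheory ProbabilityTheory Filter Topology Set
open scoped ENNReal NNReal BoundedContinuousFunction

namespace SurveyBootstrap

/-- The space `ℝᵖ` of parameters, with the Euclidean norm. -/
abbrev Param (p : ℕ) := EuclideanSpace ℝ (Fin p)

section Model

variable {𝒴 : Type*} {p : ℕ}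

/-- The score function `S(θ; y) = ∂ log f(y; θ) / ∂θ`. -/
noncomputable def score (f : 𝒴 → Param p → ℝ) (θ : Param p) (y : 𝒴) : Param p :=
  gradient (fun t => Real.log (f y t)) θ

/-- The matrix `I(θ; y) = - ∂² log f(y; θ) / ∂θ ∂θᵀ`. -/
noncomputable def obsInfo (f : 𝒴 → Param p → ℝ) (θ : Param p) (y : 𝒴) :
    Matrix (Fin p) (Fin p) ℝ :=
  Matrix.of fun j k => - fderiv ℝ (fun t => score f t y j) θ (EuclideanSpace.single k 1)

variable [MeasurableSpace 𝒴]

/-- The distribution with density `f(·; θ)` with respect to `μ`. -/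
noncomputable def modelLaw (μ : Measure 𝒴) (f : 𝒴 → Param p → ℝ) (θ : Param p) : Measure 𝒴 :=
  μ.withDensity fun y => ENNReal.ofReal (f y θ)

/-- `f(·; θ)`, `θ ∈ Θ`, are positive probability densities with respect to `μ`. -/
structure IsDensityFamily (μ : Measure 𝒴) (f : 𝒴 → Param p → ℝ) (Θ : Set (Param p)) : Prop where
  measurable : ∀ θ ∈ Θ, Measurable fun y => f y θ
  pos : ∀ θ ∈ Θ, ∀ y, 0 < f y θ
  lintegral_eq_one : ∀ θ ∈ Θ, ∫⁻ y, ENNReal.ofReal (f y θ) ∂μ = 1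

/-- `𝓘(θ) = E{I(θ; Y)}`, for `Y` with distribution `law`. -/
noncomputable def info (law : Measure 𝒴) (f : 𝒴 → Param p → ℝ) (θ : Param p) :
    Matrix (Fin p) (Fin p) ℝ :=
  Matrix.of fun j k => ∫ y, obsInfo f θ y j k ∂law

/-- Smoothness and moment conditions on the densities, over a closed neighborhood `B` of `θ₀`;
expectations are under `θ₀`. -/
structure ModelRegularity (μ : Measure 𝒴) (f : 𝒴 → Param p → ℝ) (Θ B : Set (Param p))
    (θ₀ : Param p) : Prop where
  isClosed : IsClosed B
  nhds : B ∈ 𝓝 θ₀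
  subset : B ⊆ interior Θ
  /-- continuous second-order derivatives in the parameter -/
  contDiffOn : ∀ y, ContDiffOn ℝ 2 (f y) (interior Θ)
  /-- sixth moments of the score, bounded over `B` -/
  score_moment : ∃ M : ℝ≥0, ∀ θ ∈ B, ∫⁻ y, ‖score f θ y‖ₑ ^ 6 ∂(modelLaw μ f θ₀) ≤ M
  /-- integrable envelope for the second derivatives of the log-density over `B` -/
  info_dominated : ∃ G : 𝒴 → ℝ, Integrable G (modelLaw μ f θ₀) ∧
    ∀ᵐ y ∂(modelLaw μ f θ₀), ∀ θ ∈ B, ∀ j k, |obsInfo f θ y j k| ≤ G y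
  /-- `𝓘(θ₀)` is invertible -/
  info_isUnit : IsUnit (info (modelLaw μ f θ₀) f θ₀)

/-- Identifiability of `θ₀`: away from every neighborhood of `θ₀`, the parameter set splits into
finitely many pieces on each of which `log {f(Y; θ) / f(Y; θ₀)}` is bounded, uniformly in `θ`, by
an integrable function of `Y` with negative expectation under `θ₀`. -/
def Identifiable (μ : Measure 𝒴) (f : 𝒴 → Param p → ℝ) (Θ : Set (Param p))
    (θ₀ : Param p) : Prop :=
  ∀ U ∈ 𝓝 θ₀, ∃ (r : ℕ) (T : Fin r → Set (Param p)) (g : Fin r → 𝒴 → ℝ),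
    Θ \ U ⊆ ⋃ j, T j ∧
    ∀ j, Integrable (g j) (modelLaw μ f θ₀) ∧ ∫ y, g j y ∂(modelLaw μ f θ₀) < 0 ∧
      ∀ᵐ y ∂(modelLaw μ f θ₀), ∀ θ ∈ Θ ∩ T j,
        Real.log (f y θ) - Real.log (f y θ₀) ≤ g j y

end Model

section Sampling

variable {𝒴 Ω : Type*} [MeasurableSpace 𝒴] [MeasurableSpace Ω]

/-- For every `N`, the values `y_{N,1}, …, y_{N,N}` of the finite population `U_N` are independent
with distribution `law`. -/
structure IsSuperpopulation (P : Measure Ω) (law : Measure 𝒴)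
    (y : (N : ℕ) → Fin N → Ω → 𝒴) : Prop where
  measurable : ∀ N i, Measurable (y N i)
  iIndepFun : ∀ N, iIndepFun (y N) P
  map_eq : ∀ N i, P.map (y N i) = law

/-- Poisson sampling. `𝒰 N` is the information about the finite population of size `N`: it
determines the values `y_{N,i}` and the inclusion probabilities `π_{N,i}`, so the design may be
informative. Given `𝒰 N`, unit `i` enters the sample `A N` with probability `π_{N,i}`,
independently over the units. -/
structure IsPoissonSampling (P : Measure Ω) (𝒰 : ℕ → MeasurableSpace Ω)
    (y : (N : ℕ) → Fin N → Ω → 𝒴) (π : (N : ℕ) → Fin N → Ω → unitInterval)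
    (A : (N : ℕ) → Ω → Finset (Fin N)) : Prop where
  le : ∀ N, 𝒰 N ≤ ‹MeasurableSpace Ω›
  measurable_y : ∀ N i, Measurable[𝒰 N] (y N i)
  measurable_π : ∀ N i, Measurable[𝒰 N] (π N i)
  measurableSet_eq : ∀ N (s : Finset (Fin N)), MeasurableSet {ω | A N ω = s}
  condProb : ∀ N (s : Finset (Fin N)),
    P⟦{ω | A N ω = s} | 𝒰 N⟧ =ᵐ[P]
      fun ω => (∏ i ∈ s, (π N i ω : ℝ)) * ∏ i ∈ sᶜ, (1 - (π N i ω : ℝ))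

/-- The expected sample size `n₀ = ∑ π_i` diverges, is of smaller order than `N`, and the
inclusion probabilities are of the order `n₀ / N`. -/
structure InclusionRates (P : Measure Ω) (π : (N : ℕ) → Fin N → Ω → unitInterval)
    (n₀ : ℕ → ℝ) : Prop where
  sum_eq : ∀ N, ∀ᵐ ω ∂P, ∑ i, (π N i ω : ℝ) = n₀ N
  tendsto_atTop : Tendsto n₀ atTop atTop
  tendsto_div : Tendsto (fun N => n₀ N / N) atTop (𝓝 0)
  bounds : ∃ C₁ C₂ : ℝ, 0 < C₁ ∧ 0 < C₂ ∧ ∀ N, ∀ᵐ ω ∂P, ∀ i,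
    C₁ ≤ N / n₀ N * π N i ω ∧ N / n₀ N * π N i ω ≤ C₂

end Sampling

section Estimators

variable {𝒴 : Type*} {p N : ℕ}

/-- The weighted log-likelihood `N⁻¹ ∑_{i ∈ A} v_i log f(y_i; θ)` with weights `v_i`. -/
noncomputable def logLik (f : 𝒴 → Param p → ℝ) (y : Fin N → 𝒴) (A : Finset (Fin N))
    (v : Fin N → ℝ) (θ : Param p) : ℝ :=
  (N : ℝ)⁻¹ * ∑ i ∈ A, v i * Real.log (f (y i) θ)

/-- The weighted score `N⁻¹ ∑_{i ∈ A} v_i S(θ; y_i)`. -/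
noncomputable def wScore (f : 𝒴 → Param p → ℝ) (y : Fin N → 𝒴) (A : Finset (Fin N))
    (v : Fin N → ℝ) (θ : Param p) : Param p :=
  (N : ℝ)⁻¹ • ∑ i ∈ A, v i • score f θ (y i)

/-- The weighted information `N⁻¹ ∑_{i ∈ A} v_i I(θ; y_i)`. -/
noncomputable def wInfo (f : 𝒴 → Param p → ℝ) (y : Fin N → 𝒴) (A : Finset (Fin N))
    (v : Fin N → ℝ) (θ : Param p) : Matrix (Fin p) (Fin p) ℝ :=
  (N : ℝ)⁻¹ • ∑ i ∈ A, v i • obsInfo f θ (y i)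

/-- The sampling weights `w_i = π_i⁻¹`. -/
noncomputable def weight (π : Fin N → unitInterval) (i : Fin N) : ℝ := (π i : ℝ)⁻¹

/-- The bootstrap weights `w_i^* = w_i m_i^*`. -/
noncomputable def bootWeight (π : Fin N → unitInterval) (m : Fin N → ℕ) (i : Fin N) : ℝ :=
  weight π i * m i

/-- `θ` belongs to `Θ` and maximizes `l` over `Θ`. -/
def IsArgmax (l : Param p → ℝ) (Θ : Set (Param p)) (θ : Param p) : Prop :=
  θ ∈ Θ ∧ IsMaxOn l Θ θ

end Estimators

section Bootstrap

variable {N : ℕ}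

/-- The multinomial distribution with `K` trials and cell probabilities `q_i`, `i ∈ A`, on the
vectors of counts; the count of a unit outside `A` is `0`. -/
noncomputable def multinomialLaw (K : ℕ) (A : Finset (Fin N)) (q : Fin N → ℝ) :
    Measure (Fin N → ℕ) :=
  ∑ k ∈ Finset.piAntidiag A K,
    ENNReal.ofReal (Nat.multinomial A k * ∏ i ∈ A, q i ^ k i) • Measure.dirac k

/-- The bootstrap distribution of `(m_i^*)` given the sample: the vector `N^*` is multinomial with
`N` trials and probabilities proportional to `w_i`, `i ∈ A`; given `N^*`, the counts `m_i^*` are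
independent with distributions `Bin(N_i^*, π_i)`. The count of a unit outside `A` is `0`. -/
noncomputable def bootLaw (A : Finset (Fin N)) (π : Fin N → unitInterval) :
    Measure (Fin N → ℕ) :=
  (multinomialLaw N A fun i => weight π i / ∑ j ∈ A, weight π j).bind
    fun k => Measure.pi fun i => binomial (k i) (π i)

end Bootstrap

section Probability

variable {Ω : Type*} [MeasurableSpace Ω] {p : ℕ}

/-- The covariance matrix of a random vector. -/
noncomputable def covMat (P : Measure Ω) (X : Ω → Param p) : Matrix (Fin p) (Fin p) ℝ :=
  Matrix.of fun j k => cov[fun ω => X ω j, fun ω => X ω k; P]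

/-- The inverse of the symmetric positive semidefinite square root of a symmetric matrix `V`,
through the spectral decomposition of `V` (meaningful for positive definite `V`). -/
noncomputable def invSqrt (V : Matrix (Fin p) (Fin p) ℝ) : Matrix (Fin p) (Fin p) ℝ :=
  cfc (fun x : ℝ => (√x)⁻¹) V

/-- Weak convergence in probability of random measures `ν N ω` to a fixed measure `ν'`. -/
def TendstoWeaklyInProb (P : Measure Ω) (ν : ℕ → Ω → Measure (Param p))
    (ν' : Measure (Param p)) : Prop :=
  ∀ g : Param p →ᵇ ℝ,
    TendstoInMeasure P (fun N ω => ∫ x, g x ∂(ν N ω)) atTop (fun _ => ∫ x, g x ∂ν')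

end Probability

section Conditions

variable {𝒴 Ω : Type*} [MeasurableSpace 𝒴] [MeasurableSpace Ω] {p : ℕ}

/-- Regularity conditions on the weighted score `Ŝ_w` and the weighted information `Î_w`, with
variances, probabilities and limits in distribution taken under the joint distribution of the
super-population model and the sampling mechanism. -/
structure SurveyRegularity (P : Measure Ω) [IsProbabilityMeasure P] (law : Measure 𝒴)
    (f : 𝒴 → Param p → ℝ)
    (B : Set (Param p)) (θ₀ : Param p) (y : (N : ℕ) → Fin N → Ω → 𝒴)
    (π : (N : ℕ) → Fin N → Ω → unitInterval) (A : (N : ℕ) → Ω → Finset (Fin N))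
    (n₀ : ℕ → ℝ) (SigmaS : Param p → Matrix (Fin p) (Fin p) ℝ) : Prop where
  /-- `n₀ var{Ŝ_w(θ)}` converges to the positive definite matrix `Σ_S(θ)` -/
  var_tendsto : ∀ θ ∈ B, (SigmaS θ).PosDef ∧
    Tendsto (fun N => n₀ N • covMat P fun ω =>
      wScore f (y N · ω) (A N ω) (weight (π N · ω)) θ) atTop (𝓝 (SigmaS θ))
  /-- `Î_w(θ) → 𝓘(θ)` in probability -/
  info_tendsto : ∀ θ ∈ B, ∀ j k, TendstoInMeasure P
    (fun N ω => wInfo f (y N · ω) (A N ω) (weight (π N · ω)) θ j k) atTop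
    (fun _ => info law f θ j k)
  /-- `var{Ŝ_w(θ₀)}^{-1/2} Ŝ_w(θ₀) → N(0, I)` in distribution -/
  clt : TendstoInDistribution
    (fun N ω => Matrix.toEuclideanCLM (𝕜 := ℝ)
      (invSqrt (covMat P fun ω' => wScore f (y N · ω') (A N ω') (weight (π N · ω')) θ₀))
      (wScore f (y N · ω) (A N ω) (weight (π N · ω)) θ₀))
    atTop id (fun _ => P) (stdGaussian (Param p))

/-- The sandwich matrix `Σ_θ = 𝓘(θ₀)⁻¹ Σ_S(θ₀) {𝓘(θ₀)⁻¹}ᵀ`. -/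
noncomputable def sandwich (law : Measure 𝒴) (f : 𝒴 → Param p → ℝ)
    (SigmaS : Param p → Matrix (Fin p) (Fin p) ℝ) (θ₀ : Param p) : Matrix (Fin p) (Fin p) ℝ :=
  (info law f θ₀)⁻¹ * SigmaS θ₀ * ((info law f θ₀)⁻¹).transpose

end Conditions

end SurveyBootstrap

open SurveyBootstrap

/-!
Both limits come from one linearization. Along any filter on which the weighted sums obey the law
of large numbers (`WeightedLLN`), a maximizer of the weighted log-likelihood satisfies
`θ̂ - θ₀ = 𝓘(θ₀)⁻¹ S + o(S)`, where `S` is the weighted score at `θ₀` (`isLittleO_argmax_sub`):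
identifiability gives consistency, and the integrable envelope for the second derivatives makes the
weighted information close to `𝓘(θ₀)` near `θ₀`. Convergence in probability is expressed as
convergence along a filter (`probFilter`), and the bootstrap is the same construction on top of the
filter of the samples, so the linearization applies both to `θ̂` and to `θ̂*`. The two laws of large
numbers, `IsPoissonSampling.weightedLLN` and `RegularSamples.bootstrap_lln`, follow by truncation
from second moments. Subtracting the two expansions leaves
`√n₀ (θ̂* - θ̂) = 𝓘(θ₀)⁻¹ (bootScore) + o(1)`.

For the estimator itself, the assumed central limit theorem for the standardized score and the
convergence of `n₀ var Ŝ_w(θ₀)` give the limit `N(0, Σ_S(θ₀))` of `√n₀ Ŝ_w(θ₀)`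
(`tendsto_integral_exp_inner_of_covMat`).

For the bootstrap, each of the `N` trials selects and retains each sampled unit with the same
probability `1 / ∑ w_j`, so that the characteristic function of a linear function of the counts is
explicit (`integral_prod_pow_bootLaw`) and is asymptotically Gaussian with variance
`∑_{i ∈ A} c_i²` (`tendsto_charFun_bootLaw`). The point is that for the score this variance converges
in probability to `tᵀ Σ_S(θ₀) t`, although the conditions speak only of unconditional moments
and the inclusion probabilities may depend on the values. Given the population, a scaled Poisson sum
of a centered function has a characteristic function close to `exp (-V_N / 2)`, with `V_N` the scaled
variance `popVar`. Hence the unconditional central limit theorem determines the limit of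
`E exp (-V_N / 2)`, and the convergence of the variances determines that of `E V_N`; these are the
values for a constant, and strict convexity of the exponential forces `V_N` to that constant in
probability (`IsPoissonSampling.tendsto_popVar`).

Weak convergence is recovered from characteristic functions by a version of Lévy's theorem along
arbitrary filters (`tendsto_integral_of_tendsto_charFun`), and `n / n₀ → 1` in probability replaces
`√n₀` by `√n`.
-/

namespace SurveyBootstrap

/-! ### Convergence in probability as convergence along a filter -/

section ProbFilter

variable {ι : Type*} {M : ι → Type*} [∀ i, MeasurableSpace (M i)]

/-- The filter of the sets of pairs `(i, m)` that have probability tending to one: `s` belongs to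
it when `ν i {m | (i, m) ∉ s}` tends to `0` along `l`. Convergence in `ν i`-probability to a constant
is convergence along this filter. The outer measure of the complement is used, so that no
measurability is needed. -/
def probFilter (l : Filter ι) (ν : ∀ i, Measure (M i)) : Filter (Σ i, M i) where
  sets := {s | Tendsto (fun i => ν i {m | (⟨i, m⟩ : Σ i, M i) ∉ s}) l (𝓝 0)}
  univ_sets := by simpa using tendsto_const_nhds
  sets_of_superset hs hst :=
    tendsto_of_tendsto_of_tendsto_of_le_of_le tendsto_const_nhds hs (fun _ => zero_le)
      (fun i => measure_mono fun m hm h => hm (hst h))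
  inter_sets {s t} hs ht := by
    refine tendsto_of_tendsto_of_tendsto_of_le_of_le tendsto_const_nhds
      (by simpa using Tendsto.add hs ht) (fun _ => zero_le) (fun i => ?_)
    refine (measure_mono ?_).trans (measure_union_le _ _)
    intro m hm
    by_contra h
    simp only [mem_union, mem_ofPred_eq, not_or, not_not] at h
    exact hm ⟨h.1, h.2⟩

variable {l : Filter ι} {ν : ∀ i, Measure (M i)}

lemma eventually_probFilter {p : (Σ i, M i) → Prop} :
    (∀ᶠ k in probFilter l ν, p k) ↔ Tendsto (fun i => ν i {m | ¬ p ⟨i, m⟩}) l (𝓝 0) := Iff.rfl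

lemma tendsto_fst_probFilter : Tendsto Sigma.fst (probFilter l ν) l := by
  intro s hs
  change Tendsto _ _ _
  refine tendsto_const_nhds.congr' ?_
  filter_upwards [hs] with i hi
  simp [hi]

lemma eventually_probFilter_of_ae {p : (Σ i, M i) → Prop}
    (h : ∀ᶠ i in l, ∀ᵐ m ∂ν i, p ⟨i, m⟩) : ∀ᶠ k in probFilter l ν, p k := by
  rw [eventually_probFilter]
  refine tendsto_const_nhds.congr' ?_
  filter_upwards [h] with i hi
  exact (ae_iff.mp hi).symm

lemma tendsto_probFilter_iff {E : Type*} [PseudoMetricSpace E] {X : (Σ i, M i) → E} {c : E} :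
    Tendsto X (probFilter l ν) (𝓝 c) ↔
      ∀ ε > 0, Tendsto (fun i => ν i {m | ε ≤ dist (X ⟨i, m⟩) c}) l (𝓝 0) := by
  simp only [Metric.tendsto_nhds, eventually_probFilter, not_lt]

lemma tendstoInMeasure_const_iff {Ω E : Type*} [MeasurableSpace Ω]
    [PseudoMetricSpace E] {P : Measure Ω} {l : Filter ι} {X : ι → Ω → E} {c : E} :
    TendstoInMeasure P X l (fun _ => c) ↔
      Tendsto (fun k : Σ _ : ι, Ω => X k.1 k.2) (probFilter l fun _ => P) (𝓝 c) := by
  rw [tendstoInMeasure_iff_dist, tendsto_probFilter_iff]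

/-- Markov's inequality: convergence to `0` in `L¹` implies convergence in probability. -/
lemma tendsto_probFilter_of_lintegral {E : Type*} [NormedAddCommGroup E]
    {X : (Σ i, M i) → E}
    (hm : ∀ᶠ i in l, AEMeasurable (fun m => ‖X ⟨i, m⟩‖ₑ) (ν i))
    (h : Tendsto (fun i => ∫⁻ m, ‖X ⟨i, m⟩‖ₑ ∂ν i) l (𝓝 0)) :
    Tendsto X (probFilter l ν) (𝓝 0) := by
  rw [tendsto_probFilter_iff]
  intro ε hε
  have hε' : ENNReal.ofReal ε ≠ 0 := by simpa using hε
  have h2 : Tendsto (fun i => (∫⁻ m, ‖X ⟨i, m⟩‖ₑ ∂ν i) / ENNReal.ofReal ε) l (𝓝 0) := by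
    simpa using ENNReal.Tendsto.div_const h (Or.inr hε')
  refine tendsto_of_tendsto_of_tendsto_of_le_of_le' tendsto_const_nhds h2
    (Eventually.of_forall fun _ => zero_le) ?_
  filter_upwards [hm] with i hi
  refine (measure_mono ?_).trans (meas_ge_le_lintegral_div hi hε' ENNReal.ofReal_ne_top)
  intro m hmem
  simp only [mem_ofPred_eq, dist_zero_right] at hmem ⊢
  rw [← ofReal_norm]
  exact ENNReal.ofReal_le_ofReal hmem

lemma tendsto_probFilter_of_lintegral_sq {E : Type*} [NormedAddCommGroup E]
    {X : (Σ i, M i) → E}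
    (hm : ∀ᶠ i in l, AEMeasurable (fun m => ‖X ⟨i, m⟩‖ₑ) (ν i))
    (h : Tendsto (fun i => ∫⁻ m, ‖X ⟨i, m⟩‖ₑ ^ 2 ∂ν i) l (𝓝 0)) :
    Tendsto X (probFilter l ν) (𝓝 0) := by
  have h1 : Tendsto (fun k => ‖X k‖ ^ 2) (probFilter l ν) (𝓝 0) := by
    apply tendsto_probFilter_of_lintegral
    · filter_upwards [hm] with i hi
      simpa using hi.pow_const 2
    · simpa using h
  have h2 := h1.sqrt
  simp only [norm_nonneg, Real.sqrt_sq, Real.sqrt_zero] at h2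
  exact tendsto_zero_iff_norm_tendsto_zero.mpr h2

/-- Truncation principle for convergence in probability: it is enough to approximate `X` in `L¹`,
to any accuracy, by variables that converge to `0`. -/
lemma tendsto_probFilter_of_approx {X : (Σ i, M i) → ℝ}
    (h : ∀ δ > 0, ∃ Y R : (Σ i, M i) → ℝ, (∀ᶠ k in probFilter l ν, |X k| ≤ |Y k| + |R k|) ∧
      Tendsto Y (probFilter l ν) (𝓝 0) ∧
      ∀ᶠ i in l, AEMeasurable (fun m => R ⟨i, m⟩) (ν i) ∧
        ∫⁻ m, ‖R ⟨i, m⟩‖ₑ ∂ν i ≤ ENNReal.ofReal δ) :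
    Tendsto X (probFilter l ν) (𝓝 0) := by
  rw [tendsto_probFilter_iff]
  intro ε hε
  rw [ENNReal.tendsto_nhds_zero]
  intro η hη
  obtain ⟨η', hη', hle⟩ : ∃ η' : ℝ, 0 < η' ∧ ENNReal.ofReal η' ≤ η := by
    rcases eq_or_ne η ⊤ with rfl | ht
    · exact ⟨1, one_pos, le_top⟩
    · exact ⟨η.toReal, ENNReal.toReal_pos hη.ne' ht, ENNReal.ofReal_toReal_le⟩
  obtain ⟨Y, R, hXYR, hY, hR⟩ := h (ε / 2 * (η' / 3)) (by positivity)
  rw [eventually_probFilter, ENNReal.tendsto_nhds_zero] at hXYR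
  rw [tendsto_probFilter_iff] at hY
  have hY1 := hY (ε / 2) (by positivity)
  rw [ENNReal.tendsto_nhds_zero] at hY1
  have h3 : (0 : ℝ≥0∞) < ENNReal.ofReal (η' / 3) := by simpa using hη'
  filter_upwards [hXYR _ h3, hY1 _ h3, hR] with i h1 h2 ⟨hm, h4⟩
  have h5 : ν i {m | ENNReal.ofReal (ε / 2) ≤ ‖R ⟨i, m⟩‖ₑ} ≤ ENNReal.ofReal (η' / 3) := by
    refine (meas_ge_le_lintegral_div hm.enorm (by simpa using hε) ENNReal.ofReal_ne_top).trans ?_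
    rw [ENNReal.div_le_iff (by simpa using hε) ENNReal.ofReal_ne_top,
      ← ENNReal.ofReal_mul (by positivity)]
    rwa [mul_comm] at h4
  have hsub : {m | ε ≤ dist (X ⟨i, m⟩) 0} ⊆
      ({m | ¬ |X ⟨i, m⟩| ≤ |Y ⟨i, m⟩| + |R ⟨i, m⟩|} ∪ {m | ε / 2 ≤ dist (Y ⟨i, m⟩) 0}) ∪
        {m | ENNReal.ofReal (ε / 2) ≤ ‖R ⟨i, m⟩‖ₑ} := by
    intro m hm
    by_contra hcon
    simp only [mem_union, mem_ofPred_eq, not_or, not_le, dist_zero_right,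
      Real.norm_eq_abs] at hcon hm
    obtain ⟨⟨ha, hb⟩, hc⟩ := hcon
    rw [← ofReal_norm, ENNReal.ofReal_lt_ofReal_iff (by positivity),
      Real.norm_eq_abs] at hc
    linarith
  calc ν i {m | ε ≤ dist (X ⟨i, m⟩) 0}
      ≤ (ENNReal.ofReal (η' / 3) + ENNReal.ofReal (η' / 3)) + ENNReal.ofReal (η' / 3) :=
        (measure_mono hsub).trans ((measure_union_le _ _).trans
          (add_le_add ((measure_union_le _ _).trans (add_le_add h1 h2)) h5))
    _ = ENNReal.ofReal η' := by
        rw [← ENNReal.ofReal_add (by positivity) (by positivity),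
          ← ENNReal.ofReal_add (by positivity) (by positivity)]
        congr 1; ring
    _ ≤ η := hle

/-- Stochastic boundedness of `X` along a filter, in the form in which it is used: the product of
`X` with anything that tends to `0` tends to `0`. -/
def TightAlong {κ E : Type*} [NormedAddCommGroup E] (𝓖 : Filter κ) (X : κ → E) : Prop :=
  ∀ ε : κ → ℝ, Tendsto ε 𝓖 (𝓝 0) → Tendsto (fun k => ε k * ‖X k‖) 𝓖 (𝓝 0)

lemma TightAlong.of_le {κ E E' : Type*} [NormedAddCommGroup E] [NormedAddCommGroup E']
    {𝓖 : Filter κ} {X : κ → E} {Y : κ → E'} (hX : TightAlong 𝓖 X) (C : ℝ)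
    (h : ∀ᶠ k in 𝓖, ‖Y k‖ ≤ C * ‖X k‖) : TightAlong 𝓖 Y := by
  intro ε hε
  have h1 : Tendsto (fun k => C * (|ε k| * ‖X k‖)) 𝓖 (𝓝 0) := by
    simpa using (hX (fun k => |ε k|) (by simpa using hε.abs)).const_mul C
  refine squeeze_zero_norm' ?_ h1
  filter_upwards [h] with k hk
  rw [norm_mul, norm_norm, Real.norm_eq_abs]
  calc |ε k| * ‖Y k‖ ≤ |ε k| * (C * ‖X k‖) := by gcongr
    _ = C * (|ε k| * ‖X k‖) := by ring

lemma TightAlong.add {κ E : Type*} [NormedAddCommGroup E]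
    {𝓖 : Filter κ} {X Y : κ → E} (hX : TightAlong 𝓖 X) (hY : TightAlong 𝓖 Y) :
    TightAlong 𝓖 (fun k => X k + Y k) := by
  intro ε hε
  have h0 : Tendsto (fun k => |ε k|) 𝓖 (𝓝 0) := by simpa using hε.abs
  have h1 : Tendsto (fun k => |ε k| * ‖X k‖ + |ε k| * ‖Y k‖) 𝓖 (𝓝 0) := by
    simpa using (hX _ h0).add (hY _ h0)
  refine squeeze_zero_norm' ?_ h1
  filter_upwards with k
  rw [norm_mul, norm_norm, Real.norm_eq_abs, ← mul_add]
  gcongr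
  exact norm_add_le _ _

lemma TightAlong.smul_tendsto {κ E : Type*} [NormedAddCommGroup E] [NormedSpace ℝ E]
    {𝓖 : Filter κ} {X : κ → E} (hX : TightAlong 𝓖 X) {ε : κ → ℝ} (hε : Tendsto ε 𝓖 (𝓝 0)) :
    Tendsto (fun k => ε k • X k) 𝓖 (𝓝 0) := by
  rw [tendsto_zero_iff_norm_tendsto_zero]
  have h0 : Tendsto (fun k => |ε k|) 𝓖 (𝓝 0) := by simpa using hε.abs
  simpa [norm_smul] using hX _ h0

/-- Uniform stochastic boundedness of `X` under the measures `ν i`. -/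
def BddInProb {E : Type*} [NormedAddCommGroup E] (l : Filter ι) (ν : ∀ i, Measure (M i))
    (X : (Σ i, M i) → E) : Prop :=
  ∀ η : ℝ≥0∞, 0 < η → ∃ K : ℝ, 0 < K ∧ ∀ᶠ i in l, ν i {m | K ≤ ‖X ⟨i, m⟩‖} ≤ η

lemma bddInProb_of_lintegral_sq {E : Type*} [NormedAddCommGroup E] {X : (Σ i, M i) → E}
    (hm : ∀ᶠ i in l, AEMeasurable (fun m => ‖X ⟨i, m⟩‖ₑ) (ν i)) (C : ℝ)
    (h : ∀ᶠ i in l, ∫⁻ m, ‖X ⟨i, m⟩‖ₑ ^ 2 ∂ν i ≤ ENNReal.ofReal C) : BddInProb l ν X := by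
  intro η hη
  obtain ⟨K, hK0, hK⟩ : ∃ K : ℝ, 0 < K ∧ ENNReal.ofReal C / ENNReal.ofReal (K ^ 2) ≤ η := by
    have h1 : Tendsto (fun K : ℝ => ENNReal.ofReal C / ENNReal.ofReal (K ^ 2)) atTop (𝓝 0) := by
      have : Tendsto (fun K : ℝ => ENNReal.ofReal (K ^ 2)) atTop (𝓝 ⊤) :=
        ENNReal.tendsto_ofReal_nhds_top.mpr (tendsto_pow_atTop two_ne_zero)
      simpa using ENNReal.Tendsto.const_div this (Or.inr ENNReal.ofReal_ne_top)
    obtain ⟨K, hK, hK2⟩ := (((ENNReal.tendsto_nhds_zero.mp h1) η hη).and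
      (eventually_gt_atTop 0)).exists
    exact ⟨K, hK2, hK⟩
  refine ⟨K, hK0, ?_⟩
  filter_upwards [hm, h] with i hm h
  refine le_trans (le_trans (measure_mono ?_)
    (meas_ge_le_lintegral_div (hm.pow_const 2) (ε := ENNReal.ofReal (K ^ 2))
      (by simpa using hK0.ne') ENNReal.ofReal_ne_top)) (le_trans (by gcongr) hK)
  intro m hm
  simp only [mem_ofPred_eq] at hm ⊢
  rw [← ofReal_norm, ← ENNReal.ofReal_pow (norm_nonneg _)]
  apply ENNReal.ofReal_le_ofReal
  gcongr

lemma BddInProb.tightAlong {E : Type*} [NormedAddCommGroup E] {X : (Σ i, M i) → E}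
    (hX : BddInProb l ν X) : TightAlong (probFilter l ν) X := by
  intro ε hε
  rw [tendsto_probFilter_iff] at hε ⊢
  intro δ hδ
  rw [ENNReal.tendsto_nhds_zero]
  intro η hη
  have hη2 : 0 < η / 2 := ENNReal.half_pos hη.ne'
  obtain ⟨K, hK, hXK⟩ := hX _ hη2
  have h1 := ENNReal.tendsto_nhds_zero.mp (hε (δ / K) (by positivity)) _ hη2
  filter_upwards [hXK, h1] with i h2 h3
  refine (measure_mono ?_).trans ((measure_union_le _ _).trans
    ((add_le_add h2 h3).trans (ENNReal.add_halves η).le))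
  intro m hm
  by_contra hcon
  simp only [mem_union, mem_ofPred_eq, not_or, not_le, dist_zero_right, norm_mul,
    norm_norm] at hcon hm
  have h4 : ‖ε ⟨i, m⟩‖ * ‖X ⟨i, m⟩‖ ≤ ‖ε ⟨i, m⟩‖ * K := by gcongr; exact hcon.1.le
  have h5 : ‖ε ⟨i, m⟩‖ * K < δ := (lt_div_iff₀ hK).mp hcon.2
  linarith

/-- A variable that does not depend on the second stage and is stochastically bounded at the first
stage is stochastically bounded at the second stage. -/
lemma BddInProb.tightAlong_fst {E : Type*} [NormedAddCommGroup E] {X : (Σ i, M i) → E}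
    (hX : BddInProb l ν X) {M' : (Σ i, M i) → Type*} [∀ k, MeasurableSpace (M' k)]
    (ν' : ∀ k, Measure (M' k)) :
    TightAlong (probFilter (probFilter l ν) ν') (fun k => X k.1) := by
  intro ε hε
  rw [tendsto_probFilter_iff] at hε ⊢
  intro δ hδ
  rw [ENNReal.tendsto_nhds_zero]
  intro τ hτ
  rw [eventually_probFilter, ENNReal.tendsto_nhds_zero]
  intro η hη
  have hη2 : 0 < η / 2 := ENNReal.half_pos hη.ne'
  obtain ⟨K, hK, hXK⟩ := hX _ hη2
  have h1 := ENNReal.tendsto_nhds_zero.mp (hε (δ / K) (by positivity)) _ hτ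
  rw [eventually_probFilter, ENNReal.tendsto_nhds_zero] at h1
  filter_upwards [hXK, h1 _ hη2] with i h2 h3
  refine (measure_mono ?_).trans ((measure_union_le _ _).trans
    ((add_le_add h2 h3).trans (ENNReal.add_halves η).le))
  intro m hm
  by_contra hcon
  simp only [mem_union, mem_ofPred_eq, not_or, not_le, dist_zero_right, norm_mul,
    norm_norm, not_lt] at hcon hm
  refine absurd hm (not_lt.mpr (le_trans (measure_mono ?_) hcon.2))
  intro m' hm'
  simp only [mem_ofPred_eq] at hm' ⊢
  rw [div_le_iff₀ hK]
  exact hm'.trans (by gcongr; exact hcon.1.le)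

end ProbFilter

/-! ### Characteristic functions: expansions and convergence -/

section Expansions

lemma norm_prod_sub_prod_le {ι : Type*} (s : Finset ι) (x y : ι → ℂ)
    (hx : ∀ i ∈ s, ‖x i‖ ≤ 1) (hy : ∀ i ∈ s, ‖y i‖ ≤ 1) :
    ‖∏ i ∈ s, x i - ∏ i ∈ s, y i‖ ≤ ∑ i ∈ s, ‖x i - y i‖ := by
  classical
  induction s using Finset.induction_on with
  | empty => simp
  | insert a s ha ih =>
    rw [Finset.prod_insert ha, Finset.prod_insert ha, Finset.sum_insert ha]
    have h1 := ih (fun i hi => hx i (Finset.mem_insert_of_mem hi))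
      (fun i hi => hy i (Finset.mem_insert_of_mem hi))
    have h2 : ‖∏ i ∈ s, x i‖ ≤ 1 := by
      rw [norm_prod]
      exact Finset.prod_le_one (fun i _ => norm_nonneg _)
        (fun i hi => hx i (Finset.mem_insert_of_mem hi))
    have h3 : ‖y a‖ ≤ 1 := hy a (Finset.mem_insert_self _ _)
    calc ‖x a * ∏ i ∈ s, x i - y a * ∏ i ∈ s, y i‖
        = ‖(x a - y a) * ∏ i ∈ s, x i + y a * (∏ i ∈ s, x i - ∏ i ∈ s, y i)‖ := by
          congr 1; ring
      _ ≤ ‖x a - y a‖ * ‖∏ i ∈ s, x i‖ + ‖y a‖ * ‖∏ i ∈ s, x i - ∏ i ∈ s, y i‖ :=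
          (norm_add_le _ _).trans (by rw [norm_mul, norm_mul])
      _ ≤ ‖x a - y a‖ * 1 + 1 * ‖∏ i ∈ s, x i - ∏ i ∈ s, y i‖ := by gcongr
      _ ≤ _ := by linarith

lemma norm_exp_mul_I_sub_taylor_le (a : ℝ) :
    ‖Complex.exp (a * Complex.I) - 1 - (a * Complex.I - a ^ 2 / 2)‖ ≤ 4 * |a| ^ 3 := by
  have hn : ‖(a : ℂ) * Complex.I‖ = |a| := by simp
  rcases le_total |a| 1 with h | h
  · have h1 := Complex.exp_bound (x := (a : ℂ) * Complex.I) (by rw [hn]; exact h)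
      (n := 3) (by norm_num)
    rw [hn] at h1
    have h2 : ∑ m ∈ Finset.range 3, ((a : ℂ) * Complex.I) ^ m / (m.factorial : ℂ)
        = 1 + (a * Complex.I - a ^ 2 / 2) := by
      simp only [Finset.sum_range_succ, Finset.sum_range_zero, Nat.factorial]
      rw [mul_pow (a : ℂ) Complex.I 2, Complex.I_sq]
      push_cast
      ring
    rw [h2] at h1
    rw [sub_sub]
    refine h1.trans ?_
    have : (0 : ℝ) ≤ |a| ^ 3 := by positivity
    norm_num [Nat.factorial]
    nlinarith
  · have h1 : ‖Complex.exp (a * Complex.I)‖ = 1 := Complex.norm_exp_ofReal_mul_I a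
    have h2 : ‖((a : ℂ) ^ 2 / 2)‖ = |a| ^ 2 / 2 := by simp
    have h3 : ‖Complex.exp (a * Complex.I) - 1 - (a * Complex.I - a ^ 2 / 2)‖
        ≤ (1 + 1) + (|a| + |a| ^ 2 / 2) := by
      refine (norm_sub_le _ _).trans (add_le_add ((norm_sub_le _ _).trans ?_)
        ((norm_sub_le _ _).trans ?_))
      · rw [h1]; simp
      · rw [hn, h2]
    have h4 : |a| ≤ |a| ^ 3 := le_self_pow₀ h (by norm_num)
    have h5 : |a| ^ 2 ≤ |a| ^ 3 := pow_le_pow_right₀ h (by norm_num)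
    have h6 : 1 ≤ |a| ^ 3 := one_le_pow₀ h
    linarith

lemma norm_exp_sub_one_sub_le {z : ℂ} (hz : z.re ≤ 0) :
    ‖Complex.exp z - 1 - z‖ ≤ 3 * ‖z‖ ^ 2 := by
  rcases le_total ‖z‖ 1 with h | h
  · have := Complex.norm_exp_sub_one_sub_id_le h
    nlinarith [sq_nonneg ‖z‖]
  · have h1 : ‖Complex.exp z‖ ≤ 1 := by
      rw [Complex.norm_exp]; exact Real.exp_le_one_iff.mpr hz
    have h2 : ‖Complex.exp z - 1 - z‖ ≤ (1 + 1) + ‖z‖ := by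
      refine (norm_sub_le _ _).trans (add_le_add ((norm_sub_le _ _).trans ?_) le_rfl)
      simpa using h1
    nlinarith

/-- The characteristic function of a thinned point mass, compared with its Gaussian counterpart. -/
lemma norm_thinned_sub_exp_le {q a : ℝ} (hq0 : 0 ≤ q) (hq1 : q ≤ 1) :
    ‖(1 + q * (Complex.exp (a * Complex.I) - 1)) - Complex.exp (q * (a * Complex.I - a ^ 2 / 2))‖
      ≤ 4 * (q * |a| ^ 3) + 6 * (q ^ 2 * a ^ 2) + 2 * (q * a ^ 4) := by
  set z : ℂ := q * (a * Complex.I - a ^ 2 / 2) with hz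
  have hre : z.re ≤ 0 := by
    have : z = ((-(q * (a ^ 2 / 2)) : ℝ) : ℂ) + ((q * a : ℝ) : ℂ) * Complex.I := by
      rw [hz]; push_cast; ring
    have h0 : 0 ≤ q * (a ^ 2 / 2) := by positivity
    rw [this, Complex.add_re, Complex.ofReal_re, Complex.re_ofReal_mul, Complex.I_re]
    linarith
  have hnz : ‖z‖ ≤ q * (|a| + a ^ 2 / 2) := by
    rw [hz, norm_mul]
    have : ‖(q : ℂ)‖ = q := by simp [abs_of_nonneg hq0]
    rw [this]
    gcongr
    refine (norm_sub_le _ _).trans ?_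
    simp
  have h1 := norm_exp_sub_one_sub_le hre
  have h2 := norm_exp_mul_I_sub_taylor_le a
  have h3 : ‖(q : ℂ) * (Complex.exp (a * Complex.I) - 1 - (a * Complex.I - a ^ 2 / 2))‖
      ≤ q * (4 * |a| ^ 3) := by
    rw [norm_mul]
    have : ‖(q : ℂ)‖ = q := by simp [abs_of_nonneg hq0]
    rw [this]
    gcongr
  have h4 : (1 + q * (Complex.exp (a * Complex.I) - 1)) - Complex.exp z
      = q * (Complex.exp (a * Complex.I) - 1 - (a * Complex.I - a ^ 2 / 2))
        - (Complex.exp z - 1 - z) := by rw [hz]; ring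
  rw [h4]
  have h5 : ‖z‖ ^ 2 ≤ (q * (|a| + a ^ 2 / 2)) ^ 2 := by gcongr
  have h6 : (q * (|a| + a ^ 2 / 2)) ^ 2 ≤ q ^ 2 * (2 * a ^ 2 + a ^ 4 / 2) := by
    have : (|a| + a ^ 2 / 2) ^ 2 ≤ 2 * a ^ 2 + a ^ 4 / 2 := by
      nlinarith [sq_nonneg (|a| - a ^ 2 / 2), sq_abs a]
    rw [mul_pow]; gcongr
  have h7 : q ^ 2 * a ^ 4 ≤ q * a ^ 4 := by
    have : q ^ 2 ≤ q := by nlinarith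
    have : 0 ≤ a ^ 4 := by positivity
    gcongr
  have h8 : 0 ≤ q * a ^ 4 := by positivity
  calc _ ≤ q * (4 * |a| ^ 3) + 3 * ‖z‖ ^ 2 := (norm_sub_le _ _).trans (add_le_add h3 h1)
    _ ≤ _ := by nlinarith

end Expansions

section Levy

variable {ι : Type*} {M : ι → Type*} [∀ i, MeasurableSpace (M i)] {l : Filter ι}
  {ν : ∀ i, Measure (M i)}
  {E : Type*} [NormedAddCommGroup E] [InnerProductSpace ℝ E]
  [MeasurableSpace E] [BorelSpace E]

omit [MeasurableSpace E] [BorelSpace E] in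
lemma norm_exp_inner_sub_le (x y s t : E) :
    ‖Complex.exp (inner ℝ x s * Complex.I) - Complex.exp (inner ℝ y t * Complex.I)‖
      ≤ |inner ℝ x s - inner ℝ y t| := by
  set a := inner ℝ x s
  set b := inner ℝ y t
  have h : Complex.exp (a * Complex.I) - Complex.exp (b * Complex.I)
      = Complex.exp (b * Complex.I) * (Complex.exp (Complex.I * ((a - b : ℝ) : ℂ)) - 1) := by
    rw [mul_sub, ← Complex.exp_add]
    congr 2
    · push_cast; ring_nf
    · ring
  rw [h, norm_mul, Complex.norm_exp_ofReal_mul_I, one_mul]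
  exact Real.norm_exp_I_mul_ofReal_sub_one_le

/-- A quantitative form of the continuity of a characteristic function. -/
lemma norm_charFun_map_sub_le {M : Type*} [MeasurableSpace M] (ν : Measure M)
    [IsProbabilityMeasure ν] {Y : M → E} (hY : AEMeasurable Y ν) {C : ℝ} (hC : 0 ≤ C)
    (hY2 : ∫⁻ m, ‖Y m‖ₑ ^ 2 ∂ν ≤ ENNReal.ofReal C) (s t : E) :
    ‖charFun (ν.map Y) s - charFun (ν.map Y) t‖ ≤ (1 + C) * ‖s - t‖ := by
  have hexp : ∀ t : E, Continuous fun x : E => Complex.exp (inner ℝ x t * Complex.I) := by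
    intro t; fun_prop
  have hint : ∀ t, Integrable (fun m => Complex.exp (inner ℝ (Y m) t * Complex.I)) ν := by
    intro t
    refine (integrable_const (1 : ℝ)).mono'
      ((hexp t).measurable.comp_aemeasurable hY).aestronglyMeasurable ?_
    filter_upwards with m
    rw [Complex.norm_exp_ofReal_mul_I]
  have hsq : Integrable (fun m => ‖Y m‖ ^ 2) ν := by
    refine ⟨(hY.norm.pow_const 2).aestronglyMeasurable, ?_⟩
    rw [hasFiniteIntegral_iff_enorm]
    simpa using hY2.trans_lt ENNReal.ofReal_lt_top
  have hsq_le : ∫ m, ‖Y m‖ ^ 2 ∂ν ≤ C := by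
    rw [integral_eq_lintegral_of_nonneg_ae (Eventually.of_forall fun m => by positivity)
      hsq.aestronglyMeasurable]
    refine ENNReal.toReal_le_of_le_ofReal hC ?_
    refine le_trans (le_of_eq (lintegral_congr fun m => ?_)) hY2
    rw [ENNReal.ofReal_pow (norm_nonneg _), ofReal_norm]
  rw [charFun_apply, charFun_apply, integral_map hY (hexp s).aestronglyMeasurable,
    integral_map hY (hexp t).aestronglyMeasurable, ← integral_sub (hint s) (hint t)]
  calc ‖∫ m, (Complex.exp (inner ℝ (Y m) s * Complex.I)
          - Complex.exp (inner ℝ (Y m) t * Complex.I)) ∂ν‖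
      ≤ ∫ m, (1 + ‖Y m‖ ^ 2) * ‖s - t‖ ∂ν := by
        refine norm_integral_le_of_norm_le (((integrable_const _).add hsq).mul_const _) ?_
        filter_upwards with m
        refine (norm_exp_inner_sub_le _ _ _ _).trans ?_
        rw [← inner_sub_right]
        refine (abs_real_inner_le_norm _ _).trans ?_
        gcongr
        nlinarith [sq_nonneg (‖Y m‖ - 1), norm_nonneg (Y m)]
    _ = (1 + ∫ m, ‖Y m‖ ^ 2 ∂ν) * ‖s - t‖ := by
        rw [integral_mul_const, integral_add (integrable_const _) hsq]
        simp
    _ ≤ _ := by gcongr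

variable [SecondCountableTopology E]

lemma norm_charFun_map_sub_map_le {M : Type*} [MeasurableSpace M] (ν : Measure M)
    [IsProbabilityMeasure ν] {X Y : M → E} (hX : AEMeasurable X ν) (hY : AEMeasurable Y ν)
    {δ : ℝ} (hδ : 0 ≤ δ)
    (h : ν {m | δ ≤ ‖X m - Y m‖} ≤ ENNReal.ofReal δ) (t : E) :
    ‖charFun (ν.map X) t - charFun (ν.map Y) t‖ ≤ δ * (‖t‖ + 2) := by
  have hexp : Continuous fun x : E => Complex.exp (inner ℝ x t * Complex.I) := by fun_prop
  have hint : ∀ {X : M → E}, AEMeasurable X ν →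
      Integrable (fun m => Complex.exp (inner ℝ (X m) t * Complex.I)) ν := by
    intro X hX
    refine (integrable_const (1 : ℝ)).mono'
      (hexp.measurable.comp_aemeasurable hX).aestronglyMeasurable ?_
    filter_upwards with m
    rw [Complex.norm_exp_ofReal_mul_I]
  have hset : NullMeasurableSet {m | δ ≤ ‖X m - Y m‖} ν :=
    nullMeasurableSet_le aemeasurable_const (hX.sub hY).norm
  have hi2 : Integrable (({m | δ ≤ ‖X m - Y m‖}).indicator fun _ => (2 : ℝ)) ν :=
    (integrable_const (2 : ℝ)).indicator₀ hset
  rw [charFun_apply, charFun_apply, integral_map hX hexp.aestronglyMeasurable,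
    integral_map hY hexp.aestronglyMeasurable, ← integral_sub (hint hX) (hint hY)]
  calc _ ≤ ∫ m, (δ * ‖t‖ + ({m | δ ≤ ‖X m - Y m‖}).indicator (fun _ => (2 : ℝ)) m) ∂ν := by
        refine norm_integral_le_of_norm_le ((integrable_const _).add hi2) ?_
        filter_upwards with m
        by_cases hm : δ ≤ ‖X m - Y m‖
        · rw [indicator_of_mem (by exact hm)]
          refine (norm_sub_le _ _).trans ?_
          rw [Complex.norm_exp_ofReal_mul_I, Complex.norm_exp_ofReal_mul_I]
          have : 0 ≤ δ * ‖t‖ := by positivity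
          linarith
        · rw [indicator_of_notMem (by exact hm), add_zero]
          refine (norm_exp_inner_sub_le _ _ _ _).trans ?_
          rw [← inner_sub_left]
          refine (abs_real_inner_le_norm _ _).trans ?_
          gcongr
          exact (not_le.mp hm).le
    _ = δ * ‖t‖ + ν.real {m | δ ≤ ‖X m - Y m‖} * 2 := by
        rw [integral_add (integrable_const _) hi2, integral_indicator₀ hset]
        simp
    _ ≤ δ * ‖t‖ + δ * 2 := by
        gcongr
        exact ENNReal.toReal_le_of_le_ofReal hδ h
    _ = _ := by ring

variable [FiniteDimensional ℝ E]

/-- **Lévy's continuity theorem along an arbitrary filter**, with a perturbation that tends to `0`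
in probability. Along a filter that is not countably generated, pointwise convergence of the
characteristic functions does not imply weak convergence; with bounded second moments it does,
because the characteristic functions are then equicontinuous and finitely many of their values
decide about each integral. -/
theorem tendsto_integral_of_tendsto_charFun
    (hν : ∀ᶠ i in l, IsProbabilityMeasure (ν i)) {X Y : ∀ i, M i → E}
    (hX : ∀ᶠ i in l, AEMeasurable (X i) (ν i)) (hY : ∀ᶠ i in l, AEMeasurable (Y i) (ν i))
    {C : ℝ} (hC : 0 ≤ C) (hY2 : ∀ᶠ i in l, ∫⁻ m, ‖Y i m‖ₑ ^ 2 ∂ν i ≤ ENNReal.ofReal C)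
    (hXY : Tendsto (fun k => X k.1 k.2 - Y k.1 k.2) (probFilter l ν) (𝓝 0))
    {ν' : Measure E} [IsProbabilityMeasure ν']
    (hchar : ∀ t, Tendsto (fun i => charFun ((ν i).map (Y i)) t) l (𝓝 (charFun ν' t)))
    (g : E →ᵇ ℝ) :
    Tendsto (fun i => ∫ m, g (X i m) ∂ν i) l (𝓝 (∫ x, g x ∂ν')) := by
  rw [Metric.tendsto_nhds]
  intro ε hε
  -- If the convergence fails, a sequence of bad indices can be selected along which the characteristic
  -- functions converge on a countable dense set; the sequential theorem of Lévy then applies.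
  by_contra hcon
  let d := TopologicalSpace.denseSeq E
  have hsel : ∀ n : ℕ, ∃ i, (IsProbabilityMeasure (ν i) ∧ AEMeasurable (X i) (ν i) ∧
      AEMeasurable (Y i) (ν i) ∧ ∫⁻ m, ‖Y i m‖ₑ ^ 2 ∂ν i ≤ ENNReal.ofReal C ∧
      (∀ k ∈ Finset.range n, dist (charFun ((ν i).map (Y i)) (d k)) (charFun ν' (d k))
        < 1 / ((n : ℝ) + 1)) ∧
      ν i {m | 1 / ((n : ℝ) + 1) ≤ ‖X i m - Y i m‖} ≤ ENNReal.ofReal (1 / ((n : ℝ) + 1))) ∧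
      ¬ dist (∫ m, g (X i m) ∂ν i) (∫ x, g x ∂ν') < ε := by
    intro n
    have hn : (0 : ℝ) < 1 / ((n : ℝ) + 1) := by positivity
    have h1 : ∀ᶠ i in l, ∀ k ∈ Finset.range n,
        dist (charFun ((ν i).map (Y i)) (d k)) (charFun ν' (d k)) < 1 / ((n : ℝ) + 1) := by
      rw [Filter.eventually_all_finset]
      exact fun k _ => (Metric.tendsto_nhds.mp (hchar (d k))) _ hn
    have h2 := (ENNReal.tendsto_nhds_zero.mp (tendsto_probFilter_iff.mp hXY _ hn))
      (ENNReal.ofReal (1 / ((n : ℝ) + 1))) (by simpa using hn)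
    simp only [dist_zero_right] at h2
    obtain ⟨i, hi1, hi2⟩ := ((Filter.not_eventually.mp hcon).and_eventually
      (hν.and (hX.and (hY.and (hY2.and (h1.and h2)))))).exists
    exact ⟨i, hi2, hi1⟩
  choose i hi hbad using hsel
  have hprob : ∀ n, IsProbabilityMeasure (ν (i n)) := fun n => (hi n).1
  have hpX : ∀ n, IsProbabilityMeasure ((ν (i n)).map (X (i n))) := fun n =>
    Measure.isProbabilityMeasure_map (hi n).2.1
  have hsmall : Tendsto (fun n : ℕ => 1 / ((n : ℝ) + 1)) atTop (𝓝 0) :=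
    tendsto_one_div_add_atTop_nhds_zero_nat
  -- convergence of the characteristic functions of `Y` along the selected indices
  have hcY : ∀ t, Tendsto (fun n => charFun ((ν (i n)).map (Y (i n))) t) atTop
      (𝓝 (charFun ν' t)) := by
    intro t
    rw [Metric.tendsto_atTop]
    intro η hη
    obtain ⟨δ, hδ, hcont⟩ := Metric.continuous_iff.mp
      (continuous_charFun (μ := ν')) t (η / 3) (by positivity)
    obtain ⟨k, hk⟩ : ∃ k, dist (d k) t < min δ (η / 3 / (1 + C)) := by
      obtain ⟨k, hk⟩ := (TopologicalSpace.denseRange_denseSeq E).exists_dist_lt t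
        (lt_min hδ (show 0 < η / 3 / (1 + C) by positivity))
      exact ⟨k, by rwa [dist_comm]⟩
    obtain ⟨n₁, hn₁⟩ := (hsmall.eventually (gt_mem_nhds (show (0 : ℝ) < η / 3 by positivity))
      ).exists_forall_of_atTop
    refine ⟨max n₁ (k + 1), fun n hn => ?_⟩
    have := hprob n
    have e1 : dist (charFun ((ν (i n)).map (Y (i n))) t)
        (charFun ((ν (i n)).map (Y (i n))) (d k)) ≤ η / 3 := by
      rw [dist_eq_norm]
      refine (norm_charFun_map_sub_le _ (hi n).2.2.1 hC (hi n).2.2.2.1 _ _).trans ?_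
      rw [← dist_eq_norm, dist_comm]
      have := (hk.trans_le (min_le_right _ _)).le
      rw [le_div_iff₀ (by positivity)] at this
      linarith
    have e2 : dist (charFun ((ν (i n)).map (Y (i n))) (d k)) (charFun ν' (d k)) < η / 3 :=
      ((hi n).2.2.2.2.1 k (Finset.mem_range.mpr (by omega))).trans (hn₁ n (by omega))
    have e3 := hcont (d k) (hk.trans_le (min_le_left _ _))
    calc _ ≤ _ := dist_triangle4 _ (charFun ((ν (i n)).map (Y (i n))) (d k))
          (charFun ν' (d k)) _
      _ < η := by linarith
  -- the characteristic functions of `X` and `Y` have the same limits, since `X - Y` is small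
  have hcX : ∀ t, Tendsto (fun n => charFun ((ν (i n)).map (X (i n))) t) atTop
      (𝓝 (charFun ν' t)) := by
    intro t
    have h0 : Tendsto (fun n => charFun ((ν (i n)).map (X (i n))) t
        - charFun ((ν (i n)).map (Y (i n))) t) atTop (𝓝 0) := by
      have := hsmall.mul_const (‖t‖ + 2)
      rw [zero_mul] at this
      refine squeeze_zero_norm (fun n => ?_) this
      have := hprob n
      exact norm_charFun_map_sub_map_le _ (hi n).2.1 (hi n).2.2.1 (by positivity)
        (hi n).2.2.2.2.2 t
    simpa using h0.add (hcY t)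
  have hconv := ProbabilityMeasure.tendsto_of_tendsto_charFun
    (μ := fun n => ⟨(ν (i n)).map (X (i n)), hpX n⟩) (μ₀ := ⟨ν', inferInstance⟩) hcX
  have hint := (ProbabilityMeasure.tendsto_iff_forall_integral_tendsto.mp hconv) g
  obtain ⟨n, hn⟩ := ((Metric.tendsto_nhds.mp hint) ε hε).exists
  refine hbad n ?_
  simp only [ProbabilityMeasure.coe_mk] at hn
  rwa [integral_map (hi n).2.1 g.continuous.aestronglyMeasurable] at hn

end Levy

/-! ### Score and information of the model -/

section Matrix

variable {p : ℕ}

lemma toEuclideanCLM_apply_apply (V : Matrix (Fin p) (Fin p) ℝ) (x : Param p) (j : Fin p) :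
    Matrix.toEuclideanCLM (𝕜 := ℝ) V x j = ∑ k, V j k * x k := by
  simp [Matrix.mulVec, dotProduct]

lemma norm_le_sum_abs (x : Param p) : ‖x‖ ≤ ∑ j, |x j| := by
  have h : x = ∑ j, EuclideanSpace.single j (x j) := by
    ext i
    simp [Finset.sum_apply, Pi.single_apply]
  calc ‖x‖ = ‖∑ j, EuclideanSpace.single j (x j)‖ := by rw [← h]
    _ ≤ ∑ j, ‖(EuclideanSpace.single j (x j) : Param p)‖ := norm_sum_le _ _
    _ = ∑ j, |x j| := by simp

lemma norm_toEuclideanCLM_le (V : Matrix (Fin p) (Fin p) ℝ) :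
    ‖Matrix.toEuclideanCLM (𝕜 := ℝ) V‖ ≤ ∑ j, ∑ k, |V j k| := by
  refine ContinuousLinearMap.opNorm_le_bound _ (by positivity) fun x => ?_
  refine (norm_le_sum_abs _).trans ?_
  rw [Finset.sum_mul]
  refine Finset.sum_le_sum fun j _ => ?_
  rw [toEuclideanCLM_apply_apply, Finset.sum_mul]
  refine (Finset.abs_sum_le_sum_abs _ _).trans (Finset.sum_le_sum fun k _ => ?_)
  rw [abs_mul]
  gcongr
  exact PiLp.norm_apply_le x k

end Matrix

section Model

variable {𝒴 : Type*} {p : ℕ} {f : 𝒴 → Param p → ℝ} {O : Set (Param p)} {y : 𝒴} {θ : Param p}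

lemma contDiffOn_logDensity (hc : ContDiffOn ℝ 2 (f y) O) (hpos : ∀ t ∈ O, 0 < f y t) :
    ContDiffOn ℝ 2 (fun t => Real.log (f y t)) O :=
  hc.log fun t ht => (hpos t ht).ne'

variable (hO : IsOpen O) (hc : ContDiffOn ℝ 2 (fun t => Real.log (f y t)) O)
include hO hc

lemma hasGradientAt_logDensity (hθ : θ ∈ O) :
    HasGradientAt (fun t => Real.log (f y t)) (score f θ y) θ :=
  ((hc.contDiffAt (hO.mem_nhds hθ)).differentiableAt (by norm_num)).hasGradientAt

lemma contDiffOn_score : ContDiffOn ℝ 1 (fun t => score f t y) O := by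
  have h1 : ContDiffOn ℝ 1 (fun t => fderiv ℝ (fun t => Real.log (f y t)) t) O :=
    hc.fderiv_of_isOpen hO (by norm_num)
  exact ((InnerProductSpace.toDual ℝ (Param p)).symm.toContinuousLinearEquiv.contDiff).comp_contDiffOn
    h1

lemma hasFDerivAt_score (hθ : θ ∈ O) :
    HasFDerivAt (fun t => score f t y) (-Matrix.toEuclideanCLM (𝕜 := ℝ) (obsInfo f θ y)) θ := by
  have h1 : DifferentiableAt ℝ (fun t => score f t y) θ :=
    ((contDiffOn_score hO hc).contDiffAt (hO.mem_nhds hθ)).differentiableAt (by norm_num)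
  have h2 : fderiv ℝ (fun t => score f t y) θ
      = -Matrix.toEuclideanCLM (𝕜 := ℝ) (obsInfo f θ y) := by
    apply ContinuousLinearMap.coe_injective
    refine (EuclideanSpace.basisFun (Fin p) ℝ).toBasis.ext fun k => ?_
    ext j
    have h3 : HasFDerivAt (fun t => score f t y j)
        ((EuclideanSpace.proj j).comp (fderiv ℝ (fun t => score f t y) θ)) θ :=
      (EuclideanSpace.proj (𝕜 := ℝ) j).hasFDerivAt.comp θ h1.hasFDerivAt
    simp [toEuclideanCLM_apply_apply, obsInfo, h3.fderiv]
  rw [← h2]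
  exact h1.hasFDerivAt

lemma continuousOn_obsInfo (j k : Fin p) : ContinuousOn (fun t => obsInfo f t y j k) O := by
  have h1 : ContDiffOn ℝ 1 (fun t => score f t y j) O :=
    (EuclideanSpace.proj (𝕜 := ℝ) j).contDiff.comp_contDiffOn (contDiffOn_score hO hc)
  have h2 : ContinuousOn (fun t => fderiv ℝ (fun t => score f t y j) t) O :=
    h1.continuousOn_fderiv_of_isOpen hO (by norm_num)
  simp only [obsInfo, Matrix.of_apply]
  exact (h2.clm_apply continuousOn_const).neg

end Model

section Measurability

variable {𝒴 : Type*} [MeasurableSpace 𝒴] {p : ℕ} {O : Set (Param p)} {θ : Param p}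

/-- A directional derivative is a limit of difference quotients, hence measurable in the
observation. -/
lemma measurable_fderiv_apply (hO : IsOpen O) {F : 𝒴 → Param p → ℝ}
    (hm : ∀ t ∈ O, Measurable fun y => F y t) (hθ : θ ∈ O)
    (hd : ∀ y, DifferentiableAt ℝ (F y) θ) (u : Param p) :
    Measurable fun y => fderiv ℝ (F y) θ u := by
  have h0 : Tendsto (fun n : ℕ => θ + (1 / ((n : ℝ) + 1)) • u) atTop (𝓝 θ) := by
    simpa using (tendsto_const_nhds (x := θ)).add
      ((tendsto_one_div_add_atTop_nhds_zero_nat (𝕜 := ℝ)).smul_const u)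
  obtain ⟨n₀, hn₀⟩ := (h0.eventually (hO.mem_nhds hθ)).exists_forall_of_atTop
  refine measurable_of_tendsto_metrizable (f := fun (n : ℕ) y =>
    (((n + n₀ : ℕ) : ℝ) + 1) * (F y (θ + (1 / (((n + n₀ : ℕ) : ℝ) + 1)) • u) - F y θ)) ?_ ?_
  · intro n
    exact ((hm _ (hn₀ (n + n₀) (by omega))).sub (hm _ hθ)).const_mul _
  · rw [tendsto_pi_nhds]
    intro y
    have h1 := (hasLineDerivAt_iff_tendsto_slope_zero.mp
      ((hd y).hasFDerivAt.hasLineDerivAt u)).mono_left (nhdsGT_le_nhdsNE 0)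
    have h2 : Tendsto (fun n : ℕ => 1 / (((n + n₀ : ℕ) : ℝ) + 1)) atTop (𝓝[>] 0) := by
      rw [tendsto_nhdsWithin_iff]
      refine ⟨(tendsto_one_div_add_atTop_nhds_zero_nat (𝕜 := ℝ)).comp (tendsto_add_atTop_nat n₀),
        Eventually.of_forall fun n => ?_⟩
      simp only [mem_Ioi]
      positivity
    refine (h1.comp h2).congr fun n => ?_
    simp

variable {f : 𝒴 → Param p → ℝ}

lemma measurable_score_apply (hO : IsOpen O)
    (hc : ∀ y, ContDiffOn ℝ 2 (fun t => Real.log (f y t)) O)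
    (hm : ∀ t ∈ O, Measurable fun y => f y t) (hθ : θ ∈ O) (j : Fin p) :
    Measurable fun y => score f θ y j := by
  have h1 := measurable_fderiv_apply hO (F := fun y t => Real.log (f y t))
    (fun t ht => (hm t ht).log) hθ
    (fun y => (((hc y).contDiffAt (hO.mem_nhds hθ)).differentiableAt (by norm_num)))
    (EuclideanSpace.single j 1)
  convert h1 using 2 with y
  rw [(hasGradientAt_logDensity hO (hc y) hθ).hasFDerivAt.fderiv]
  simp [EuclideanSpace.inner_single_right]

lemma measurable_score (hO : IsOpen O)
    (hc : ∀ y, ContDiffOn ℝ 2 (fun t => Real.log (f y t)) O)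
    (hm : ∀ t ∈ O, Measurable fun y => f y t) (hθ : θ ∈ O) :
    Measurable fun y => score f θ y := by
  have h1 : Measurable fun y => (score f θ y).ofLp :=
    measurable_pi_iff.mpr (measurable_score_apply hO hc hm hθ)
  exact (WithLp.measurable_toLp 2 _).comp h1

lemma measurable_obsInfo (hO : IsOpen O)
    (hc : ∀ y, ContDiffOn ℝ 2 (fun t => Real.log (f y t)) O)
    (hm : ∀ t ∈ O, Measurable fun y => f y t) (hθ : θ ∈ O) (j k : Fin p) :
    Measurable fun y => obsInfo f θ y j k := by
  simp only [obsInfo, Matrix.of_apply]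
  refine (measurable_fderiv_apply hO (F := fun y t => score f t y j)
    (fun t ht => measurable_score_apply hO hc hm ht j) hθ (fun y => ?_) _).neg
  exact (EuclideanSpace.proj (𝕜 := ℝ) j).differentiableAt.comp θ
    (hasFDerivAt_score hO (hc y) hθ).differentiableAt

end Measurability

section Regularity

variable {𝒴 : Type*} [MeasurableSpace 𝒴] {p : ℕ} {μ : Measure 𝒴} {f : 𝒴 → Param p → ℝ}
  {Θ B : Set (Param p)} {θ₀ : Param p}

lemma ModelRegularity.mem_interior (hreg : ModelRegularity μ f Θ B θ₀) : θ₀ ∈ interior Θ :=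
  hreg.subset (mem_of_mem_nhds hreg.nhds)

lemma ModelRegularity.contDiffOn_log (hf : IsDensityFamily μ f Θ)
    (hreg : ModelRegularity μ f Θ B θ₀) (y : 𝒴) :
    ContDiffOn ℝ 2 (fun t => Real.log (f y t)) (interior Θ) :=
  contDiffOn_logDensity (hreg.contDiffOn y) fun t ht => hf.pos t (interior_subset ht) y

lemma isProbabilityMeasure_modelLaw (hf : IsDensityFamily μ f Θ) (hθ : θ₀ ∈ Θ) :
    IsProbabilityMeasure (modelLaw μ f θ₀) :=
  ⟨by simpa [modelLaw] using hf.lintegral_eq_one θ₀ hθ⟩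

/-- The modulus of continuity at `θ₀` of the observed information has an integrable envelope whose
mean tends to `0` with the radius. The supremum defining it is taken over a countable dense set of
parameters, for measurability. -/
lemma exists_obsInfo_modulus (hf : IsDensityFamily μ f Θ) (hreg : ModelRegularity μ f Θ B θ₀) :
    ∃ (r : ℕ → ℝ) (ω : ℕ → 𝒴 → ℝ), (∀ n, 0 < r n) ∧ (∀ n, Metric.ball θ₀ (r n) ⊆ B) ∧
      (∀ n, Integrable (ω n) (modelLaw μ f θ₀)) ∧
      Tendsto (fun n => ∫ y, ω n y ∂(modelLaw μ f θ₀)) atTop (𝓝 0) ∧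
      ∀ n, ∀ᵐ y ∂(modelLaw μ f θ₀), ∀ θ ∈ Metric.ball θ₀ (r n),
        ∑ j, ∑ k, |obsInfo f θ y j k - obsInfo f θ₀ y j k| ≤ ω n y := by
  obtain ⟨r₀, hr₀, hball⟩ := Metric.mem_nhds_iff.mp hreg.nhds
  obtain ⟨G, hG, hGb⟩ := hreg.info_dominated
  have hO : IsOpen (interior Θ) := isOpen_interior
  have hc := fun y => hreg.contDiffOn_log hf y
  have hm : ∀ t ∈ interior Θ, Measurable fun y => f y t :=
    fun t ht => hf.measurable t (interior_subset ht)
  let d := TopologicalSpace.denseSeq (Param p)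
  let r : ℕ → ℝ := fun n => r₀ * (1 / ((n : ℝ) + 1))
  have hrpos : ∀ n, 0 < r n := fun n => by positivity
  have hrle : ∀ n, r n ≤ r₀ := fun n => by
    refine mul_le_of_le_one_right hr₀.le ?_
    rw [div_le_one (by positivity)]
    linarith [Nat.cast_nonneg (α := ℝ) n]
  have hrlim : Tendsto r atTop (𝓝 0) := by
    simpa [r] using tendsto_one_div_add_atTop_nhds_zero_nat.const_mul r₀
  have hrB : ∀ n, Metric.ball θ₀ (r n) ⊆ B := fun n =>
    (Metric.ball_subset_ball (hrle n)).trans hball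
  let dev : Param p → 𝒴 → ℝ := fun θ y => ∑ j, ∑ k, |obsInfo f θ y j k - obsInfo f θ₀ y j k|
  -- taken in `ℝ≥0∞`, where a supremum that is infinite on a null set does no harm
  let W : ℕ → 𝒴 → ℝ≥0∞ := fun n y =>
    ⨆ m, ⨆ _ : d m ∈ Metric.ball θ₀ (r n), ENNReal.ofReal (dev (d m) y)
  have hdev_meas : ∀ θ ∈ interior Θ, Measurable (dev θ) := fun θ hθ =>
    Finset.measurable_sum _ fun j _ => Finset.measurable_sum _ fun k _ =>
      ((measurable_obsInfo hO hc hm hθ j k).sub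
        (measurable_obsInfo hO hc hm hreg.mem_interior j k)).abs
  have hdev_cont : ∀ y, ContinuousOn (fun θ => dev θ y) (interior Θ) := fun y =>
    continuousOn_finsetSum _ fun j _ => continuousOn_finsetSum _ fun k _ =>
      ((continuousOn_obsInfo hO (hc y) j k).sub continuousOn_const).abs
  have hWmeas : ∀ n, Measurable (W n) := fun n =>
    Measurable.iSup fun m => Measurable.iSup fun h =>
      (hdev_meas _ (hreg.subset (hrB n h))).ennreal_ofReal
  have hdev_le : ∀ᵐ y ∂(modelLaw μ f θ₀), ∀ θ ∈ B, dev θ y ≤ ∑ _j : Fin p, ∑ _k : Fin p, 2 * G y := by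
    filter_upwards [hGb] with y hy θ hθ
    refine Finset.sum_le_sum fun j _ => Finset.sum_le_sum fun k _ => ?_
    have h1 := hy θ hθ j k
    have h2 := hy θ₀ (mem_of_mem_nhds hreg.nhds) j k
    calc _ ≤ |obsInfo f θ y j k| + |obsInfo f θ₀ y j k| := abs_sub _ _
      _ ≤ _ := by linarith
  have hW_le : ∀ᵐ y ∂(modelLaw μ f θ₀), ∀ n, W n y ≤
      ENNReal.ofReal (∑ _j : Fin p, ∑ _k : Fin p, 2 * G y) := by
    filter_upwards [hdev_le] with y hy n
    exact iSup_le fun m => iSup_le fun h => ENNReal.ofReal_le_ofReal (hy _ (hrB n h))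
  have hbound : ∀ᵐ y ∂(modelLaw μ f θ₀), ∀ n,
      ‖(W n y).toReal‖ ≤ ∑ _j : Fin p, ∑ _k : Fin p, 2 * G y := by
    filter_upwards [hW_le, hdev_le] with y hy hy2 n
    rw [Real.norm_eq_abs, abs_of_nonneg ENNReal.toReal_nonneg]
    refine ENNReal.toReal_le_of_le_ofReal ?_ (hy n)
    refine le_trans ?_ (hy2 θ₀ (mem_of_mem_nhds hreg.nhds))
    positivity
  have hbint : Integrable (fun y => ∑ _j : Fin p, ∑ _k : Fin p, 2 * G y) (modelLaw μ f θ₀) :=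
    integrable_finsetSum _ fun j _ => integrable_finsetSum _ fun k _ => hG.const_mul 2
  refine ⟨r, fun n y => (W n y).toReal, hrpos, hrB, fun n => ?_, ?_, fun n => ?_⟩
  · refine hbint.mono' (hWmeas n).ennreal_toReal.aestronglyMeasurable ?_
    filter_upwards [hbound] with y hy using hy n
  · have := tendsto_integral_of_dominated_convergence (μ := modelLaw μ f θ₀)
      (F := fun n y => (W n y).toReal) (f := fun _ => 0) _
      (fun n => (hWmeas n).ennreal_toReal.aestronglyMeasurable) hbint
      (fun n => hbound.mono fun y hy => hy n) (Eventually.of_forall fun y => ?_)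
    · simpa using this
    -- the supremum over a shrinking ball tends to the value `0` at its center
    · rw [Metric.tendsto_atTop]
      intro ε hε
      have h1 : ContinuousAt (fun θ => dev θ y) θ₀ :=
        (hdev_cont y).continuousAt (hO.mem_nhds hreg.mem_interior)
      obtain ⟨δ, hδ, h2⟩ := Metric.continuousAt_iff.mp h1 (ε / 2) (by positivity)
      obtain ⟨n₀, hn₀⟩ := (hrlim.eventually (gt_mem_nhds hδ)).exists_forall_of_atTop
      refine ⟨n₀, fun n hn => ?_⟩
      rw [dist_zero_right, Real.norm_eq_abs, abs_of_nonneg ENNReal.toReal_nonneg]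
      refine lt_of_le_of_lt (ENNReal.toReal_le_of_le_ofReal (half_pos hε).le ?_) (half_lt_self hε)
      refine iSup_le fun m => iSup_le fun h => ENNReal.ofReal_le_ofReal ?_
      have h3 := h2 ((Metric.mem_ball.mp h).trans (hn₀ n hn))
      have h4 : dev θ₀ y = 0 := by simp [dev]
      rw [h4, dist_zero_right, Real.norm_eq_abs] at h3
      exact (le_abs_self _).trans h3.le
  -- continuity in the parameter extends the bound from the dense set to the whole ball
  · filter_upwards [hW_le] with y hy θ hθ
    have hcl : θ ∈ closure (Metric.ball θ₀ (r n) ∩ range d) :=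
      (TopologicalSpace.denseRange_denseSeq (Param p)).open_subset_closure_inter
        Metric.isOpen_ball hθ
    have hcont : ContinuousWithinAt (fun θ => dev θ y) (Metric.ball θ₀ (r n) ∩ range d) θ :=
      ((hdev_cont y).continuousAt (hO.mem_nhds (hreg.subset (hrB n hθ)))).continuousWithinAt
    refine hcont.closure_le hcl continuousWithinAt_const ?_
    rintro _ ⟨hmem, m, rfl⟩
    have h1 : ENNReal.ofReal (dev (d m) y) ≤ W n y := le_iSup₂_of_le m hmem le_rfl
    have hne : W n y ≠ ⊤ := ((hy n).trans_lt ENNReal.ofReal_lt_top).ne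
    exact (ENNReal.ofReal_le_iff_le_toReal hne).mp h1

/-- The score has mean zero at the true parameter. This needs no differentiation under the integral:
with the second-order expansion of the log-likelihood ratio `ℓ`, and `ℓ ≤ exp ℓ - 1`, the mean
of `s S(θ₀; Y)·u` is at most of the order `s²` for every direction `u`. -/
lemma integral_inner_score_eq_zero (hf : IsDensityFamily μ f Θ)
    (hreg : ModelRegularity μ f Θ B θ₀)
    (hint : ∀ u, Integrable (fun y => inner ℝ u (score f θ₀ y)) (modelLaw μ f θ₀)) (u : Param p) :
    ∫ y, inner ℝ u (score f θ₀ y) ∂(modelLaw μ f θ₀) = 0 := by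
  have hθ₀ : θ₀ ∈ Θ := interior_subset hreg.mem_interior
  have := isProbabilityMeasure_modelLaw hf hθ₀
  obtain ⟨r₀, hr₀, hball⟩ := Metric.mem_nhds_iff.mp hreg.nhds
  obtain ⟨G, hG, hGb⟩ := hreg.info_dominated
  have hO : IsOpen (interior Θ) := isOpen_interior
  have hc := fun y => hreg.contDiffOn_log hf y
  have key : ∀ u, ∫ y, inner ℝ u (score f θ₀ y) ∂(modelLaw μ f θ₀) ≤ 0 := by
    intro u
    set K : ℝ := ∫ y, (∑ _j : Fin p, ∑ _k : Fin p, G y) * ‖u‖ ^ 2 ∂(modelLaw μ f θ₀) with hK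
    have hKint : Integrable (fun y => (∑ _j : Fin p, ∑ _k : Fin p, G y) * ‖u‖ ^ 2)
        (modelLaw μ f θ₀) :=
      (integrable_finsetSum _ fun j _ => integrable_finsetSum _ fun k _ => hG).mul_const _
    have hstep : ∀ᶠ s : ℝ in 𝓝[>] 0,
        ∫ y, inner ℝ u (score f θ₀ y) ∂(modelLaw μ f θ₀) ≤ s * K := by
      have hmem : ∀ᶠ s : ℝ in 𝓝[>] 0, θ₀ + s • u ∈ Metric.ball θ₀ r₀ := by
        have : Tendsto (fun s : ℝ => θ₀ + s • u) (𝓝[>] 0) (𝓝 θ₀) := by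
          have h : Continuous fun s : ℝ => θ₀ + s • u := by fun_prop
          simpa using (h.tendsto 0).mono_left nhdsWithin_le_nhds
        exact this (Metric.ball_mem_nhds _ hr₀)
      filter_upwards [hmem, self_mem_nhdsWithin] with s hs hs0
      have hs0 : 0 < s := hs0
      set θ := θ₀ + s • u with hθ
      have hθΘ : θ ∈ Θ := interior_subset (hreg.subset (hball hs))
      -- the likelihood ratio integrates to one
      have hratio : ∫⁻ y, ENNReal.ofReal (f y θ / f y θ₀) ∂(modelLaw μ f θ₀) = 1 := by
        have hm : Measurable fun y => ENNReal.ofReal (f y θ / f y θ₀) :=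
          ((hf.measurable _ hθΘ).div (hf.measurable _ hθ₀)).ennreal_ofReal
        rw [modelLaw, lintegral_withDensity_eq_lintegral_mul _ (hf.measurable _ hθ₀).ennreal_ofReal
          hm, ← hf.lintegral_eq_one θ hθΘ]
        refine lintegral_congr fun y => ?_
        have := hf.pos _ hθ₀ y
        rw [Pi.mul_apply, ← ENNReal.ofReal_mul this.le, mul_div_cancel₀ _ this.ne']
      have hrm : Measurable fun y => f y θ / f y θ₀ :=
        (hf.measurable _ hθΘ).div (hf.measurable _ hθ₀)
      have hrpos : ∀ y, 0 < f y θ / f y θ₀ := fun y =>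
        div_pos (hf.pos _ hθΘ y) (hf.pos _ hθ₀ y)
      have hrint : Integrable (fun y => f y θ / f y θ₀) (modelLaw μ f θ₀) := by
        refine ⟨hrm.aestronglyMeasurable, ?_⟩
        rw [hasFiniteIntegral_iff_ofReal (Eventually.of_forall fun y => (hrpos y).le), hratio]
        exact ENNReal.one_lt_top
      have hr1 : ∫ y, f y θ / f y θ₀ ∂(modelLaw μ f θ₀) = 1 := by
        rw [integral_eq_lintegral_of_nonneg_ae (Eventually.of_forall fun y => (hrpos y).le)
          hrm.aestronglyMeasurable, hratio, ENNReal.toReal_one]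
      have hle : ∀ᵐ y ∂(modelLaw μ f θ₀), s * inner ℝ u (score f θ₀ y)
          ≤ s ^ 2 * ((∑ _j : Fin p, ∑ _k : Fin p, G y) * ‖u‖ ^ 2) + (f y θ / f y θ₀ - 1) := by
        filter_upwards [hGb] with y hy
        set L : ℝ := ∑ _j : Fin p, ∑ _k : Fin p, G y with hL
        have hsc : ∀ x ∈ Metric.ball θ₀ r₀, ‖score f x y - score f θ₀ y‖ ≤ L * ‖x - θ₀‖ := by
          intro x hx
          refine (convex_ball θ₀ r₀).norm_image_sub_le_of_norm_hasFDerivWithin_le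
            (f := fun t => score f t y)
            (f' := fun t => -Matrix.toEuclideanCLM (𝕜 := ℝ) (obsInfo f t y))
            (fun t ht => (hasFDerivAt_score hO (hc y)
              (hreg.subset (hball ht))).hasFDerivWithinAt) (fun t ht => ?_)
            (Metric.mem_ball_self hr₀) hx
          rw [norm_neg]
          refine (norm_toEuclideanCLM_le _).trans ?_
          exact Finset.sum_le_sum fun j _ => Finset.sum_le_sum fun k _ => hy t (hball ht) j k
        have hL0 : 0 ≤ L := by
          have := (norm_nonneg _).trans (hsc _ hs)
          by_contra hneg
          push Not at hneg
          have h0 : ‖θ - θ₀‖ = 0 := by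
            nlinarith [norm_nonneg (θ - θ₀)]
          have : (0 : ℝ) ≤ L := by
            refine Finset.sum_nonneg fun j _ => Finset.sum_nonneg fun k _ => ?_
            exact (abs_nonneg _).trans (hy θ₀ (mem_of_mem_nhds hreg.nhds) j k)
          linarith
        have hexpand : ‖Real.log (f y θ) - Real.log (f y θ₀)
            - (InnerProductSpace.toDual ℝ (Param p) (score f θ₀ y)) (θ - θ₀)‖
              ≤ (L * ‖θ - θ₀‖) * ‖θ - θ₀‖ := by
          have hconv : Convex ℝ (Metric.closedBall θ₀ ‖θ - θ₀‖ ∩ Metric.ball θ₀ r₀) :=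
            (convex_closedBall _ _).inter (convex_ball _ _)
          refine hconv.norm_image_sub_le_of_norm_hasFDerivWithin_le'
            (f := fun t => Real.log (f y t))
            (f' := fun t => InnerProductSpace.toDual ℝ (Param p) (score f t y))
            (fun t ht => (hasGradientAt_logDensity hO (hc y)
              (hreg.subset (hball ht.2))).hasFDerivAt.hasFDerivWithinAt) (fun t ht => ?_)
            ⟨Metric.mem_closedBall_self (norm_nonneg _), Metric.mem_ball_self hr₀⟩ ⟨?_, hs⟩
          · rw [← map_sub, LinearIsometryEquiv.norm_map]
            refine (hsc t ht.2).trans ?_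
            gcongr
            simpa [dist_eq_norm] using ht.1
          · simp [dist_eq_norm]
        have hdiff : θ - θ₀ = s • u := by simp [hθ]
        rw [hdiff, InnerProductSpace.toDual_apply_apply, inner_smul_right, norm_smul,
          Real.norm_eq_abs, Real.norm_eq_abs, abs_of_pos hs0, real_inner_comm] at hexpand
        have h1 := (abs_le.mp hexpand).1
        have h2 : Real.log (f y θ) - Real.log (f y θ₀) ≤ f y θ / f y θ₀ - 1 := by
          rw [← Real.log_div (hf.pos _ hθΘ y).ne' (hf.pos _ hθ₀ y).ne']
          exact Real.log_le_sub_one_of_pos (hrpos y)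
        nlinarith
      have h3 := integral_mono_ae ((hint u).const_mul s)
        ((hKint.const_mul (s ^ 2)).add (hrint.sub (integrable_const 1))) hle
      rw [integral_add' (hKint.const_mul _) (hrint.sub (integrable_const 1)),
        integral_sub' hrint (integrable_const 1), hr1, integral_const_mul, integral_const_mul,
        ← hK] at h3
      simp only [integral_const, probReal_univ, smul_eq_mul, mul_one, sub_self, add_zero] at h3
      have h4 : s * ∫ y, inner ℝ u (score f θ₀ y) ∂(modelLaw μ f θ₀) ≤ s * (s * K) := by
        calc _ ≤ _ := h3
          _ = _ := by ring
      exact le_of_mul_le_mul_left h4 hs0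
    have hlim : Tendsto (fun s : ℝ => s * K) (𝓝[>] 0) (𝓝 0) := by
      have h : Continuous fun s : ℝ => s * K := by fun_prop
      simpa using (h.tendsto 0).mono_left nhdsWithin_le_nhds
    exact ge_of_tendsto hlim hstep
  refine le_antisymm (key u) ?_
  have := key (-u)
  simp only [inner_neg_left, integral_neg] at this
  linarith

end Regularity

/-! ### Linearization of a weighted maximum likelihood estimator -/

section MEstimation

variable {𝒴 κ : Type*} {p : ℕ}

/-- The weighted sum `N⁻¹ ∑_{i ∈ A} v_i h(y_i)`. -/
noncomputable def wAvg {N : ℕ} (y : Fin N → 𝒴) (A : Finset (Fin N)) (v : Fin N → ℝ)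
    (h : 𝒴 → ℝ) : ℝ :=
  (N : ℝ)⁻¹ * ∑ i ∈ A, v i * h (y i)

lemma wAvg_mono {N : ℕ} {y : Fin N → 𝒴} {A : Finset (Fin N)} {v : Fin N → ℝ}
    (hv : ∀ i, 0 ≤ v i) {h h' : 𝒴 → ℝ} (hle : ∀ i, h (y i) ≤ h' (y i)) :
    wAvg y A v h ≤ wAvg y A v h' := by
  unfold wAvg
  gcongr with i
  · exact hv i
  · exact hle i

lemma wAvg_congr {N : ℕ} {y : Fin N → 𝒴} {A : Finset (Fin N)} {v : Fin N → ℝ}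
    {h h' : 𝒴 → ℝ} (he : ∀ i, h (y i) = h' (y i)) :
    wAvg y A v h = wAvg y A v h' := by
  simp only [wAvg, he]

lemma wAvg_sub {N : ℕ} (y : Fin N → 𝒴) (A : Finset (Fin N)) (v : Fin N → ℝ) (h h' : 𝒴 → ℝ) :
    wAvg y A v (fun x => h x - h' x) = wAvg y A v h - wAvg y A v h' := by
  simp only [wAvg, mul_sub, Finset.sum_sub_distrib]

lemma abs_wAvg_le {N : ℕ} {y : Fin N → 𝒴} {A : Finset (Fin N)} {v : Fin N → ℝ}
    (hv : ∀ i, 0 ≤ v i) (h : 𝒴 → ℝ) : |wAvg y A v h| ≤ wAvg y A v fun x => |h x| := by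
  unfold wAvg
  rw [abs_mul, abs_of_nonneg (by positivity : (0 : ℝ) ≤ (N : ℝ)⁻¹)]
  gcongr
  refine (Finset.abs_sum_le_sum_abs _ _).trans (le_of_eq ?_)
  exact Finset.sum_congr rfl fun i _ => by rw [abs_mul, abs_of_nonneg (hv i)]

lemma wInfo_apply {N : ℕ} (f : 𝒴 → Param p → ℝ) (y : Fin N → 𝒴) (A : Finset (Fin N))
    (v : Fin N → ℝ) (θ : Param p) (j k : Fin p) :
    wInfo f y A v θ j k = wAvg y A v fun x => obsInfo f θ x j k := by
  simp [wInfo, wAvg, Matrix.sum_apply]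

lemma inner_wScore {N : ℕ} (f : 𝒴 → Param p → ℝ) (y : Fin N → 𝒴) (A : Finset (Fin N))
    (v : Fin N → ℝ) (θ u : Param p) :
    inner ℝ u (wScore f y A v θ) = wAvg y A v fun x => inner ℝ u (score f θ x) := by
  simp [wScore, wAvg, inner_smul_right, inner_sum]

variable [MeasurableSpace 𝒴]

/-- Along the filter `𝓖`, the weights `v` are nonnegative, the values `y` avoid every null set of
`law`, and the weighted sums of every integrable function converge to its integral. -/
structure WeightedLLN (𝓖 : Filter κ) (law : Measure 𝒴) (N : κ → ℕ) (y : ∀ k, Fin (N k) → 𝒴)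
    (A : ∀ k, Finset (Fin (N k))) (v : ∀ k, Fin (N k) → ℝ) : Prop where
  nonneg : ∀ᶠ k in 𝓖, ∀ i, 0 ≤ v k i
  ae : ∀ Q : 𝒴 → Prop, (∀ᵐ x ∂law, Q x) → ∀ᶠ k in 𝓖, ∀ i, Q (y k i)
  tendsto : ∀ h : 𝒴 → ℝ, Integrable h law →
    Tendsto (fun k => wAvg (y k) (A k) (v k) h) 𝓖 (𝓝 (∫ x, h x ∂law))

variable {μ : Measure 𝒴} {f : 𝒴 → Param p → ℝ} {Θ B : Set (Param p)} {θ₀ : Param p}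
  {𝓖 : Filter κ} {N : κ → ℕ} {y : ∀ k, Fin (N k) → 𝒴}
  {A : ∀ k, Finset (Fin (N k))} {v : ∀ k, Fin (N k) → ℝ} {θhat : κ → Param p}

/-- Wald's consistency argument: on each of the finitely many pieces that identifiability provides,
the weighted log-likelihood ratio is at most the weighted sum of `g j`, which is eventually negative,
so that the maximizer cannot lie there. -/
lemma tendsto_argmax (hθ₀ : θ₀ ∈ Θ) (hid : Identifiable μ f Θ θ₀)
    (hL : WeightedLLN 𝓖 (modelLaw μ f θ₀) N y A v)
    (hmax : ∀ᶠ k in 𝓖, IsArgmax (logLik f (y k) (A k) (v k)) Θ (θhat k)) :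
    Tendsto θhat 𝓖 (𝓝 θ₀) := by
  intro U hU
  obtain ⟨r, T, g, hcover, hg⟩ := hid U hU
  have h1 : ∀ᶠ k in 𝓖, ∀ j, wAvg (y k) (A k) (v k) (g j) < 0 := by
    rw [eventually_all]
    exact fun j => (hL.tendsto _ (hg j).1).eventually (gt_mem_nhds (hg j).2.1)
  have h2 : ∀ᶠ k in 𝓖, ∀ j i, ∀ θ ∈ Θ ∩ T j,
      Real.log (f (y k i) θ) - Real.log (f (y k i) θ₀) ≤ g j (y k i) := by
    rw [eventually_all]
    exact fun j => hL.ae _ (hg j).2.2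
  change ∀ᶠ k in 𝓖, θhat k ∈ U
  filter_upwards [hmax, h1, h2, hL.nonneg] with k hk h1 h2 hv
  by_contra hU'
  obtain ⟨j, hj⟩ := mem_iUnion.mp (hcover ⟨hk.1, hU'⟩)
  have h3 : logLik f (y k) (A k) (v k) θ₀ ≤ logLik f (y k) (A k) (v k) (θhat k) := hk.2 hθ₀
  have h4 : logLik f (y k) (A k) (v k) (θhat k) - logLik f (y k) (A k) (v k) θ₀
      ≤ wAvg (y k) (A k) (v k) (g j) := by
    have := wAvg_sub (y k) (A k) (v k) (fun x => Real.log (f x (θhat k)))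
      (fun x => Real.log (f x θ₀))
    refine this.symm.trans_le ?_
    exact wAvg_mono hv fun i => h2 j i _ ⟨hk.1, hj⟩
  linarith [h1 j]

section Derivatives

variable {n : ℕ} (y : Fin n → 𝒴) (A : Finset (Fin n)) (v : Fin n → ℝ)

lemma hasGradientAt_logLik (hf : IsDensityFamily μ f Θ) (hreg : ModelRegularity μ f Θ B θ₀)
    {θ : Param p} (hθ : θ ∈ interior Θ) :
    HasGradientAt (logLik f y A v) (wScore f y A v θ) θ := by
  have h1 : HasFDerivAt (logLik f y A v) ((n : ℝ)⁻¹ • ∑ i ∈ A, v i •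
      (InnerProductSpace.toDual ℝ (Param p) (score f θ (y i)))) θ :=
    (HasFDerivAt.fun_sum fun i _ => ((hasGradientAt_logDensity isOpen_interior
      (hreg.contDiffOn_log hf (y i)) hθ).hasFDerivAt.const_mul (v i))).const_mul _
  have h2 : InnerProductSpace.toDual ℝ (Param p) (wScore f y A v θ) = (n : ℝ)⁻¹ • ∑ i ∈ A, v i •
      (InnerProductSpace.toDual ℝ (Param p) (score f θ (y i))) := by simp [wScore]
  rw [hasGradientAt_iff_hasFDerivAt, h2]
  exact h1

lemma hasFDerivAt_wScore (hf : IsDensityFamily μ f Θ) (hreg : ModelRegularity μ f Θ B θ₀)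
    {θ : Param p} (hθ : θ ∈ interior Θ) :
    HasFDerivAt (wScore f y A v) (-Matrix.toEuclideanCLM (𝕜 := ℝ) (wInfo f y A v θ)) θ := by
  have h1 : HasFDerivAt (wScore f y A v) ((n : ℝ)⁻¹ • ∑ i ∈ A, v i •
      (-Matrix.toEuclideanCLM (𝕜 := ℝ) (obsInfo f θ (y i)))) θ :=
    (HasFDerivAt.fun_sum fun i _ => ((hasFDerivAt_score isOpen_interior
      (hreg.contDiffOn_log hf (y i)) hθ).fun_const_smul (v i))).fun_const_smul _
  have h2 : -Matrix.toEuclideanCLM (𝕜 := ℝ) (wInfo f y A v θ) = (n : ℝ)⁻¹ • ∑ i ∈ A, v i •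
      (-Matrix.toEuclideanCLM (𝕜 := ℝ) (obsInfo f θ (y i))) := by
    simp [wInfo, Finset.sum_neg_distrib]
  rw [h2]
  exact h1

end Derivatives

lemma integrable_obsInfo (hf : IsDensityFamily μ f Θ) (hreg : ModelRegularity μ f Θ B θ₀)
    (j k : Fin p) : Integrable (fun x => obsInfo f θ₀ x j k) (modelLaw μ f θ₀) := by
  obtain ⟨G, hG, hGb⟩ := hreg.info_dominated
  refine hG.mono' (measurable_obsInfo isOpen_interior (fun y => hreg.contDiffOn_log hf y)
    (fun t ht => hf.measurable t (interior_subset ht)) hreg.mem_interior j k).aestronglyMeasurable ?_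
  filter_upwards [hGb] with x hx using hx θ₀ (mem_of_mem_nhds hreg.nhds) j k

/-- A consistent maximizer satisfies `θ̂ - θ₀ = 𝓘(θ₀)⁻¹ S + o(S)`, with `S` the weighted score at
`θ₀`. The filter is arbitrary, so that the estimator and its bootstrap version are treated at
once. -/
theorem isLittleO_argmax_sub (hf : IsDensityFamily μ f Θ) (hreg : ModelRegularity μ f Θ B θ₀)
    (hid : Identifiable μ f Θ θ₀) (hL : WeightedLLN 𝓖 (modelLaw μ f θ₀) N y A v)
    (hmax : ∀ᶠ k in 𝓖, IsArgmax (logLik f (y k) (A k) (v k)) Θ (θhat k)) :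
    (fun k => θhat k - θ₀ - Matrix.toEuclideanCLM (𝕜 := ℝ) (info (modelLaw μ f θ₀) f θ₀)⁻¹
      (wScore f (y k) (A k) (v k) θ₀)) =o[𝓖] fun k => wScore f (y k) (A k) (v k) θ₀ := by
  have hcons := tendsto_argmax (interior_subset hreg.mem_interior) hid hL hmax
  set H := info (modelLaw μ f θ₀) f θ₀ with hH
  obtain ⟨r, ω, hr, hrB, hωint, hωlim, hω⟩ := exists_obsInfo_modulus hf hreg
  -- The mean value inequality for the score, around the linear map `-𝓘(θ₀)`: near `θ₀`, the weighted
  -- information differs from `𝓘(θ₀)` by the averaged modulus of continuity and the error at `θ₀`.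
  have key : ∀ ε > 0, ∀ᶠ k in 𝓖, ‖wScore f (y k) (A k) (v k) θ₀
      - Matrix.toEuclideanCLM (𝕜 := ℝ) H (θhat k - θ₀)‖ ≤ ε * ‖θhat k - θ₀‖ := by
    intro ε hε
    obtain ⟨n, hn⟩ := (hωlim.eventually (gt_mem_nhds (half_pos hε))).exists
    have h1 : ∀ᶠ k in 𝓖, wAvg (y k) (A k) (v k) (ω n) < ε / 2 :=
      (hL.tendsto _ (hωint n)).eventually (gt_mem_nhds hn)
    have h2 : ∀ᶠ k in 𝓖, ∑ a, ∑ b, |wInfo f (y k) (A k) (v k) θ₀ a b - H a b| < ε / 2 := by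
      have : Tendsto (fun k => ∑ a, ∑ b, |wInfo f (y k) (A k) (v k) θ₀ a b - H a b|) 𝓖
          (𝓝 (∑ a, ∑ b, |H a b - H a b|)) := by
        refine tendsto_finsetSum _ fun a _ => tendsto_finsetSum _ fun b _ => ?_
        simp only [wInfo_apply]
        exact ((hL.tendsto _ (integrable_obsInfo hf hreg a b)).sub_const _).abs
      refine this.eventually (gt_mem_nhds ?_)
      simpa using hε
    have h3 : ∀ᶠ k in 𝓖, θhat k ∈ Metric.ball θ₀ (r n) :=
      hcons (Metric.ball_mem_nhds _ (hr n))
    filter_upwards [h1, h2, h3, hmax, hL.nonneg, hL.ae _ (hω n)] with k h1 h2 h3 h4 hv h5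
    have hint : ∀ θ ∈ Metric.ball θ₀ (r n), θ ∈ interior Θ := fun θ hθ => hreg.subset (hrB n hθ)
    -- the first-order condition
    have hzero : wScore f (y k) (A k) (v k) (θhat k) = 0 := by
      have hloc : IsLocalMax (logLik f (y k) (A k) (v k)) (θhat k) :=
        h4.2.isLocalMax (mem_interior_iff_mem_nhds.mp (hint _ h3))
      have := hloc.hasFDerivAt_eq_zero
        (hasGradientAt_logLik (y k) (A k) (v k) hf hreg (hint _ h3)).hasFDerivAt
      simpa using this
    have hmv := (convex_ball θ₀ (r n)).norm_image_sub_le_of_norm_hasFDerivWithin_le'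
      (f := wScore f (y k) (A k) (v k)) (φ := -Matrix.toEuclideanCLM (𝕜 := ℝ) H) (C := ε)
      (fun θ hθ => (hasFDerivAt_wScore (y k) (A k) (v k) hf hreg (hint θ hθ)).hasFDerivWithinAt)
      (fun θ hθ => ?_) (Metric.mem_ball_self (hr n)) h3
    · rw [hzero, zero_sub, neg_apply, sub_neg_eq_add, neg_add_eq_sub,
        norm_sub_rev] at hmv
      exact hmv
    · rw [← neg_add_eq_sub, neg_neg, add_comm, neg_add_eq_sub, ← map_sub]
      refine (norm_toEuclideanCLM_le _).trans ?_
      have h6 : ∑ a, ∑ b, |wInfo f (y k) (A k) (v k) θ a b - wInfo f (y k) (A k) (v k) θ₀ a b|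
          ≤ wAvg (y k) (A k) (v k) (ω n) := by
        calc _ ≤ ∑ a, ∑ b, wAvg (y k) (A k) (v k)
              (fun x => |obsInfo f θ x a b - obsInfo f θ₀ x a b|) := by
              refine Finset.sum_le_sum fun a _ => Finset.sum_le_sum fun b _ => ?_
              rw [wInfo_apply, wInfo_apply, ← wAvg_sub]
              exact abs_wAvg_le hv _
          _ = wAvg (y k) (A k) (v k)
              (fun x => ∑ a, ∑ b, |obsInfo f θ x a b - obsInfo f θ₀ x a b|) := by
              simp only [wAvg, Finset.mul_sum]
              rw [Finset.sum_comm (s := A k)]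
              exact Finset.sum_congr rfl fun a _ => Finset.sum_comm
          _ ≤ _ := wAvg_mono hv fun i => h5 i θ hθ
      calc _ ≤ ∑ a, ∑ b, (|wInfo f (y k) (A k) (v k) θ a b - wInfo f (y k) (A k) (v k) θ₀ a b|
            + |wInfo f (y k) (A k) (v k) θ₀ a b - H a b|) := by
            refine Finset.sum_le_sum fun a _ => Finset.sum_le_sum fun b _ => ?_
            simp only [Matrix.sub_apply]
            rw [abs_sub_comm]
            exact abs_sub_le _ _ _
        _ ≤ ε := by
            simp only [Finset.sum_add_distrib]
            linarith
  -- Inverting `𝓘(θ₀)` turns the remainder `o(θ̂ - θ₀)` into `o(S)`: the bound forces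
  -- `‖θ̂ - θ₀‖ ≤ 2 K ‖S‖`.
  rw [Asymptotics.isLittleO_iff]
  intro c hc
  set Hi := Matrix.toEuclideanCLM (𝕜 := ℝ) H⁻¹ with hHi
  set K := ‖Hi‖ + 1 with hK
  have hK0 : 0 < K := by positivity
  have hinv : ∀ x, Hi (Matrix.toEuclideanCLM (𝕜 := ℝ) H x) = x := by
    intro x
    rw [hHi, ← mul_apply_eq_comp, ← map_mul,
      Matrix.nonsing_inv_mul _ ((Matrix.isUnit_iff_isUnit_det _).mp hreg.info_isUnit), map_one]
    rfl
  filter_upwards [key (min (1 / (2 * K)) (c / (2 * K ^ 2))) (by positivity)] with k hk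
  set S := wScore f (y k) (A k) (v k) θ₀
  set d := θhat k - θ₀
  set ε := min (1 / (2 * K)) (c / (2 * K ^ 2)) with hε
  have hε0 : 0 ≤ ε := by positivity
  have hε1 : K * ε ≤ 1 / 2 := by
    have := min_le_left (1 / (2 * K)) (c / (2 * K ^ 2))
    calc K * ε ≤ K * (1 / (2 * K)) := by gcongr
      _ = 1 / 2 := by field_simp
  have hε2 : 2 * K ^ 2 * ε ≤ c := by
    have := min_le_right (1 / (2 * K)) (c / (2 * K ^ 2))
    calc 2 * K ^ 2 * ε ≤ 2 * K ^ 2 * (c / (2 * K ^ 2)) := by gcongr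
      _ = c := by field_simp
  have e1 : d - Hi S = -Hi (S - Matrix.toEuclideanCLM (𝕜 := ℝ) H d) := by
    rw [map_sub, hinv]; abel
  have e2 : ‖d - Hi S‖ ≤ K * ε * ‖d‖ := by
    rw [e1, norm_neg]
    refine (Hi.le_opNorm _).trans ?_
    rw [mul_assoc]
    gcongr
    linarith
  have e3 : ‖Hi S‖ ≤ K * ‖S‖ := (Hi.le_opNorm _).trans (by gcongr; linarith)
  have e4 : ‖d‖ ≤ ‖d - Hi S‖ + ‖Hi S‖ := by
    simpa using norm_add_le (d - Hi S) (Hi S)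
  have e5 : ‖d‖ ≤ 2 * (K * ‖S‖) := by nlinarith [norm_nonneg d]
  calc ‖d - Hi S‖ ≤ K * ε * ‖d‖ := e2
    _ ≤ K * ε * (2 * (K * ‖S‖)) := by gcongr
    _ = (2 * K ^ 2 * ε) * ‖S‖ := by ring
    _ ≤ c * ‖S‖ := by gcongr

end MEstimation

/-! ### The bootstrap distribution: generating function and moments -/

section BootLaw

variable {N : ℕ} {A : Finset (Fin N)} {π : Fin N → unitInterval}

lemma multinomialLaw_bind {β : Type*} [MeasurableSpace β] (K : ℕ) (A : Finset (Fin N))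
    (q : Fin N → ℝ) (κ : (Fin N → ℕ) → Measure β) :
    (multinomialLaw K A q).bind κ = ∑ k ∈ Finset.piAntidiag A K,
      ENNReal.ofReal (Nat.multinomial A k * ∏ i ∈ A, q i ^ k i) • κ k := by
  ext s hs
  rw [Measure.bind_apply hs Measurable.of_discrete.aemeasurable, multinomialLaw,
    lintegral_finsetSum_measure, Measure.finsetSum_apply]
  refine Finset.sum_congr rfl fun k _ => ?_
  rw [lintegral_smul_measure, lintegral_dirac, Measure.smul_apply]

/-- Every unit is counted at most as often as there are trials. -/
lemma ae_bootLaw_le : ∀ᵐ m ∂(bootLaw A π), ∀ i, m i ≤ N := by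
  rw [bootLaw, multinomialLaw_bind, ae_iff, Measure.finsetSum_apply]
  refine Finset.sum_eq_zero fun k hk => ?_
  rw [Measure.smul_apply, smul_eq_mul, mul_eq_zero]
  right
  rw [← ae_iff, ae_all_iff]
  intro i
  have hki : k i ≤ N := by
    by_cases hi : i ∈ A
    · rw [← (Finset.mem_piAntidiag.mp hk).1]
      exact Finset.single_le_sum (f := k) (fun _ _ => Nat.zero_le _) hi
    · have : k i = 0 := by
        by_contra h
        exact hi ((Finset.mem_piAntidiag.mp hk).2 i h)
      omega
  have h1 : ∀ᵐ x ∂(binomial (k i) (π i)), x ≤ N := by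
    filter_upwards [ae_le_of_hasLaw_binomial (HasLaw.id (μ := binomial (k i) (π i)))] with x hx
    exact le_trans hx hki
  exact (measurePreserving_eval (fun i => binomial (k i) (π i)) i).quasiMeasurePreserving.ae h1

instance : IsFiniteMeasure (bootLaw A π) := by
  rw [bootLaw, multinomialLaw_bind]
  refine ⟨?_⟩
  rw [Measure.finsetSum_apply]
  exact ENNReal.sum_lt_top.mpr fun k _ => by
    simp [Measure.smul_apply, ENNReal.mul_lt_top]

lemma integrable_bootLaw {E : Type*} [NormedAddCommGroup E] (g : (Fin N → ℕ) → E) :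
    Integrable g (bootLaw A π) := by
  have hfin : {m : Fin N → ℕ | ∀ i, m i ∈ Set.Iic N}.Finite :=
    Set.Finite.pi' fun _ => finite_Iic N
  obtain ⟨C, hC⟩ := (hfin.image fun m => ‖g m‖).bddAbove
  refine Integrable.of_bound AEStronglyMeasurable.of_discrete C ?_
  filter_upwards [ae_bootLaw_le (A := A) (π := π)] with m hm
  exact hC (mem_image_of_mem _ hm)

lemma integral_binomial_pow (n : ℕ) (q : unitInterval) (z : ℂ) :
    ∫ x, z ^ x ∂(binomial n q) = (1 - q + q * z) ^ n := by
  have h : Finset.Iic n = Finset.range (n + 1) := by ext; simp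
  rw [integral_binomial, h, add_comm (1 - (q : ℂ)), add_pow]
  refine Finset.sum_congr rfl fun k _ => ?_
  rw [Complex.real_smul]
  push_cast
  ring

/-- The total of the sampling weights, an estimate of the population size. -/
noncomputable def weightSum (A : Finset (Fin N)) (π : Fin N → unitInterval) : ℝ :=
  ∑ j ∈ A, weight π j

lemma weight_mul_self (hπ : ∀ i, 0 < (π i : ℝ)) (i : Fin N) : weight π i * (π i : ℝ) = 1 :=
  inv_mul_cancel₀ (hπ i).ne'

lemma weight_pos (hπ : ∀ i, 0 < (π i : ℝ)) (i : Fin N) : 0 < weight π i :=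
  inv_pos.mpr (hπ i)

lemma weightSum_pos (hπ : ∀ i, 0 < (π i : ℝ)) (hA : A.Nonempty) : 0 < weightSum A π :=
  Finset.sum_pos (fun i _ => weight_pos hπ i) hA

/-- The probability generating function of the bootstrap counts. A trial selects the unit `i` with
probability `w_i / ∑ w_j` and then retains it with probability `π_i`, so that each unit in `A` is
selected and retained with the same probability `1 / ∑ w_j`. -/
lemma integral_prod_pow_bootLaw (hπ : ∀ i, 0 < (π i : ℝ)) (hA : A.Nonempty) (z : Fin N → ℂ) :
    ∫ m, ∏ i ∈ A, z i ^ m i ∂(bootLaw A π)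
      = (1 + (weightSum A π : ℂ)⁻¹ * ∑ i ∈ A, (z i - 1)) ^ N := by
  classical
  have hW := weightSum_pos hπ hA
  have hq : ∀ i, 0 ≤ weight π i / weightSum A π := fun i =>
    div_nonneg (weight_pos hπ i).le hW.le
  have hfin : ∀ k : Fin N → ℕ, Integrable (fun m : Fin N → ℕ => ∏ i ∈ A, z i ^ m i)
      (Measure.pi fun i => binomial (k i) (π i)) := by
    intro k
    have := Integrable.fintype_prod (μ := fun i => binomial (k i) (π i))
      (f := fun i (x : ℕ) => if i ∈ A then z i ^ x else 1) (fun i => integrable_binomial _)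
    refine this.congr (Eventually.of_forall fun m => ?_)
    simp [Finset.prod_ite_mem]
  rw [bootLaw, multinomialLaw_bind, integral_finsetSum_measure
    (fun k _ => (hfin k).smul_measure ENNReal.ofReal_ne_top)]
  -- given the multinomial counts, the binomial generating functions multiply
  have hinner : ∀ k : Fin N → ℕ, ∫ m, ∏ i ∈ A, z i ^ m i ∂(Measure.pi fun i => binomial (k i) (π i))
      = ∏ i ∈ A, (1 - (π i : ℝ) + (π i : ℝ) * z i : ℂ) ^ k i := by
    intro k
    have h1 : ∀ m : Fin N → ℕ, ∏ i ∈ A, z i ^ m i = ∏ i, if i ∈ A then z i ^ m i else 1 := by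
      intro m; simp [Finset.prod_ite_mem]
    simp_rw [h1]
    rw [integral_fintype_prod_eq_prod (f := fun i (x : ℕ) => if i ∈ A then z i ^ x else 1)]
    have h2 : ∀ i, ∫ x : ℕ, (if i ∈ A then z i ^ x else 1) ∂(binomial (k i) (π i))
        = if i ∈ A then (1 - (π i : ℝ) + (π i : ℝ) * z i : ℂ) ^ k i else 1 := by
      intro i
      split_ifs
      · exact integral_binomial_pow _ _ _
      · simp
    simp_rw [h2]
    simp [Finset.prod_ite_mem]
  have hsum : (∑ i ∈ A, ((weight π i / weightSum A π : ℝ) : ℂ)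
        * (1 - (π i : ℝ) + (π i : ℝ) * z i))
      = 1 + (weightSum A π : ℂ)⁻¹ * ∑ i ∈ A, (z i - 1) := by
    have hWc : (weightSum A π : ℂ) ≠ 0 := by exact_mod_cast hW.ne'
    have h1 : (1 : ℂ) = (weightSum A π : ℂ)⁻¹ * ∑ i ∈ A, (weight π i : ℂ) := by
      rw [← Complex.ofReal_sum]
      exact (inv_mul_cancel₀ hWc).symm
    conv_rhs => rw [h1]
    rw [← mul_add, ← Finset.sum_add_distrib, Finset.mul_sum]
    refine Finset.sum_congr rfl fun i _ => ?_
    have h2 : (weight π i : ℂ) * ((π i : ℝ) : ℂ) = 1 := by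
      exact_mod_cast weight_mul_self hπ i
    push_cast
    rw [← h1]
    linear_combination (weightSum A π : ℂ)⁻¹ * (z i - 1) * h2
  rw [← hsum, Finset.sum_pow_eq_sum_piAntidiag]
  refine Finset.sum_congr rfl fun k _ => ?_
  rw [integral_smul_measure, hinner, ← weightSum, ENNReal.toReal_ofReal
    (mul_nonneg (Nat.cast_nonneg _) (Finset.prod_nonneg fun i _ => pow_nonneg (hq i) _)),
    Complex.real_smul]
  push_cast
  rw [mul_assoc, ← Finset.prod_mul_distrib]
  congr 1
  refine Finset.prod_congr rfl fun i _ => ?_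
  rw [mul_pow]

lemma isProbabilityMeasure_bootLaw (hπ : ∀ i, 0 < (π i : ℝ)) (hA : A.Nonempty) :
    IsProbabilityMeasure (bootLaw A π) := by
  have h := integral_prod_pow_bootLaw hπ hA (fun _ => 1)
  simp only [one_pow, Finset.prod_const_one, integral_const, sub_self, Finset.sum_const_zero,
    mul_zero, add_zero, Complex.real_smul, mul_one] at h
  refine ⟨?_⟩
  have h1 : (bootLaw A π).real univ = 1 := by exact_mod_cast h
  rw [← ENNReal.ofReal_toReal (measure_ne_top (bootLaw A π) univ)]
  rw [measureReal_def] at h1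
  simp [h1]

lemma integral_exp_mul_I_bootLaw (hπ : ∀ i, 0 < (π i : ℝ)) (hA : A.Nonempty) (c : Fin N → ℝ) :
    ∫ m, Complex.exp (((∑ i ∈ A, c i * m i : ℝ) : ℂ) * Complex.I) ∂(bootLaw A π)
      = (1 + (weightSum A π : ℂ)⁻¹ * ∑ i ∈ A, (Complex.exp (c i * Complex.I) - 1)) ^ N := by
  rw [← integral_prod_pow_bootLaw hπ hA]
  refine integral_congr_ae (Eventually.of_forall fun m => ?_)
  simp only [← Complex.exp_nat_mul]
  rw [← Complex.exp_sum]
  push_cast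
  rw [Finset.sum_mul]
  exact congrArg _ (Finset.sum_congr rfl fun i _ => by ring)

lemma mgf_bootLaw (hπ : ∀ i, 0 < (π i : ℝ)) (hA : A.Nonempty) (c : Fin N → ℝ) :
    mgf (fun m : Fin N → ℕ => ∑ i ∈ A, c i * m i) (bootLaw A π)
      = fun s => (1 + (weightSum A π)⁻¹ * ∑ i ∈ A, (Real.exp (c i * s) - 1)) ^ N := by
  ext s
  have h := integral_prod_pow_bootLaw hπ hA (fun i => (Real.exp (c i * s) : ℂ))
  rw [mgf]
  have h2 : ∀ m : Fin N → ℕ, ∏ i ∈ A, (Real.exp (c i * s) : ℂ) ^ m i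
      = ((Real.exp (s * ∑ i ∈ A, c i * m i) : ℝ) : ℂ) := by
    intro m
    rw [Finset.mul_sum, Real.exp_sum]
    push_cast
    refine Finset.prod_congr rfl fun i _ => ?_
    rw [← Complex.exp_nat_mul]
    congr 1; ring
  simp_rw [h2] at h
  rw [integral_complex_ofReal] at h
  exact_mod_cast h

lemma zero_mem_interior_integrableExpSet_bootLaw (X : (Fin N → ℕ) → ℝ) :
    (0 : ℝ) ∈ interior (integrableExpSet X (bootLaw A π)) := by
  have : integrableExpSet X (bootLaw A π) = univ :=
    eq_univ_of_forall fun t => integrable_bootLaw _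
  simp [this]

lemma hasDerivAt_mgf_bootLaw (W : ℝ) (c : Fin N → ℝ) (s : ℝ) :
    HasDerivAt (fun s => 1 + W⁻¹ * ∑ i ∈ A, (Real.exp (c i * s) - 1))
      (W⁻¹ * ∑ i ∈ A, c i * Real.exp (c i * s)) s := by
  refine ((HasDerivAt.fun_sum fun i _ => ?_).const_mul W⁻¹).const_add 1
  have h := (((hasDerivAt_id s).const_mul (c i)).exp).sub_const 1
  simpa [mul_comm] using h

/-- The bootstrap mean of a linear function of the counts. -/
lemma integral_bootLaw (hπ : ∀ i, 0 < (π i : ℝ)) (hA : A.Nonempty) (c : Fin N → ℝ) :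
    ∫ m, ∑ i ∈ A, c i * m i ∂(bootLaw A π) = N / weightSum A π * ∑ i ∈ A, c i := by
  have h1 := deriv_mgf_zero (zero_mem_interior_integrableExpSet_bootLaw (A := A) (π := π)
    (fun m : Fin N → ℕ => ∑ i ∈ A, c i * m i))
  rw [← h1, mgf_bootLaw hπ hA, ((hasDerivAt_mgf_bootLaw (A := A) (weightSum A π) c 0).fun_pow N).deriv]
  simp
  ring

/-- A bound for the bootstrap variance of a linear function of the counts. -/
lemma integral_sq_bootLaw_le (hπ : ∀ i, 0 < (π i : ℝ)) (hA : A.Nonempty) (c : Fin N → ℝ) :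
    ∫ m, (∑ i ∈ A, c i * m i - N / weightSum A π * ∑ i ∈ A, c i) ^ 2 ∂(bootLaw A π)
      ≤ N / weightSum A π * ∑ i ∈ A, c i ^ 2 := by
  have := isProbabilityMeasure_bootLaw hπ hA
  set W := weightSum A π with hW
  set X : (Fin N → ℕ) → ℝ := fun m => ∑ i ∈ A, c i * m i with hX
  set b : ℝ := N / W * ∑ i ∈ A, c i with hb
  have hmean : ∫ m, X m ∂(bootLaw A π) = b := integral_bootLaw hπ hA c
  -- the second moment as a second derivative of the moment generating function
  have hsq : ∫ m, X m ^ 2 ∂(bootLaw A π) = N * ((N - 1 : ℕ) * (W⁻¹ * ∑ i ∈ A, c i) ^ 2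
      + W⁻¹ * ∑ i ∈ A, c i ^ 2) := by
    have h1 := iteratedDeriv_mgf_zero (zero_mem_interior_integrableExpSet_bootLaw (A := A)
      (π := π) X) 2
    have h2 : ∀ s, HasDerivAt (fun s => W⁻¹ * ∑ i ∈ A, c i * Real.exp (c i * s))
        (W⁻¹ * ∑ i ∈ A, c i * (c i * Real.exp (c i * s))) s := by
      intro s
      refine (HasDerivAt.fun_sum fun i _ => ?_).const_mul W⁻¹
      have h := (((hasDerivAt_id s).const_mul (c i)).exp).const_mul (c i)
      simpa [mul_comm, mul_assoc, mul_left_comm] using h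
    rw [iteratedDeriv_succ, iteratedDeriv_one, hX, mgf_bootLaw hπ hA] at h1
    have h3 : deriv (fun s => (1 + W⁻¹ * ∑ i ∈ A, (Real.exp (c i * s) - 1)) ^ N)
        = fun s => (N * (1 + W⁻¹ * ∑ i ∈ A, (Real.exp (c i * s) - 1)) ^ (N - 1))
          * (W⁻¹ * ∑ i ∈ A, c i * Real.exp (c i * s)) := by
      ext s
      exact ((hasDerivAt_mgf_bootLaw (A := A) W c s).fun_pow N).deriv
    rw [h3, ((((hasDerivAt_mgf_bootLaw (A := A) W c 0).fun_pow (N - 1)).const_mul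
      (N : ℝ)).fun_mul (h2 0)).deriv] at h1
    simp only [Pi.pow_apply] at h1
    have h4 : ∑ i ∈ A, c i ^ 2 = ∑ i ∈ A, c i * c i := by simp only [sq]
    rw [← h1, h4]
    simp
    ring
  have hvar : ∫ m, (X m - b) ^ 2 ∂(bootLaw A π) = ∫ m, X m ^ 2 ∂(bootLaw A π) - b ^ 2 := by
    have h1 : ∀ m, (X m - b) ^ 2 = X m ^ 2 - 2 * b * X m + b ^ 2 := fun m => by ring
    simp_rw [h1]
    rw [integral_add (integrable_bootLaw _) (integrable_bootLaw _),
      integral_sub (integrable_bootLaw _) (integrable_bootLaw _), integral_const_mul, hmean]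
    simp
    ring
  rw [hvar, hsq, hb]
  have h1 : ((N - 1 : ℕ) : ℝ) ≤ N := by exact_mod_cast Nat.sub_le N 1
  have h2 : (N : ℝ) * ((N - 1 : ℕ) * (W⁻¹ * ∑ i ∈ A, c i) ^ 2)
      ≤ N * (N * (W⁻¹ * ∑ i ∈ A, c i) ^ 2) := by gcongr
  calc _ = (N : ℝ) * ((N - 1 : ℕ) * (W⁻¹ * ∑ i ∈ A, c i) ^ 2)
        - N * (N * (W⁻¹ * ∑ i ∈ A, c i) ^ 2) + N / W * ∑ i ∈ A, c i ^ 2 := by ring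
    _ ≤ _ := by linarith

end BootLaw

/-! ### Asymptotics of the bootstrap, given the sample -/

section Truncation

variable {𝒴 κ : Type*} [MeasurableSpace 𝒴] {law : Measure 𝒴}

/-- An integrable function is bounded up to a remainder with small mean. -/
lemma exists_truncation {h : 𝒴 → ℝ} (hm : Measurable h) (hint : Integrable h law) {δ : ℝ}
    (hδ : 0 < δ) :
    ∃ (h₁ r : 𝒴 → ℝ) (M : ℝ), Measurable h₁ ∧ Measurable r ∧ (∀ x, h x = h₁ x + r x) ∧
      (∀ x, |h₁ x| ≤ M) ∧ Integrable r law ∧ ∫ x, |r x| ∂law < δ := by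
  have hset : ∀ n : ℕ, MeasurableSet {x | |h x| ≤ n} := fun n =>
    measurableSet_le hm.abs measurable_const
  have hlim : Tendsto (fun n : ℕ => ∫ x, |({x | |h x| ≤ n}ᶜ).indicator h x| ∂law) atTop
      (𝓝 (∫ _, (0 : ℝ) ∂law)) := by
    refine tendsto_integral_of_dominated_convergence (fun x => |h x|)
      (fun n => ((hm.indicator (hset n).compl).abs).aestronglyMeasurable) hint.abs
      (fun n => Eventually.of_forall fun x => ?_) (Eventually.of_forall fun x => ?_)
    · rw [Real.norm_eq_abs, abs_abs]
      by_cases hx : x ∈ {x | |h x| ≤ n}ᶜ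
      · rw [indicator_of_mem hx]
      · rw [indicator_of_notMem hx]; simp
    · refine tendsto_const_nhds.congr' ?_
      obtain ⟨n₀, hn₀⟩ := exists_nat_ge |h x|
      filter_upwards [eventually_ge_atTop n₀] with n hn
      rw [indicator_of_notMem, abs_zero]
      simp only [mem_compl_iff, mem_ofPred_eq, not_not]
      exact hn₀.trans (by exact_mod_cast hn)
  rw [integral_zero] at hlim
  obtain ⟨n, hn⟩ := (hlim.eventually (gt_mem_nhds hδ)).exists
  refine ⟨{x | |h x| ≤ n}.indicator h, {x | |h x| ≤ n}ᶜ.indicator h, n,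
    hm.indicator (hset n), hm.indicator (hset n).compl, fun x => ?_, fun x => ?_,
    hint.indicator (hset n).compl, hn⟩
  · exact (congrFun (indicator_self_add_compl {x | |h x| ≤ (n : ℝ)} h) x).symm
  · by_cases hx : x ∈ {x | |h x| ≤ n}
    · rw [indicator_of_mem hx]; exact hx
    · rw [indicator_of_notMem hx]; simp

variable {𝓖 : Filter κ} {N : κ → ℕ} {y : ∀ k, Fin (N k) → 𝒴}
  {A : ∀ k, Finset (Fin (N k))} {v : ∀ k, Fin (N k) → ℝ}

/-- In the law of large numbers it is enough to consider measurable functions, because the values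
avoid null sets. -/
lemma WeightedLLN.of_measurable (hv : ∀ᶠ k in 𝓖, ∀ i, 0 ≤ v k i)
    (hae : ∀ Q : 𝒴 → Prop, (∀ᵐ x ∂law, Q x) → ∀ᶠ k in 𝓖, ∀ i, Q (y k i))
    (h : ∀ h : 𝒴 → ℝ, Measurable h → Integrable h law →
      Tendsto (fun k => wAvg (y k) (A k) (v k) h) 𝓖 (𝓝 (∫ x, h x ∂law))) :
    WeightedLLN 𝓖 law N y A v where
  nonneg := hv
  ae := hae
  tendsto g hg := by
    rw [integral_congr_ae hg.aestronglyMeasurable.ae_eq_mk]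
    refine (h _ hg.aestronglyMeasurable.stronglyMeasurable_mk.measurable
      (hg.congr hg.aestronglyMeasurable.ae_eq_mk)).congr' ?_
    filter_upwards [hae _ hg.aestronglyMeasurable.ae_eq_mk] with k hk
    exact wAvg_congr fun i => (hk i).symm

end Truncation

section BootCLT

variable {κ : Type*} {𝓕 : Filter κ} {N : κ → ℕ} {A : ∀ k, Finset (Fin (N k))}
  {π : ∀ k, Fin (N k) → unitInterval}

lemma one_le_weight {N : ℕ} {π : Fin N → unitInterval} (hπ : ∀ i, 0 < (π i : ℝ)) (i : Fin N) :
    1 ≤ weight π i :=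
  (one_le_inv₀ (hπ i)).mpr (π i).2.2

lemma card_le_weightSum {N : ℕ} {A : Finset (Fin N)} {π : Fin N → unitInterval}
    (hπ : ∀ i, 0 < (π i : ℝ)) : (A.card : ℝ) ≤ weightSum A π := by
  rw [weightSum, Finset.card_eq_sum_ones]
  push_cast
  exact Finset.sum_le_sum fun i _ => one_le_weight hπ i

/-- Comparison of the bootstrap characteristic function of a centered linear function of the
counts with a Gaussian one. Both are `N`-th powers, of `x = 1 + W⁻¹ ∑ (exp (i c_i) - 1)` and of
`exp b` with `b` the second-order expansion of `x - 1`, up to the same phase. -/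
lemma norm_charFun_bootLaw_sub_le {N : ℕ} {A : Finset (Fin N)} {π : Fin N → unitInterval}
    (hπ : ∀ i, 0 < (π i : ℝ)) (hA : A.Nonempty) (hN : 0 < N) (c : Fin N → ℝ) :
    ‖∫ m, Complex.exp (((∑ i ∈ A, c i * m i - N / weightSum A π * ∑ i ∈ A, c i : ℝ) : ℂ)
        * Complex.I) ∂(bootLaw A π)
      - ((Real.exp (-(N / weightSum A π * ((∑ i ∈ A, c i ^ 2) / 2))) : ℝ) : ℂ)‖
      ≤ 4 * (N / weightSum A π) * ∑ i ∈ A, |c i| ^ 3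
        + 6 * (N / weightSum A π) ^ 2 * ((∑ i ∈ A, c i) ^ 2 / N)
        + 2 * (N / weightSum A π) ^ 2 * ((∑ i ∈ A, c i ^ 2) ^ 2 / N) := by
  set W := weightSum A π with hWdef
  have hW : 0 < W := weightSum_pos hπ hA
  set σ : ℝ := ∑ i ∈ A, c i with hσ
  set Q : ℝ := ∑ i ∈ A, c i ^ 2 with hQ
  have hQ0 : 0 ≤ Q := Finset.sum_nonneg fun i _ => sq_nonneg _
  have hN' : (0 : ℝ) < N := by exact_mod_cast hN
  set x : ℂ := 1 + (W : ℂ)⁻¹ * ∑ i ∈ A, (Complex.exp (c i * Complex.I) - 1) with hx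
  set b : ℂ := (W : ℂ)⁻¹ * (σ * Complex.I - Q / 2) with hb
  have hbre : b.re ≤ 0 := by
    have : b = ((-(W⁻¹ * (Q / 2)) : ℝ) : ℂ) + ((W⁻¹ * σ : ℝ) : ℂ) * Complex.I := by
      rw [hb]; push_cast; ring
    have h0 : 0 ≤ W⁻¹ * (Q / 2) := by positivity
    rw [this, Complex.add_re, Complex.ofReal_re, Complex.re_ofReal_mul, Complex.I_re]
    linarith
  have hnW : ‖(W : ℂ)⁻¹‖ = W⁻¹ := by
    rw [norm_inv, Complex.norm_real, Real.norm_eq_abs, abs_of_pos hW]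
  have hbn : ‖b‖ ≤ W⁻¹ * (|σ| + Q / 2) := by
    rw [hb, norm_mul, hnW]
    gcongr
    refine (norm_sub_le _ _).trans ?_
    simp [abs_of_nonneg hQ0]
  have hx1 : ‖x‖ ≤ 1 := by
    have h1 : x = ((1 - W⁻¹ * A.card : ℝ) : ℂ) + (W : ℂ)⁻¹ * ∑ i ∈ A, Complex.exp (c i * Complex.I) := by
      rw [hx, Finset.sum_sub_distrib]
      simp
      ring
    have h2 : ‖∑ i ∈ A, Complex.exp (c i * Complex.I)‖ ≤ A.card := by
      refine (norm_sum_le _ _).trans ?_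
      simp [Complex.norm_exp_ofReal_mul_I]
    have h3 : W⁻¹ * A.card ≤ 1 := by
      rw [inv_mul_le_one₀ hW]
      exact card_le_weightSum hπ
    rw [h1]
    refine (norm_add_le _ _).trans ?_
    rw [norm_mul, hnW, Complex.norm_real, Real.norm_eq_abs, abs_of_nonneg (by linarith)]
    have : W⁻¹ * ‖∑ i ∈ A, Complex.exp (c i * Complex.I)‖ ≤ W⁻¹ * A.card := by gcongr
    linarith
  have hy1 : ‖Complex.exp b‖ ≤ 1 := by
    rw [Complex.norm_exp]; exact Real.exp_le_one_iff.mpr hbre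
  have hpow : ‖x ^ N - Complex.exp b ^ N‖ ≤ N * ‖x - Complex.exp b‖ := by
    have := norm_prod_sub_prod_le (Finset.univ : Finset (Fin N)) (fun _ => x)
      (fun _ => Complex.exp b) (fun _ _ => hx1) (fun _ _ => hy1)
    simpa using this
  have hxb : ‖x - 1 - b‖ ≤ W⁻¹ * (4 * ∑ i ∈ A, |c i| ^ 3) := by
    have h1 : x - 1 - b = (W : ℂ)⁻¹ * ∑ i ∈ A, (Complex.exp (c i * Complex.I) - 1
        - (c i * Complex.I - c i ^ 2 / 2)) := by
      rw [hx, hb, Finset.sum_sub_distrib (f := fun i => Complex.exp (c i * Complex.I) - 1),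
        Finset.sum_sub_distrib (f := fun i => (c i : ℂ) * Complex.I), ← Finset.sum_mul,
        ← Finset.sum_div, hσ, hQ]
      push_cast
      ring
    rw [h1, norm_mul, hnW, Finset.mul_sum]
    gcongr
    exact (norm_sum_le _ _).trans (Finset.sum_le_sum fun i _ => norm_exp_mul_I_sub_taylor_le _)
  have hyb := norm_exp_sub_one_sub_le hbre
  have hxy : ‖x - Complex.exp b‖ ≤ W⁻¹ * (4 * ∑ i ∈ A, |c i| ^ 3) + 3 * ‖b‖ ^ 2 := by
    have h1 : x - Complex.exp b = (x - 1 - b) - (Complex.exp b - 1 - b) := by ring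
    rw [h1]
    exact (norm_sub_le _ _).trans (add_le_add hxb hyb)
  have hb2 : ‖b‖ ^ 2 ≤ W⁻¹ ^ 2 * (2 * σ ^ 2 + Q ^ 2 / 2) := by
    calc ‖b‖ ^ 2 ≤ (W⁻¹ * (|σ| + Q / 2)) ^ 2 := by gcongr
      _ = W⁻¹ ^ 2 * (|σ| + Q / 2) ^ 2 := by ring
      _ ≤ _ := by
        gcongr
        nlinarith [sq_nonneg (|σ| - Q / 2), sq_abs σ]
  have hI : ∫ m, Complex.exp (((∑ i ∈ A, c i * m i - N / W * σ : ℝ) : ℂ) * Complex.I)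
      ∂(bootLaw A π) = x ^ N * Complex.exp (((-(N / W * σ) : ℝ) : ℂ) * Complex.I) := by
    rw [hx, hWdef, ← integral_exp_mul_I_bootLaw hπ hA, ← integral_mul_const]
    refine integral_congr_ae (Eventually.of_forall fun m => ?_)
    simp only
    rw [← Complex.exp_add]
    congr 1
    push_cast
    ring
  have hE : ((Real.exp (-(N / W * (Q / 2))) : ℝ) : ℂ)
      = Complex.exp b ^ N * Complex.exp (((-(N / W * σ) : ℝ) : ℂ) * Complex.I) := by
    rw [← Complex.exp_nat_mul, ← Complex.exp_add, Complex.ofReal_exp, hb]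
    congr 1
    push_cast
    ring
  rw [hI, hE, ← sub_mul, norm_mul, Complex.norm_exp_ofReal_mul_I, mul_one]
  refine hpow.trans ?_
  calc (N : ℝ) * ‖x - Complex.exp b‖
      ≤ N * (W⁻¹ * (4 * ∑ i ∈ A, |c i| ^ 3) + 3 * (W⁻¹ ^ 2 * (2 * σ ^ 2 + Q ^ 2 / 2))) := by
        gcongr
        linarith
    _ = 4 * (N / W) * ∑ i ∈ A, |c i| ^ 3 + 6 * (N / W) ^ 2 * (σ ^ 2 / N)
        + 3 / 2 * (N / W) ^ 2 * (Q ^ 2 / N) := by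
        field_simp
        ring
    _ ≤ _ := by
        have : 0 ≤ (N / W) ^ 2 * (Q ^ 2 / N) := by positivity
        nlinarith

/-- The central limit theorem for the bootstrap, in terms of characteristic functions. -/
lemma tendsto_charFun_bootLaw (hN : Tendsto (fun k => (N k : ℝ)) 𝓕 atTop)
    (hπ : ∀ᶠ k in 𝓕, ∀ i, 0 < (π k i : ℝ)) (hA : ∀ᶠ k in 𝓕, (A k).Nonempty)
    (hW : Tendsto (fun k => N k / weightSum (A k) (π k)) 𝓕 (𝓝 1))
    {c : ∀ k, Fin (N k) → ℝ} {s : ℝ}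
    (h1 : Tendsto (fun k => (∑ i ∈ A k, c k i) ^ 2 / N k) 𝓕 (𝓝 0))
    (h2 : Tendsto (fun k => ∑ i ∈ A k, c k i ^ 2) 𝓕 (𝓝 s))
    (h3 : Tendsto (fun k => ∑ i ∈ A k, |c k i| ^ 3) 𝓕 (𝓝 0)) :
    Tendsto (fun k => ∫ m, Complex.exp (((∑ i ∈ A k, c k i * m i
      - N k / weightSum (A k) (π k) * ∑ i ∈ A k, c k i : ℝ) : ℂ) * Complex.I)
        ∂(bootLaw (A k) (π k))) 𝓕 (𝓝 ((Real.exp (-(s / 2)) : ℝ) : ℂ)) := by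
  have hlim : Tendsto (fun k => ((Real.exp (-(N k / weightSum (A k) (π k)
      * ((∑ i ∈ A k, c k i ^ 2) / 2))) : ℝ) : ℂ)) 𝓕 (𝓝 ((Real.exp (-(s / 2)) : ℝ) : ℂ)) := by
    have h := (Real.continuous_exp.tendsto _).comp ((hW.mul (h2.div_const 2)).neg)
    rw [one_mul] at h
    exact (Complex.continuous_ofReal.tendsto _).comp h
  have hQN : Tendsto (fun k => (∑ i ∈ A k, c k i ^ 2) ^ 2 / N k) 𝓕 (𝓝 0) :=
    (h2.pow 2).div_atTop hN
  have hb : Tendsto (fun k => 4 * (N k / weightSum (A k) (π k)) * ∑ i ∈ A k, |c k i| ^ 3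
        + 6 * (N k / weightSum (A k) (π k)) ^ 2 * ((∑ i ∈ A k, c k i) ^ 2 / N k)
        + 2 * (N k / weightSum (A k) (π k)) ^ 2 * ((∑ i ∈ A k, c k i ^ 2) ^ 2 / N k))
      𝓕 (𝓝 0) := by
    have := (((hW.const_mul 4).mul h3).add (((hW.pow 2).const_mul 6).mul h1)).add
      (((hW.pow 2).const_mul 2).mul hQN)
    simpa using this
  have hdiff := squeeze_zero_norm' (f := fun k => ∫ m, Complex.exp (((∑ i ∈ A k, c k i * m i
      - N k / weightSum (A k) (π k) * ∑ i ∈ A k, c k i : ℝ) : ℂ) * Complex.I)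
        ∂(bootLaw (A k) (π k)) - ((Real.exp (-(N k / weightSum (A k) (π k)
      * ((∑ i ∈ A k, c k i ^ 2) / 2))) : ℝ) : ℂ)) (t₀ := 𝓕) ?_ hb
  · simpa using hdiff.add hlim
  · filter_upwards [hπ, hA, hN.eventually_gt_atTop 0] with k hk hAk hNk
    exact norm_charFun_bootLaw_sub_le hk hAk (by exact_mod_cast hNk) (c k)

lemma wAvg_bootWeight {𝒴 : Type*} {N : ℕ} (y : Fin N → 𝒴) (A : Finset (Fin N)) (π : Fin N → unitInterval)
    (m : Fin N → ℕ) (h : 𝒴 → ℝ) :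
    wAvg y A (bootWeight π m) h = ∑ i ∈ A, ((N : ℝ)⁻¹ * weight π i * h (y i)) * m i := by
  rw [wAvg, Finset.mul_sum]
  exact Finset.sum_congr rfl fun i _ => by rw [bootWeight]; ring

lemma wAvg_weight {𝒴 : Type*} {N : ℕ} (y : Fin N → 𝒴) (A : Finset (Fin N)) (π : Fin N → unitInterval)
    (h : 𝒴 → ℝ) :
    wAvg y A (weight π) h = ∑ i ∈ A, (N : ℝ)⁻¹ * weight π i * h (y i) := by
  rw [wAvg, Finset.mul_sum]
  exact Finset.sum_congr rfl fun i _ => by ring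

/-- The deviation of a weighted sum with bootstrap weights from its bootstrap mean. -/
noncomputable def bootDev {𝒴 : Type*} {N : ℕ} (y : Fin N → 𝒴) (A : Finset (Fin N))
    (π : Fin N → unitInterval) (g : 𝒴 → ℝ) (m : Fin N → ℕ) : ℝ :=
  wAvg y A (bootWeight π m) g - N / weightSum A π * wAvg y A (weight π) g

lemma bootDev_eq {𝒴 : Type*} {N : ℕ} (y : Fin N → 𝒴) (A : Finset (Fin N))
    (π : Fin N → unitInterval) (g : 𝒴 → ℝ) (m : Fin N → ℕ) :
    bootDev y A π g m = ∑ i ∈ A, ((N : ℝ)⁻¹ * weight π i * g (y i)) * m i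
      - N / weightSum A π * ∑ i ∈ A, (N : ℝ)⁻¹ * weight π i * g (y i) := by
  rw [bootDev, wAvg_bootWeight, wAvg_weight]

lemma lintegral_sq_eq_ofReal {N : ℕ} {A : Finset (Fin N)} {π : Fin N → unitInterval}
    (X : (Fin N → ℕ) → ℝ) :
    ∫⁻ m, ‖X m‖ₑ ^ 2 ∂(bootLaw A π) = ENNReal.ofReal (∫ m, X m ^ 2 ∂(bootLaw A π)) := by
  rw [ofReal_integral_eq_lintegral_ofReal (integrable_bootLaw _)
    (Eventually.of_forall fun m => sq_nonneg _)]
  refine lintegral_congr fun m => ?_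
  rw [← ofReal_norm, ← ENNReal.ofReal_pow (norm_nonneg _), Real.norm_eq_abs, sq_abs]

lemma integral_bootDev_sq_le {𝒴 : Type*} {N : ℕ} (y : Fin N → 𝒴) {A : Finset (Fin N)}
    {π : Fin N → unitInterval} (hπ : ∀ i, 0 < (π i : ℝ)) (hA : A.Nonempty) (hN : 0 < (N : ℝ))
    {K M : ℝ} (hK : ∀ i, weight π i ≤ K) {g : 𝒴 → ℝ} (hg : ∀ x, |g x| ≤ M) :
    ∫ m, bootDev y A π g m ^ 2 ∂(bootLaw A π) ≤ M ^ 2 * K / N := by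
  have hW := weightSum_pos hπ hA
  have h2 : ∑ i ∈ A, ((N : ℝ)⁻¹ * weight π i * g (y i)) ^ 2
      ≤ (N : ℝ)⁻¹ ^ 2 * K * M ^ 2 * weightSum A π := by
    rw [weightSum, Finset.mul_sum]
    refine Finset.sum_le_sum fun i _ => ?_
    have hwi := weight_pos hπ i
    have h3 : g (y i) ^ 2 ≤ M ^ 2 := sq_le_sq.mpr ((hg _).trans (le_abs_self _))
    have hle := hK i
    have h0 : 0 ≤ K := hwi.le.trans hle
    calc ((N : ℝ)⁻¹ * weight π i * g (y i)) ^ 2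
        = (N : ℝ)⁻¹ ^ 2 * weight π i * g (y i) ^ 2 * weight π i := by ring
      _ ≤ (N : ℝ)⁻¹ ^ 2 * K * M ^ 2 * weight π i := by gcongr
  simp only [bootDev_eq]
  refine (integral_sq_bootLaw_le hπ hA _).trans ?_
  calc _ ≤ N / weightSum A π * ((N : ℝ)⁻¹ ^ 2 * K * M ^ 2 * weightSum A π) := by gcongr
    _ = _ := by field_simp

lemma lintegral_bootDev_le {𝒴 : Type*} {N : ℕ} (y : Fin N → 𝒴) {A : Finset (Fin N)}
    {π : Fin N → unitInterval} (hπ : ∀ i, 0 < (π i : ℝ)) (hA : A.Nonempty) (r : 𝒴 → ℝ) :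
    ∫⁻ m, ‖bootDev y A π r m‖ₑ ∂(bootLaw A π)
      ≤ ENNReal.ofReal (2 * (N / weightSum A π * wAvg y A (weight π) fun x => |r x|)) := by
  have := isProbabilityMeasure_bootLaw hπ hA
  have hW := weightSum_pos hπ hA
  have hnn : ∀ i, 0 ≤ weight π i := fun i => (weight_pos hπ i).le
  set T : ℝ := N / weightSum A π * wAvg y A (weight π) fun x => |r x| with hT
  have h1 : ∫ m, wAvg y A (bootWeight π m) (fun x => |r x|) ∂(bootLaw A π) = T := by
    simp only [wAvg_bootWeight]
    rw [integral_bootLaw hπ hA, ← wAvg_weight y A π fun x => |r x|]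
  have h2 : ∫ m, |bootDev y A π r m| ∂(bootLaw A π) ≤ 2 * T := by
    calc _ ≤ ∫ m, (wAvg y A (bootWeight π m) (fun x => |r x|) + T) ∂(bootLaw A π) := by
          refine integral_mono (integrable_bootLaw _) (integrable_bootLaw _) fun m => ?_
          refine (abs_sub _ _).trans (add_le_add (abs_wAvg_le (fun i =>
            mul_nonneg (hnn i) (Nat.cast_nonneg _)) _) ?_)
          rw [abs_mul, abs_of_nonneg (by positivity : (0 : ℝ) ≤ N / weightSum A π), hT]
          gcongr
          exact abs_wAvg_le hnn _
      _ = 2 * T := by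
          rw [integral_add (integrable_bootLaw _) (integrable_bootLaw _), h1]
          simp
          ring
  refine le_trans (le_of_eq ?_) (ENNReal.ofReal_le_ofReal h2)
  rw [ofReal_integral_eq_lintegral_ofReal (integrable_bootLaw _)
    (Eventually.of_forall fun m => abs_nonneg _)]
  refine lintegral_congr fun m => ?_
  rw [← ofReal_norm, Real.norm_eq_abs]

end BootCLT

section BootLLN

variable {𝒴 κ : Type*} [MeasurableSpace 𝒴] {law : Measure 𝒴} {𝓕 : Filter κ} {N : κ → ℕ}
  {y : ∀ k, Fin (N k) → 𝒴} {A : ∀ k, Finset (Fin (N k))} {π : ∀ k, Fin (N k) → unitInterval}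
  {n₀ : κ → ℝ}

/-- A sequence of samples whose weighted sums obey the law of large numbers, with weights of the
order `N / n₀`. -/
structure RegularSamples (𝓕 : Filter κ) (law : Measure 𝒴) (N : κ → ℕ)
    (y : ∀ k, Fin (N k) → 𝒴) (A : ∀ k, Finset (Fin (N k)))
    (π : ∀ k, Fin (N k) → unitInterval) (n₀ : κ → ℝ) : Prop where
  lln : WeightedLLN 𝓕 law N y A fun k => weight (π k)
  tendsto_N : Tendsto (fun k => (N k : ℝ)) 𝓕 atTop
  tendsto_n₀ : Tendsto n₀ 𝓕 atTop
  tendsto_div : Tendsto (fun k => n₀ k / N k) 𝓕 (𝓝 0)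
  pos : ∀ᶠ k in 𝓕, ∀ i, 0 < (π k i : ℝ)
  weight_le : ∃ C : ℝ, 0 < C ∧ ∀ᶠ k in 𝓕, ∀ i, weight (π k) i ≤ C * (N k / n₀ k)

variable [IsProbabilityMeasure law]

lemma RegularSamples.tendsto_weightSum (h : RegularSamples 𝓕 law N y A π n₀) :
    Tendsto (fun k => N k / weightSum (A k) (π k)) 𝓕 (𝓝 1) := by
  have h1 := (h.lln.tendsto (fun _ => 1) (integrable_const _)).inv₀ (by simp)
  simp only [integral_const, probReal_univ, smul_eq_mul, mul_one, inv_one] at h1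
  refine h1.congr fun k => ?_
  simp only [wAvg, mul_one, weightSum]
  rw [mul_inv, inv_inv, div_eq_mul_inv]

lemma RegularSamples.nonempty (h : RegularSamples 𝓕 law N y A π n₀) :
    ∀ᶠ k in 𝓕, (A k).Nonempty := by
  filter_upwards [h.tendsto_weightSum.eventually (lt_mem_nhds one_pos)] with k hk
  by_contra hne
  rw [Finset.not_nonempty_iff_eq_empty] at hne
  simp [weightSum, hne] at hk

lemma RegularSamples.isProbabilityMeasure (h : RegularSamples 𝓕 law N y A π n₀) :
    ∀ᶠ k in 𝓕, IsProbabilityMeasure (bootLaw (A k) (π k)) := by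
  filter_upwards [h.pos, h.nonempty] with k hk hA
  exact isProbabilityMeasure_bootLaw hk hA

/-- The weighted sums with bootstrap weights obey the law of large numbers. -/
lemma RegularSamples.bootstrap_lln (h : RegularSamples 𝓕 law N y A π n₀) :
    WeightedLLN (probFilter 𝓕 fun k => bootLaw (A k) (π k)) law (fun k => N k.1)
      (fun k => y k.1) (fun k => A k.1) (fun k => bootWeight (π k.1) k.2) := by
  obtain ⟨C, hC, hw⟩ := h.weight_le
  have hfst : Tendsto Sigma.fst (probFilter 𝓕 fun k => bootLaw (A k) (π k)) 𝓕 :=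
    tendsto_fst_probFilter
  have hnonneg : ∀ᶠ k : (Σ k, (Fin (N k) → ℕ)) in probFilter 𝓕 fun k => bootLaw (A k) (π k),
      ∀ i, 0 ≤ bootWeight (π k.1) k.2 i := by
    filter_upwards [hfst.eventually h.lln.nonneg] with k hk i
    exact mul_nonneg (hk i) (Nat.cast_nonneg _)
  have hae : ∀ Q : 𝒴 → Prop, (∀ᵐ x ∂law, Q x) →
      ∀ᶠ k : (Σ k, (Fin (N k) → ℕ)) in probFilter 𝓕 fun k => bootLaw (A k) (π k),
        ∀ i, Q (y k.1 i) := by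
    intro Q hQ
    have h1 := hfst.eventually (h.lln.ae Q hQ)
    filter_upwards [h1] with k hk using hk
  refine WeightedLLN.of_measurable hnonneg hae fun g hgm hg => ?_
  suffices hD : Tendsto (fun k : (Σ k, (Fin (N k) → ℕ)) =>
      bootDev (y k.1) (A k.1) (π k.1) g k.2) (probFilter 𝓕 fun k => bootLaw (A k) (π k)) (𝓝 0) by
    have h1 := (h.tendsto_weightSum.mul (h.lln.tendsto g hg)).comp hfst
    rw [one_mul] at h1
    simpa [bootDev] using hD.add h1
  -- only first moments of `g` exist, so the bounded part is treated in `L²` and the remainder in `L¹`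
  refine tendsto_probFilter_of_approx fun δ hδ => ?_
  obtain ⟨g₁, r, M, -, -, hsplit, hM, hr, hrδ⟩ := exists_truncation hgm hg
    (show 0 < δ / 2 by positivity)
  refine ⟨fun k => bootDev (y k.1) (A k.1) (π k.1) g₁ k.2,
    fun k => bootDev (y k.1) (A k.1) (π k.1) r k.2, Eventually.of_forall fun k => ?_, ?_, ?_⟩
  · have : bootDev (y k.1) (A k.1) (π k.1) g k.2 = bootDev (y k.1) (A k.1) (π k.1) g₁ k.2
        + bootDev (y k.1) (A k.1) (π k.1) r k.2 := by
      simp only [bootDev, wAvg, hsplit, mul_add, Finset.sum_add_distrib]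
      ring
    rw [this]
    exact abs_add_le _ _
  · refine tendsto_probFilter_of_lintegral_sq
      (Eventually.of_forall fun k => Measurable.of_discrete.aemeasurable) ?_
    have hlim : Tendsto (fun k => ENNReal.ofReal (M ^ 2 * C / n₀ k)) 𝓕 (𝓝 0) := by
      have := (tendsto_const_nhds (x := M ^ 2 * C)).div_atTop h.tendsto_n₀
      simpa using ENNReal.tendsto_ofReal this
    refine tendsto_of_tendsto_of_tendsto_of_le_of_le' tendsto_const_nhds hlim
      (Eventually.of_forall fun _ => zero_le) ?_
    filter_upwards [h.pos, h.nonempty, hw, h.tendsto_N.eventually_gt_atTop 0] with k hk hA hwk hN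
    rw [lintegral_sq_eq_ofReal]
    refine ENNReal.ofReal_le_ofReal ((integral_bootDev_sq_le (y k) hk hA hN hwk hM).trans ?_)
    apply le_of_eq
    field_simp
  · have hlim : Tendsto (fun k => 2 * (N k / weightSum (A k) (π k)
        * wAvg (y k) (A k) (weight (π k)) fun x => |r x|)) 𝓕 (𝓝 (2 * (1 * ∫ x, |r x| ∂law))) :=
      (h.tendsto_weightSum.mul (h.lln.tendsto _ hr.abs)).const_mul 2
    have hlt : 2 * (1 * ∫ x, |r x| ∂law) < δ := by linarith
    filter_upwards [hlim.eventually (gt_mem_nhds hlt), h.pos, h.nonempty] with k hk hpos hA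
    exact ⟨Measurable.of_discrete.aemeasurable,
      (lintegral_bootDev_le (y k) hpos hA r).trans (ENNReal.ofReal_le_ofReal hk.le)⟩

end BootLLN

/-! ### Moments of Poisson sampling -/

section PoissonWeights

variable {ι R : Type*} [Fintype ι] [DecidableEq ι] [CommRing R]

/-- The probability `∏_{i ∈ s} q_i ∏_{i ∉ s} (1 - q_i)` of the sample `s` under Poisson sampling
with inclusion probabilities `q`. -/
def poissonProb (q : ι → R) (s : Finset ι) : R := (∏ i ∈ s, q i) * ∏ i ∈ sᶜ, (1 - q i)

lemma sum_poissonProb_mul_prod (q z : ι → R) :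
    ∑ s, poissonProb q s * ∏ i ∈ s, z i = ∏ i, (1 + q i * (z i - 1)) := by
  have h := Fintype.prod_add (fun i => q i * z i) fun i => 1 - q i
  rw [Finset.prod_congr rfl fun i _ => (by ring : 1 + q i * (z i - 1) = q i * z i + (1 - q i)), h]
  refine Finset.sum_congr rfl fun s _ => ?_
  rw [poissonProb, Finset.prod_mul_distrib]
  ring

lemma sum_poissonProb (q : ι → R) : ∑ s, poissonProb q s = 1 := by
  simpa using sum_poissonProb_mul_prod q 1

lemma sum_poissonProb_of_subset (q : ι → R) (T : Finset ι) :
    ∑ s, poissonProb q s * (if T ⊆ s then 1 else 0) = ∏ i ∈ T, q i := by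
  have h := Fintype.prod_add q fun i => if i ∈ T then 0 else 1 - q i
  have h1 : ∀ i, q i + (if i ∈ T then 0 else 1 - q i) = if i ∈ T then q i else 1 := by
    intro i; split_ifs <;> simp
  simp only [h1, Finset.prod_ite_mem, Finset.univ_inter] at h
  rw [h]
  refine Finset.sum_congr rfl fun s _ => ?_
  rw [poissonProb, mul_assoc]
  congr 1
  split_ifs with hT
  · rw [mul_one]
    refine Finset.prod_congr rfl fun i hi => ?_
    rw [if_neg fun hiT => (Finset.mem_compl.1 hi) (hT hiT)]
  · obtain ⟨i, hiT, his⟩ := Finset.not_subset.1 hT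
    rw [mul_zero]
    exact (Finset.prod_eq_zero (Finset.mem_compl.2 his) (by simp [hiT])).symm

lemma sum_poissonProb_mul_sum (q x : ι → R) :
    ∑ s, poissonProb q s * ∑ i ∈ s, x i = ∑ i, q i * x i := by
  have h : ∀ s : Finset ι, ∑ i ∈ s, x i = ∑ i, x i * (if {i} ⊆ s then 1 else 0) := by
    intro s; simp
  simp only [h, Finset.mul_sum]
  rw [Finset.sum_comm]
  refine Finset.sum_congr rfl fun i _ => ?_
  have := sum_poissonProb_of_subset q {i}
  rw [Finset.prod_singleton] at this
  rw [← this, Finset.sum_mul]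
  exact Finset.sum_congr rfl fun s _ => by ring

lemma sum_poissonProb_mul_sum_sq (q x : ι → R) :
    ∑ s, poissonProb q s * (∑ i ∈ s, x i) ^ 2
      = ∑ i, q i * (1 - q i) * x i ^ 2 + (∑ i, q i * x i) ^ 2 := by
  have h : ∀ s : Finset ι, (∑ i ∈ s, x i) ^ 2
      = ∑ i, ∑ j, x i * x j * (if {i, j} ⊆ s then 1 else 0) := by
    intro s
    have : ∑ i ∈ s, x i = ∑ i, if i ∈ s then x i else 0 := by simp
    rw [sq, this, Finset.sum_mul_sum]
    refine Finset.sum_congr rfl fun i _ => Finset.sum_congr rfl fun j _ => ?_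
    by_cases hi : i ∈ s <;> by_cases hj : j ∈ s <;> simp [Finset.insert_subset_iff, hi, hj]
  have h1 : ∑ s, poissonProb q s * (∑ i ∈ s, x i) ^ 2
      = ∑ i, ∑ j, x i * x j * ∏ l ∈ {i, j}, q l := by
    simp only [h, Finset.mul_sum, ← sum_poissonProb_of_subset]
    rw [Finset.sum_comm]
    refine Finset.sum_congr rfl fun i _ => ?_
    rw [Finset.sum_comm]
    exact Finset.sum_congr rfl fun j _ => Finset.sum_congr rfl fun s _ => by ring
  rw [h1, sq, Finset.sum_mul_sum, ← Finset.sum_add_distrib]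
  refine Finset.sum_congr rfl fun i _ => ?_
  rw [← Finset.sum_add_sum_compl {i}, ← Finset.sum_add_sum_compl ({i} : Finset ι)
    (fun j => q i * x i * (q j * x j)), ← add_assoc]
  congr 1
  · simp only [Finset.sum_singleton, Finset.pair_eq_singleton, Finset.prod_singleton]; ring
  · refine Finset.sum_congr rfl fun j hj => ?_
    rw [Finset.prod_pair (fun hij => by simp [hij] at hj)]
    ring

lemma sum_poissonProb_mul_sum_sub_sq (q x : ι → R) :
    ∑ s, poissonProb q s * (∑ i ∈ s, x i - ∑ i, q i * x i) ^ 2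
      = ∑ i, q i * (1 - q i) * x i ^ 2 := by
  have h : ∀ s : Finset ι, poissonProb q s * (∑ i ∈ s, x i - ∑ i, q i * x i) ^ 2
      = poissonProb q s * (∑ i ∈ s, x i) ^ 2
        - 2 * (∑ i, q i * x i) * (poissonProb q s * ∑ i ∈ s, x i)
        + (∑ i, q i * x i) ^ 2 * poissonProb q s := fun s => by ring
  rw [Finset.sum_congr rfl fun s _ => h s, Finset.sum_add_distrib, Finset.sum_sub_distrib,
    ← Finset.mul_sum, ← Finset.mul_sum, sum_poissonProb_mul_sum_sq, sum_poissonProb_mul_sum,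
    sum_poissonProb]
  ring

end PoissonWeights

lemma poissonProb_nonneg {N : ℕ} (q : Fin N → unitInterval) (s : Finset (Fin N)) :
    0 ≤ poissonProb (fun i => (q i : ℝ)) s :=
  mul_nonneg (Finset.prod_nonneg fun i _ => (q i).2.1)
    (Finset.prod_nonneg fun i _ => sub_nonneg.2 (q i).2.2)

lemma poissonProb_le_one {N : ℕ} (q : Fin N → unitInterval) (s : Finset (Fin N)) :
    poissonProb (fun i => (q i : ℝ)) s ≤ 1 := by
  rw [← sum_poissonProb fun i => (q i : ℝ)]
  exact Finset.single_le_sum (fun s _ => poissonProb_nonneg q s) (Finset.mem_univ s)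

section Sampling

variable {𝒴 Ω : Type*} [MeasurableSpace 𝒴] [mΩ : MeasurableSpace Ω] {P : Measure Ω}
  [IsProbabilityMeasure P] {𝒰 : ℕ → MeasurableSpace Ω} {y : (N : ℕ) → Fin N → Ω → 𝒴}
  {π : (N : ℕ) → Fin N → Ω → unitInterval} {A : (N : ℕ) → Ω → Finset (Fin N)}

omit [IsProbabilityMeasure P] in
lemma IsPoissonSampling.measurable_poissonProb (hA : IsPoissonSampling P 𝒰 y π A) (N : ℕ)
    (s : Finset (Fin N)) : Measurable[𝒰 N] fun ω => poissonProb (fun i => (π N i ω : ℝ)) s := by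
  have h : ∀ i, Measurable[𝒰 N] fun ω => (π N i ω : ℝ) := fun i =>
    (measurable_subtype_coe).comp (hA.measurable_π N i)
  exact (Finset.measurable_fun_prod _ fun i _ => h i).mul
    (Finset.measurable_fun_prod _ fun i _ => measurable_const.sub (h i))

/-- On the event that the sample is `s`, the law restricted to the population information has
density `poissonProb π s`. -/
lemma IsPoissonSampling.trim_restrict (hA : IsPoissonSampling P 𝒰 y π A) (N : ℕ)
    (s : Finset (Fin N)) :
    (P.restrict {ω | A N ω = s}).trim (hA.le N) = (P.trim (hA.le N)).withDensity
      fun ω => ENNReal.ofReal (poissonProb (fun i => (π N i ω : ℝ)) s) := by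
  have hle := hA.le N
  have hmeas := hA.measurable_poissonProb N s
  refine @Measure.ext _ (𝒰 N) _ _ fun B hB => ?_
  rw [trim_measurableSet_eq hle hB, Measure.restrict_apply (hle _ hB),
    withDensity_apply _ hB, setLIntegral_trim hle hmeas.ennreal_ofReal hB]
  have h1 := setIntegral_condExp hle
    ((integrable_const (1 : ℝ)).indicator (hA.measurableSet_eq N s) (μ := P)) hB
  rw [integral_indicator (hA.measurableSet_eq N s), Measure.restrict_restrict
    (hA.measurableSet_eq N s), setIntegral_const, smul_eq_mul, mul_one] at h1
  have h2 : ∫ ω in B, poissonProb (fun i => (π N i ω : ℝ)) s ∂P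
      = P.real ({ω | A N ω = s} ∩ B) := by
    rw [← h1]
    refine integral_congr_ae (ae_restrict_of_ae ?_)
    filter_upwards [hA.condProb N s] with ω hω using hω.symm
  have hint : Integrable (fun ω => poissonProb (fun i => (π N i ω : ℝ)) s) P :=
    Integrable.of_bound (hmeas.mono hle le_rfl).aestronglyMeasurable 1
      (Eventually.of_forall fun ω => by
        rw [Real.norm_eq_abs, abs_of_nonneg (poissonProb_nonneg _ s)]
        exact poissonProb_le_one _ s)
  rw [← ofReal_integral_eq_lintegral_ofReal hint.integrableOn
    (Eventually.of_forall fun ω => poissonProb_nonneg _ s), h2, inter_comm,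
    measureReal_def, ENNReal.ofReal_toReal (measure_ne_top _ _)]

lemma IsPoissonSampling.lintegral (hA : IsPoissonSampling P 𝒰 y π A) (N : ℕ)
    {F : Finset (Fin N) → Ω → ℝ≥0∞} (hF : ∀ s, Measurable[𝒰 N] (F s)) :
    ∫⁻ ω, F (A N ω) ω ∂P
      = ∫⁻ ω, ∑ s, ENNReal.ofReal (poissonProb (fun i => (π N i ω : ℝ)) s) * F s ω ∂P := by
  have hle := hA.le N
  have hm := fun s => hA.measurable_poissonProb N s
  have h1 : ∀ ω, F (A N ω) ω = ∑ s, {ω | A N ω = s}.indicator (F s) ω := fun ω => by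
    simp [indicator_apply]
  simp_rw [h1]
  rw [lintegral_finsetSum _ fun s _ =>
      ((hF s).mono hle le_rfl).indicator (hA.measurableSet_eq N s),
    lintegral_finsetSum (f := fun s ω => ENNReal.ofReal (poissonProb (fun i => (π N i ω : ℝ)) s) *
      F s ω) _ fun s _ => ((hm s).mono hle le_rfl).ennreal_ofReal.mul ((hF s).mono hle le_rfl)]
  refine Finset.sum_congr rfl fun s _ => ?_
  rw [lintegral_indicator (hA.measurableSet_eq N s), ← lintegral_trim hle (hF s),
    hA.trim_restrict, lintegral_withDensity_eq_lintegral_mul _ (hm s).ennreal_ofReal (hF s)]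
  exact lintegral_trim hle ((hm s).ennreal_ofReal.mul (hF s))

lemma IsPoissonSampling.integral {E : Type*} [NormedAddCommGroup E] [NormedSpace ℝ E]
    (hA : IsPoissonSampling P 𝒰 y π A) (N : ℕ)
    {F : Finset (Fin N) → Ω → E} (hF : ∀ s, StronglyMeasurable[𝒰 N] (F s))
    (hint : ∀ s, Integrable (F s) P) :
    ∫ ω, F (A N ω) ω ∂P = ∫ ω, ∑ s, poissonProb (fun i => (π N i ω : ℝ)) s • F s ω ∂P := by
  have hle := hA.le N
  have hm := fun s => hA.measurable_poissonProb N s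
  have h1 : ∀ ω, F (A N ω) ω = ∑ s, {ω | A N ω = s}.indicator (F s) ω := fun ω => by
    simp [indicator_apply]
  simp_rw [h1]
  rw [integral_finsetSum _ fun s _ => (hint s).indicator (hA.measurableSet_eq N s),
    integral_finsetSum _ fun s _ => ?_]
  · refine Finset.sum_congr rfl fun s _ => ?_
    rw [integral_indicator (hA.measurableSet_eq N s), integral_trim hle (hF s),
      hA.trim_restrict]
    refine (@integral_withDensity_eq_integral_smul _ _ (𝒰 N) _ _ _ _
      (hm s).real_toNNReal (F s)).trans (Eq.trans ?_
        (integral_trim hle ((hm s).stronglyMeasurable.smul (hF s))).symm)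
    refine integral_congr_ae (Eventually.of_forall fun ω => ?_)
    simp only [Pi.smul_apply', NNReal.smul_def, Real.coe_toNNReal _ (poissonProb_nonneg _ s)]
  · exact (hint s).bdd_smul 1 ((hm s).mono hle le_rfl).aestronglyMeasurable
      (Eventually.of_forall fun ω => by
        rw [Real.norm_eq_abs, abs_of_nonneg (poissonProb_nonneg _ s)]
        exact poissonProb_le_one _ s)

lemma enorm_sq_eq_ofReal (x : ℝ) : ‖x‖ₑ ^ 2 = ENNReal.ofReal (x ^ 2) := by
  rw [← ofReal_norm, ← ENNReal.ofReal_pow (norm_nonneg _), Real.norm_eq_abs, sq_abs]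

variable {N : ℕ} {Z : Fin N → Ω → ℝ}

lemma IsPoissonSampling.lintegral_ofReal (hA : IsPoissonSampling P 𝒰 y π A)
    {F : Finset (Fin N) → Ω → ℝ} (hF : ∀ s, Measurable[𝒰 N] (F s)) (h0 : ∀ s ω, 0 ≤ F s ω) :
    ∫⁻ ω, ENNReal.ofReal (F (A N ω) ω) ∂P
      = ∫⁻ ω, ENNReal.ofReal (∑ s, poissonProb (fun i => (π N i ω : ℝ)) s * F s ω) ∂P := by
  rw [hA.lintegral N (F := fun s ω => ENNReal.ofReal (F s ω)) fun s => (hF s).ennreal_ofReal]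
  refine lintegral_congr fun ω => ?_
  rw [ENNReal.ofReal_sum_of_nonneg fun s _ => mul_nonneg (poissonProb_nonneg _ s) (h0 s ω)]
  exact Finset.sum_congr rfl fun s _ => (ENNReal.ofReal_mul (poissonProb_nonneg _ s)).symm

omit [IsProbabilityMeasure P] in
lemma IsPoissonSampling.measurable_prob (hA : IsPoissonSampling P 𝒰 y π A) (i : Fin N) :
    Measurable[𝒰 N] fun ω => (π N i ω : ℝ) :=
  measurable_subtype_coe.comp (hA.measurable_π N i)

lemma IsPoissonSampling.lintegral_sum (hA : IsPoissonSampling P 𝒰 y π A)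
    (hZ : ∀ i, Measurable[𝒰 N] (Z i)) (h0 : ∀ i ω, 0 ≤ Z i ω) :
    ∫⁻ ω, ENNReal.ofReal (∑ i ∈ A N ω, Z i ω) ∂P
      = ∫⁻ ω, ENNReal.ofReal (∑ i, π N i ω * Z i ω) ∂P := by
  rw [hA.lintegral_ofReal (F := fun s ω => ∑ i ∈ s, Z i ω)
    (fun s => Finset.measurable_fun_sum s fun i _ => hZ i)
    fun s ω => Finset.sum_nonneg fun i _ => h0 i ω]
  simp_rw [sum_poissonProb_mul_sum]

/-- Given the population, a Poisson sum has mean `∑ π_i Z_i` and variance at most `∑ π_i Z_i²`. -/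
lemma IsPoissonSampling.lintegral_sum_sub_sq_le (hA : IsPoissonSampling P 𝒰 y π A)
    (hZ : ∀ i, Measurable[𝒰 N] (Z i)) :
    ∫⁻ ω, ‖∑ i ∈ A N ω, Z i ω - ∑ i, π N i ω * Z i ω‖ₑ ^ 2 ∂P
      ≤ ∫⁻ ω, ENNReal.ofReal (∑ i, π N i ω * Z i ω ^ 2) ∂P := by
  simp_rw [enorm_sq_eq_ofReal]
  rw [hA.lintegral_ofReal (F := fun s ω => (∑ i ∈ s, Z i ω - ∑ i, π N i ω * Z i ω) ^ 2)
    (fun s => ((Finset.measurable_fun_sum s fun i _ => hZ i).sub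
      (Finset.measurable_fun_sum Finset.univ
        fun i _ => (hA.measurable_prob i).mul (hZ i))).pow_const 2)
    fun s ω => sq_nonneg _]
  simp_rw [sum_poissonProb_mul_sum_sub_sq]
  refine lintegral_mono fun ω => ENNReal.ofReal_le_ofReal (Finset.sum_le_sum fun i _ => ?_)
  have h1 := (π N i ω).2.1
  nlinarith [mul_nonneg (mul_nonneg h1 h1) (sq_nonneg (Z i ω))]

lemma IsPoissonSampling.integral_sum (hA : IsPoissonSampling P 𝒰 y π A)
    (hZ : ∀ i, Measurable[𝒰 N] (Z i)) (hint : ∀ i, Integrable (Z i) P) :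
    ∫ ω, ∑ i ∈ A N ω, Z i ω ∂P = ∫ ω, ∑ i, π N i ω * Z i ω ∂P := by
  rw [hA.integral N (F := fun s ω => ∑ i ∈ s, Z i ω)
    (fun s => (Finset.measurable_fun_sum s fun i _ => hZ i).stronglyMeasurable)
    fun s => integrable_finsetSum _ fun i _ => hint i]
  simp_rw [smul_eq_mul, sum_poissonProb_mul_sum]

/-- The characteristic function of a Poisson sum, through the population: a Bernoulli factor for
each unit. -/
lemma IsPoissonSampling.integral_exp_mul_I (hA : IsPoissonSampling P 𝒰 y π A)
    (hZ : ∀ i, Measurable[𝒰 N] (Z i)) :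
    ∫ ω, Complex.exp ((∑ i ∈ A N ω, Z i ω : ℝ) * Complex.I) ∂P
      = ∫ ω, ∏ i, (1 + (π N i ω : ℝ) * (Complex.exp (Z i ω * Complex.I) - 1)) ∂P := by
  have hm : ∀ s : Finset (Fin N), Measurable[𝒰 N]
      fun ω => Complex.exp ((∑ i ∈ s, Z i ω : ℝ) * Complex.I) := fun s =>
    Complex.measurable_exp.comp
      ((Complex.measurable_ofReal.comp (Finset.measurable_fun_sum s fun i _ => hZ i)).mul_const _)
  rw [hA.integral N (F := fun s ω => Complex.exp ((∑ i ∈ s, Z i ω : ℝ) * Complex.I))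
    (fun s => (hm s).stronglyMeasurable)
    fun s => Integrable.of_bound ((hm s).mono (hA.le N) le_rfl).aestronglyMeasurable 1
      (Eventually.of_forall fun ω => (Complex.norm_exp_ofReal_mul_I _).le)]
  refine integral_congr_ae (Eventually.of_forall fun ω => ?_)
  simp only
  rw [← sum_poissonProb_mul_prod]
  refine Finset.sum_congr rfl fun s _ => ?_
  rw [← Complex.exp_sum, Complex.real_smul]
  congr 1
  · simp [poissonProb]
  · rw [← Finset.sum_mul]; push_cast; rfl

end Sampling

/-! ### The law of large numbers for the Poisson samples -/

section LawOfLargeNumbers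

variable {𝒴 Ω : Type*} [MeasurableSpace 𝒴] [mΩ : MeasurableSpace Ω] {P : Measure Ω}
  {law : Measure 𝒴} {𝒰 : ℕ → MeasurableSpace Ω} {y : (N : ℕ) → Fin N → Ω → 𝒴}
  {π : (N : ℕ) → Fin N → Ω → unitInterval} {A : (N : ℕ) → Ω → Finset (Fin N)} {n₀ : ℕ → ℝ}

lemma IsSuperpopulation.lintegral (hy : IsSuperpopulation P law y) {N : ℕ} (i : Fin N)
    {g : 𝒴 → ℝ≥0∞} (hg : Measurable g) : ∫⁻ ω, g (y N i ω) ∂P = ∫⁻ x, g x ∂law := by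
  rw [← hy.map_eq N i, lintegral_map hg (hy.measurable N i)]

lemma IsSuperpopulation.integral (hy : IsSuperpopulation P law y) {N : ℕ} (i : Fin N)
    {g : 𝒴 → ℝ} (hg : Measurable g) : ∫ ω, g (y N i ω) ∂P = ∫ x, g x ∂law := by
  rw [← hy.map_eq N i, integral_map (hy.measurable N i).aemeasurable hg.aestronglyMeasurable]

lemma IsSuperpopulation.memLp (hy : IsSuperpopulation P law y) {N : ℕ} (i : Fin N)
    {g : 𝒴 → ℝ} {q : ℝ≥0∞} (hg : MemLp g q law) : MemLp (fun ω => g (y N i ω)) q P := by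
  rw [← hy.map_eq N i] at hg
  exact hg.comp_of_map (hy.measurable N i).aemeasurable

lemma IsSuperpopulation.integrable (hy : IsSuperpopulation P law y) {N : ℕ} (i : Fin N)
    {g : 𝒴 → ℝ} (hg : Integrable g law) : Integrable (fun ω => g (y N i ω)) P :=
  memLp_one_iff_integrable.1 (hy.memLp i (memLp_one_iff_integrable.2 hg))

lemma IsSuperpopulation.ae (hy : IsSuperpopulation P law y) (N : ℕ) {Q : 𝒴 → Prop}
    (hQ : ∀ᵐ x ∂law, Q x) : ∀ᵐ ω ∂P, ∀ i, Q (y N i ω) := by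
  rw [ae_all_iff]
  intro i
  rw [← hy.map_eq N i] at hQ
  exact ae_of_ae_map (hy.measurable N i).aemeasurable hQ

lemma IsSuperpopulation.integral_sum_sq [IsProbabilityMeasure P]
    (hy : IsSuperpopulation P law y) (N : ℕ)
    {g : 𝒴 → ℝ} (hgm : Measurable g) (hg : MemLp g 2 law) (h0 : ∫ x, g x ∂law = 0) :
    ∫ ω, (∑ i, g (y N i ω)) ^ 2 ∂P = N * ∫ x, g x ^ 2 ∂law := by
  have hmean : ∀ i, ∫ ω, g (y N i ω) ∂P = 0 := fun i => by rw [hy.integral i hgm, h0]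
  have hL : ∀ i, MemLp (fun ω => g (y N i ω)) 2 P := fun i => hy.memLp i hg
  have hsum : MemLp (fun ω => ∑ i, g (y N i ω)) 2 P := memLp_finsetSum _ fun i _ => hL i
  have hvar := IndepFun.variance_sum (μ := P) (s := Finset.univ)
    (X := fun i ω => g (y N i ω)) (fun i _ => hL i) (fun i _ j _ hij =>
      ((hy.iIndepFun N).indepFun hij).comp hgm hgm)
  have hz : ∫ ω, ∑ i, g (y N i ω) ∂P = 0 := by
    rw [integral_finsetSum _ fun i _ => (hL i).integrable one_le_two]
    simp [hmean]
  have he : (∑ i, fun ω => g (y N i ω)) = fun ω => ∑ i, g (y N i ω) := by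
    ext ω; simp
  rw [he, variance_of_integral_eq_zero hsum.aestronglyMeasurable.aemeasurable hz] at hvar
  rw [hvar, Finset.sum_congr rfl fun i _ => variance_of_integral_eq_zero
    (hL i).aestronglyMeasurable.aemeasurable (hmean i)]
  rw [Finset.sum_congr rfl fun i _ => hy.integral i (hgm.pow_const 2)]
  simp

/-- The weak law of large numbers over the finite population, in mean square. -/
lemma IsSuperpopulation.lintegral_mean_sub_sq [IsProbabilityMeasure P] [IsProbabilityMeasure law]
    (hy : IsSuperpopulation P law y) (N : ℕ)
    {g : 𝒴 → ℝ} (hgm : Measurable g) (hg : MemLp g 2 law) :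
    ∫⁻ ω, ‖(N : ℝ)⁻¹ * ∑ i, (g (y N i ω) - ∫ x, g x ∂law)‖ₑ ^ 2 ∂P
      = ENNReal.ofReal ((N : ℝ)⁻¹ * Var[g; law]) := by
  set c := ∫ x, g x ∂law
  have hgi := hg.integrable one_le_two
  have h1 : MemLp (fun x => g x - c) 2 law := hg.sub (memLp_const c)
  have h2 := hy.integral_sum_sq N (hgm.sub_const c) h1
    (by rw [integral_sub hgi (integrable_const c)]; simp [c])
  have h3 : MemLp (fun ω => ∑ i, (g (y N i ω) - c)) 2 P :=
    memLp_finsetSum _ fun i _ => hy.memLp i h1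
  simp_rw [enorm_sq_eq_ofReal, mul_pow]
  rw [← ofReal_integral_eq_lintegral_ofReal (h3.integrable_sq.const_mul _)
    (Eventually.of_forall fun ω => by positivity), integral_const_mul, h2,
    variance_eq_integral hgm.aemeasurable]
  congr 1
  rcases Nat.eq_zero_or_pos N with rfl | hN
  · simp
  · field_simp
    rfl

omit [MeasurableSpace 𝒴] in
/-- For large `N`, the inclusion probabilities are positive and of the exact order `n₀ / N`,
bounded above and below. -/
lemma InclusionRates.exists_bound [IsProbabilityMeasure P] (hπ : InclusionRates P π n₀) :
    ∃ C : ℝ, 0 < C ∧ ∀ᶠ N : ℕ in atTop, 0 < n₀ N ∧ 0 < N ∧ ∀ᵐ ω ∂P,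
      ∑ i, (π N i ω : ℝ) = n₀ N ∧ ∀ i, 0 < (π N i ω : ℝ) ∧
        weight (π N · ω) i ≤ C * (N / n₀ N) ∧ (π N i ω : ℝ) ≤ C * (n₀ N / N) := by
  obtain ⟨C₁, C₂, h1, h2, hb⟩ := hπ.bounds
  refine ⟨max C₁⁻¹ C₂, lt_max_of_lt_right h2, ?_⟩
  filter_upwards [hπ.tendsto_atTop.eventually (eventually_gt_atTop 0), eventually_gt_atTop 0]
    with N hn hN
  have hN' : (0 : ℝ) < N := by exact_mod_cast hN
  refine ⟨hn, hN, ?_⟩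
  filter_upwards [hb N, hπ.sum_eq N] with ω hω hsum
  refine ⟨hsum, fun i => ?_⟩
  have hpos : 0 < (π N i ω : ℝ) :=
    pos_of_mul_pos_right (h1.trans_le (hω i).1) (by positivity)
  refine ⟨hpos, ?_, ?_⟩
  · refine le_trans ?_ (mul_le_mul_of_nonneg_right (le_max_left _ _) (by positivity))
    have := (hω i).1
    rw [weight, inv_le_iff_one_le_mul₀ hpos]
    calc (1 : ℝ) = C₁⁻¹ * C₁ := by field_simp
      _ ≤ C₁⁻¹ * (N / n₀ N * π N i ω) := by gcongr
      _ = _ := by ring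
  · refine le_trans ?_ (mul_le_mul_of_nonneg_right (le_max_right _ _) (by positivity))
    have := (hω i).2
    calc (π N i ω : ℝ) = (N / n₀ N * π N i ω) * (n₀ N / N) := by field_simp
      _ ≤ _ := by gcongr

lemma IsPoissonSampling.measurable_comp (hA : IsPoissonSampling P 𝒰 y π A) {N : ℕ}
    {β : Type*} [MeasurableSpace β] {F : Finset (Fin N) → Ω → β} (hF : ∀ s, Measurable (F s)) :
    Measurable fun ω => F (A N ω) ω := by
  let _ : MeasurableSpace (Finset (Fin N)) := ⊤
  have h1 : Measurable (A N) := measurable_to_countable' fun s => hA.measurableSet_eq N s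
  have h2 : Measurable (Function.uncurry F) := measurable_from_prod_countable_right hF
  exact h2.comp (h1.prodMk measurable_id)

lemma IsPoissonSampling.measurable_weight (hA : IsPoissonSampling P 𝒰 y π A) {N : ℕ}
    (i : Fin N) : Measurable[𝒰 N] fun ω => weight (π N · ω) i :=
  (measurable_subtype_coe.comp (hA.measurable_π N i)).inv

lemma IsPoissonSampling.measurable_weight_mul (hA : IsPoissonSampling P 𝒰 y π A) {N : ℕ}
    {g : 𝒴 → ℝ} (hg : Measurable g) (i : Fin N) :
    Measurable[𝒰 N] fun ω => weight (π N · ω) i * g (y N i ω) :=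
  (hA.measurable_weight i).mul (hg.comp (hA.measurable_y N i))

lemma IsPoissonSampling.measurable_wAvg (hA : IsPoissonSampling P 𝒰 y π A) (N : ℕ)
    {g : 𝒴 → ℝ} (hg : Measurable g) :
    Measurable fun ω => wAvg (y N · ω) (A N ω) (weight (π N · ω)) g :=
  hA.measurable_comp (F := fun s ω => wAvg (y N · ω) s (weight (π N · ω)) g) fun s =>
    (Finset.measurable_fun_sum s fun i _ =>
      (hA.measurable_weight_mul hg i).mono (hA.le N) le_rfl).const_mul _

variable [IsProbabilityMeasure P]

/-- Chebyshev-type bound for the sampling error of a Poisson sum. -/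
lemma IsPoissonSampling.lintegral_sum_sub_sq_le_of_le (hA : IsPoissonSampling P 𝒰 y π A)
    (hy : IsSuperpopulation P law y) {N : ℕ} {Z : Fin N → Ω → ℝ}
    (hZ : ∀ i, Measurable[𝒰 N] (Z i)) {g : 𝒴 → ℝ} (hg : Measurable g) (hg0 : ∀ x, 0 ≤ g x)
    {K : ℝ} (hK : 0 ≤ K) (hle : ∀ᵐ ω ∂P, ∀ i, π N i ω * Z i ω ^ 2 ≤ K * g (y N i ω)) :
    ∫⁻ ω, ‖∑ i ∈ A N ω, Z i ω - ∑ i, π N i ω * Z i ω‖ₑ ^ 2 ∂P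
      ≤ ENNReal.ofReal (N * K) * ∫⁻ x, ENNReal.ofReal (g x) ∂law := by
  refine (hA.lintegral_sum_sub_sq_le hZ).trans ?_
  have h1 : ∫⁻ ω, ENNReal.ofReal (∑ i, π N i ω * Z i ω ^ 2) ∂P
      ≤ ∫⁻ ω, ∑ i, ENNReal.ofReal K * ENNReal.ofReal (g (y N i ω)) ∂P := by
    refine lintegral_mono_ae ?_
    filter_upwards [hle] with ω hω
    simp_rw [← ENNReal.ofReal_mul hK]
    rw [← ENNReal.ofReal_sum_of_nonneg fun i _ => mul_nonneg hK (hg0 _)]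
    exact ENNReal.ofReal_le_ofReal (Finset.sum_le_sum fun i _ => hω i)
  refine h1.trans (le_of_eq ?_)
  have hm : ∀ i, Measurable fun ω => ENNReal.ofReal (g (y N i ω)) := fun i =>
    (hg.comp (hy.measurable N i)).ennreal_ofReal
  rw [lintegral_finsetSum _ fun i _ => (hm i).const_mul _,
    Finset.sum_congr rfl fun i _ => lintegral_const_mul _ (hm i),
    Finset.sum_congr rfl fun i _ => by rw [hy.lintegral i hg.ennreal_ofReal], Finset.sum_const,
    Finset.card_univ, Fintype.card_fin, nsmul_eq_mul, ENNReal.ofReal_mul (by positivity),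
    ENNReal.ofReal_natCast, mul_assoc]

/-- The weighted sum over the sample estimates the mean over the finite population. -/
lemma IsPoissonSampling.tendsto_wAvg_sub_mean (hA : IsPoissonSampling P 𝒰 y π A)
    (hy : IsSuperpopulation P law y) (hπ : InclusionRates P π n₀) {g : 𝒴 → ℝ}
    (hgm : Measurable g) (hg : MemLp g 2 law) :
    Tendsto (fun k : Σ _ : ℕ, Ω => wAvg (y k.1 · k.2) (A k.1 k.2) (weight (π k.1 · k.2)) g
      - (k.1 : ℝ)⁻¹ * ∑ i, g (y k.1 i k.2)) (probFilter atTop fun _ => P) (𝓝 0) := by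
  obtain ⟨C, hC, hb⟩ := hπ.exists_bound
  have hmeas : ∀ N : ℕ, Measurable fun ω => wAvg (y N · ω) (A N ω) (weight (π N · ω)) g
      - (N : ℝ)⁻¹ * ∑ i, g (y N i ω) := fun N =>
    (hA.measurable_wAvg N hgm).sub ((Finset.measurable_fun_sum Finset.univ fun i _ =>
      hgm.comp (hy.measurable N i)).const_mul (N : ℝ)⁻¹)
  refine tendsto_probFilter_of_lintegral_sq
    (Eventually.of_forall fun N => (hmeas N).enorm.aemeasurable) ?_
  have hlim : Tendsto (fun N => ENNReal.ofReal (C / n₀ N) * ∫⁻ x, ENNReal.ofReal (g x ^ 2) ∂law)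
      atTop (𝓝 0) := by
    have h1 : Tendsto (fun N => ENNReal.ofReal (C / n₀ N)) atTop (𝓝 0) := by
      rw [← ENNReal.ofReal_zero]
      exact ENNReal.tendsto_ofReal (hπ.tendsto_atTop.const_div_atTop C)
    have h2 : ∫⁻ x, ENNReal.ofReal (g x ^ 2) ∂law ≠ ⊤ := hg.integrable_sq.lintegral_lt_top.ne
    simpa using ENNReal.Tendsto.mul_const h1 (Or.inr h2)
  refine tendsto_of_tendsto_of_tendsto_of_le_of_le' tendsto_const_nhds hlim
    (Eventually.of_forall fun _ => zero_le) ?_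
  filter_upwards [hb] with N ⟨hn, hN, hae⟩
  have hN' : (0 : ℝ) < N := by exact_mod_cast hN
  have hb2 := hA.lintegral_sum_sub_sq_le_of_le hy (N := N)
    (Z := fun i ω => (N : ℝ)⁻¹ * (weight (π N · ω) i * g (y N i ω)))
    (fun i => (hA.measurable_weight_mul hgm i).const_mul _) (g := fun x => g x ^ 2)
    (hgm.pow_const 2) (fun x => sq_nonneg _) (K := (N : ℝ)⁻¹ * (C / n₀ N)) (by positivity) (by
      filter_upwards [hae] with ω hω i
      obtain ⟨hpos, hw, -⟩ := hω.2 i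
      have hw1 : (π N i ω : ℝ) * weight (π N · ω) i = 1 := mul_inv_cancel₀ hpos.ne'
      calc (π N i ω : ℝ) * ((N : ℝ)⁻¹ * (weight (π N · ω) i * g (y N i ω))) ^ 2
          = ((π N i ω : ℝ) * weight (π N · ω) i) * weight (π N · ω) i * ((N : ℝ)⁻¹ ^ 2
            * g (y N i ω) ^ 2) := by ring
        _ ≤ C * (N / n₀ N) * ((N : ℝ)⁻¹ ^ 2 * g (y N i ω) ^ 2) := by
          rw [hw1, one_mul]; gcongr
        _ = _ := by field_simp)
  rw [show (N : ℝ) * ((N : ℝ)⁻¹ * (C / n₀ N)) = C / n₀ N by field_simp] at hb2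
  refine le_trans (lintegral_mono_ae ?_) hb2
  filter_upwards [hae] with ω hω
  refine le_of_eq ?_
  rw [wAvg, Finset.mul_sum, Finset.mul_sum]
  congr 3
  refine Finset.sum_congr rfl fun i _ => ?_
  have hw1 : (π N i ω : ℝ) * weight (π N · ω) i = 1 := mul_inv_cancel₀ (hω.2 i).1.ne'
  calc (N : ℝ)⁻¹ * g (y N i ω)
      = (N : ℝ)⁻¹ * (((π N i ω : ℝ) * weight (π N · ω) i) * g (y N i ω)) := by
        rw [hw1, one_mul]
    _ = _ := by ring

lemma IsSuperpopulation.tendsto_mean [IsProbabilityMeasure law]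
    (hy : IsSuperpopulation P law y) {g : 𝒴 → ℝ} (hgm : Measurable g) (hg : MemLp g 2 law) :
    Tendsto (fun k : Σ _ : ℕ, Ω => (k.1 : ℝ)⁻¹ * ∑ i, g (y k.1 i k.2))
      (probFilter atTop fun _ => P) (𝓝 (∫ x, g x ∂law)) := by
  have h1 : Tendsto (fun k : Σ _ : ℕ, Ω =>
      (k.1 : ℝ)⁻¹ * ∑ i, (g (y k.1 i k.2) - ∫ x, g x ∂law))
      (probFilter atTop fun _ => P) (𝓝 0) := by
    have hmeas : ∀ N : ℕ, Measurable fun ω =>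
        (N : ℝ)⁻¹ * ∑ i, (g (y N i ω) - ∫ x, g x ∂law) := fun N =>
      (Finset.measurable_fun_sum Finset.univ fun i _ =>
        (hgm.comp (hy.measurable N i)).sub_const (∫ x, g x ∂law)).const_mul (N : ℝ)⁻¹
    refine tendsto_probFilter_of_lintegral_sq
      (Eventually.of_forall fun N => (hmeas N).enorm.aemeasurable) ?_
    simp_rw [hy.lintegral_mean_sub_sq _ hgm hg]
    rw [← ENNReal.ofReal_zero]
    refine ENNReal.tendsto_ofReal ?_
    simpa using (tendsto_inv_atTop_nhds_zero_nat (𝕜 := ℝ)).mul_const (Var[g; law])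
  refine (zero_add (∫ x, g x ∂law) ▸ h1.add_const (∫ x, g x ∂law)).congr' ?_
  have h2 : ∀ᶠ k : Σ _ : ℕ, Ω in probFilter atTop fun _ => P, 0 < k.1 :=
    tendsto_fst_probFilter.eventually (eventually_gt_atTop 0)
  filter_upwards [h2] with k hk
  have hk' : (k.1 : ℝ) ≠ 0 := by positivity
  rw [Finset.sum_sub_distrib, mul_sub, Finset.sum_const, Finset.card_univ, Fintype.card_fin,
    nsmul_eq_mul, inv_mul_cancel_left₀ hk', sub_add_cancel]

lemma IsPoissonSampling.lintegral_wAvg_le (hA : IsPoissonSampling P 𝒰 y π A)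
    (hy : IsSuperpopulation P law y) (N : ℕ) {g : 𝒴 → ℝ} (hgm : Measurable g)
    (hg0 : ∀ x, 0 ≤ g x) :
    ∫⁻ ω, ENNReal.ofReal (wAvg (y N · ω) (A N ω) (weight (π N · ω)) g) ∂P
      ≤ ∫⁻ x, ENNReal.ofReal (g x) ∂law := by
  have h1 := hA.lintegral_sum (N := N)
    (Z := fun i ω => (N : ℝ)⁻¹ * (weight (π N · ω) i * g (y N i ω)))
    (fun i => (hA.measurable_weight_mul hgm i).const_mul _)
    (fun i ω => mul_nonneg (by positivity)
      (mul_nonneg (inv_nonneg.2 (π N i ω).2.1) (hg0 _)))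
  simp_rw [wAvg, Finset.mul_sum]
  rw [h1]
  have h2 : ∫⁻ ω, ENNReal.ofReal (∑ i, π N i ω * ((N : ℝ)⁻¹ * (weight (π N · ω) i * g (y N i ω)))) ∂P
      ≤ ∫⁻ ω, ∑ i, ENNReal.ofReal (N : ℝ)⁻¹ * ENNReal.ofReal (g (y N i ω)) ∂P := by
    refine lintegral_mono fun ω => ?_
    simp_rw [← ENNReal.ofReal_mul (by positivity : (0 : ℝ) ≤ (N : ℝ)⁻¹)]
    rw [← ENNReal.ofReal_sum_of_nonneg fun i _ => mul_nonneg (by positivity) (hg0 _)]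
    refine ENNReal.ofReal_le_ofReal (Finset.sum_le_sum fun i _ => ?_)
    calc (π N i ω : ℝ) * ((N : ℝ)⁻¹ * (weight (π N · ω) i * g (y N i ω)))
        = ((π N i ω : ℝ) * weight (π N · ω) i) * ((N : ℝ)⁻¹ * g (y N i ω)) := by ring
      _ ≤ 1 * ((N : ℝ)⁻¹ * g (y N i ω)) := by
        gcongr
        · exact mul_nonneg (by positivity) (hg0 _)
        -- `π * π⁻¹ ≤ 1`, also where the junk value `0⁻¹ = 0` enters
        · exact mul_inv_le_one
      _ = _ := one_mul _
  refine h2.trans ?_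
  have hm : ∀ i, Measurable fun ω => ENNReal.ofReal (g (y N i ω)) := fun i =>
    (hgm.comp (hy.measurable N i)).ennreal_ofReal
  rw [lintegral_finsetSum _ fun i _ => (hm i).const_mul _,
    Finset.sum_congr rfl fun i _ => lintegral_const_mul _ (hm i),
    Finset.sum_congr rfl fun i _ => by rw [hy.lintegral i hgm.ennreal_ofReal], Finset.sum_const,
    Finset.card_univ, Fintype.card_fin, nsmul_eq_mul, ← mul_assoc, ← ENNReal.ofReal_natCast,
    ← ENNReal.ofReal_mul (by positivity)]
  refine mul_le_of_le_one_left zero_le ?_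
  rw [← ENNReal.ofReal_one]
  exact ENNReal.ofReal_le_ofReal mul_inv_le_one

/-- The law of large numbers for the inverse-probability weighted sums over the Poisson samples. -/
theorem IsPoissonSampling.weightedLLN [IsProbabilityMeasure law]
    (hA : IsPoissonSampling P 𝒰 y π A)
    (hy : IsSuperpopulation P law y) (hπ : InclusionRates P π n₀) :
    WeightedLLN (probFilter atTop fun _ : ℕ => P) law (fun k => k.1) (fun k => (y k.1 · k.2))
      (fun k => A k.1 k.2) (fun k => weight (π k.1 · k.2)) := by
  refine WeightedLLN.of_measurable (Eventually.of_forall fun k i => inv_nonneg.2 (π k.1 i k.2).2.1)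
    (fun Q hQ => eventually_probFilter_of_ae (Eventually.of_forall fun N => hy.ae N hQ))
    fun h hm hint => ?_
  rw [← tendsto_sub_nhds_zero_iff]
  -- truncation: the bounded part by second moments, the remainder by its mean
  refine tendsto_probFilter_of_approx fun δ hδ => ?_
  obtain ⟨h₁, r, M, hm₁, hmr, hsum, hM, hr, hrδ⟩ := exists_truncation hm hint (half_pos hδ)
  have hL : MemLp h₁ 2 law := MemLp.of_bound hm₁.aestronglyMeasurable M
    (Eventually.of_forall hM)
  refine ⟨fun k => wAvg (y k.1 · k.2) (A k.1 k.2) (weight (π k.1 · k.2)) h₁ - ∫ x, h₁ x ∂law,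
    fun k => wAvg (y k.1 · k.2) (A k.1 k.2) (weight (π k.1 · k.2)) (fun x => |r x|)
      + ∫ x, |r x| ∂law, Eventually.of_forall fun k => ?_, ?_, Eventually.of_forall fun N => ⟨?_, ?_⟩⟩
  · have hw : ∀ i, 0 ≤ weight (π k.1 · k.2) i := fun i => inv_nonneg.2 (π k.1 i k.2).2.1
    have e1 := wAvg_sub (y k.1 · k.2) (A k.1 k.2) (weight (π k.1 · k.2)) h h₁
    have e2 : (fun x => h x - h₁ x) = r := by ext x; rw [hsum]; ring
    have e3 : ∫ x, h x ∂law = ∫ x, h₁ x ∂law + ∫ x, r x ∂law := by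
      rw [← integral_add (hL.integrable one_le_two) hr]
      simp_rw [hsum]
    rw [e2] at e1
    have e4 := abs_wAvg_le (y := (y k.1 · k.2)) (A := A k.1 k.2) hw r
    have e5 := abs_integral_le_integral_abs (f := r) (μ := law)
    rw [e3, show wAvg (y k.1 · k.2) (A k.1 k.2) (weight (π k.1 · k.2)) h
      = wAvg (y k.1 · k.2) (A k.1 k.2) (weight (π k.1 · k.2)) h₁
      + wAvg (y k.1 · k.2) (A k.1 k.2) (weight (π k.1 · k.2)) r by rw [e1]; ring]
    refine (congrArg abs (by ring)).le.trans ((abs_add_le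
      (wAvg (y k.1 · k.2) (A k.1 k.2) (weight (π k.1 · k.2)) h₁ - ∫ x, h₁ x ∂law)
      (wAvg (y k.1 · k.2) (A k.1 k.2) (weight (π k.1 · k.2)) r - ∫ x, r x ∂law)).trans ?_)
    refine add_le_add le_rfl ?_
    exact (abs_sub _ _).trans ((add_le_add e4 e5).trans (le_abs_self _))
  · rw [tendsto_sub_nhds_zero_iff]
    simpa using (hA.tendsto_wAvg_sub_mean hy hπ hm₁ hL).add (hy.tendsto_mean hm₁ hL)
  · exact ((hA.measurable_wAvg N hmr.abs).add_const _).aemeasurable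
  · have hnn : ∀ ω, 0 ≤ wAvg (y N · ω) (A N ω) (weight (π N · ω)) fun x => |r x| := fun ω =>
      mul_nonneg (by positivity) (Finset.sum_nonneg fun i _ =>
        mul_nonneg (inv_nonneg.2 (π N i ω).2.1) (abs_nonneg _))
    have h0 : 0 ≤ ∫ x, |r x| ∂law := integral_nonneg fun x => abs_nonneg _
    have h1 := hA.lintegral_wAvg_le hy N hmr.abs fun x => abs_nonneg _
    rw [← ofReal_integral_eq_lintegral_ofReal hr.abs
      (Eventually.of_forall fun x => abs_nonneg _)] at h1
    calc ∫⁻ ω, ‖wAvg (y N · ω) (A N ω) (weight (π N · ω)) (fun x => |r x|)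
          + ∫ x, |r x| ∂law‖ₑ ∂P
        = ∫⁻ ω, (ENNReal.ofReal (wAvg (y N · ω) (A N ω) (weight (π N · ω)) fun x => |r x|)
          + ENNReal.ofReal (∫ x, |r x| ∂law)) ∂P := by
          refine lintegral_congr fun ω => ?_
          rw [← ofReal_norm, Real.norm_eq_abs, abs_of_nonneg (add_nonneg (hnn ω) h0),
            ENNReal.ofReal_add (hnn ω) h0]
      _ ≤ ENNReal.ofReal (∫ x, |r x| ∂law) + ENNReal.ofReal (∫ x, |r x| ∂law) := by
          rw [lintegral_add_right _ measurable_const, lintegral_const, measure_univ, mul_one]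
          gcongr
      _ ≤ ENNReal.ofReal δ := by
          rw [← ENNReal.ofReal_add h0 h0]
          exact ENNReal.ofReal_le_ofReal (by linarith)

theorem IsPoissonSampling.regularSamples [IsProbabilityMeasure law]
    (hA : IsPoissonSampling P 𝒰 y π A)
    (hy : IsSuperpopulation P law y) (hπ : InclusionRates P π n₀) :
    RegularSamples (probFilter atTop fun _ : ℕ => P) law (fun k => k.1)
      (fun k => (y k.1 · k.2)) (fun k => A k.1 k.2) (fun k => (π k.1 · k.2))
      (fun k => n₀ k.1) := by
  obtain ⟨C, hC, hb⟩ := hπ.exists_bound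
  have hfst : Tendsto Sigma.fst (probFilter atTop fun _ : ℕ => P) atTop := tendsto_fst_probFilter
  exact
  { lln := hA.weightedLLN hy hπ
    tendsto_N := tendsto_natCast_atTop_atTop.comp hfst
    tendsto_n₀ := hπ.tendsto_atTop.comp hfst
    tendsto_div := hπ.tendsto_div.comp hfst
    pos := eventually_probFilter_of_ae (by
      filter_upwards [hb] with N hN
      filter_upwards [hN.2.2] with ω hω i using (hω.2 i).1)
    weight_le := ⟨C, hC, eventually_probFilter_of_ae (by
      filter_upwards [hb] with N hN
      filter_upwards [hN.2.2] with ω hω i using (hω.2 i).2.1)⟩ }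

/-- The sample size is asymptotically equivalent to its expectation `n₀`. -/
theorem IsPoissonSampling.tendsto_card_div (hA : IsPoissonSampling P 𝒰 y π A)
    (hπ : InclusionRates P π n₀) :
    Tendsto (fun k : Σ _ : ℕ, Ω => ((A k.1 k.2).card : ℝ) / n₀ k.1)
      (probFilter atTop fun _ => P) (𝓝 1) := by
  obtain ⟨C, hC, hb⟩ := hπ.exists_bound
  rw [← tendsto_sub_nhds_zero_iff]
  refine tendsto_probFilter_of_lintegral_sq (Eventually.of_forall fun N => ?_) ?_
  · exact (hA.measurable_comp (F := fun s _ => ‖(s.card : ℝ) / n₀ N - 1‖ₑ)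
      fun s => measurable_const).aemeasurable
  · have hlim : Tendsto (fun N => ENNReal.ofReal (1 / n₀ N)) atTop (𝓝 0) := by
      rw [← ENNReal.ofReal_zero]
      exact ENNReal.tendsto_ofReal (hπ.tendsto_atTop.const_div_atTop 1)
    refine tendsto_of_tendsto_of_tendsto_of_le_of_le' tendsto_const_nhds hlim
      (Eventually.of_forall fun _ => zero_le) ?_
    filter_upwards [hb] with N ⟨hn, hN, hae⟩
    have h1 := hA.lintegral_sum_sub_sq_le (N := N) (Z := fun i _ => (n₀ N)⁻¹)
      (fun i => measurable_const)
    have h2 : ∫⁻ ω, ENNReal.ofReal (∑ i, π N i ω * (n₀ N)⁻¹ ^ 2) ∂P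
        = ENNReal.ofReal (1 / n₀ N) := by
      rw [lintegral_congr_ae (g := fun _ => ENNReal.ofReal (1 / n₀ N)), lintegral_const,
        measure_univ, mul_one]
      filter_upwards [hae] with ω hω
      rw [← Finset.sum_mul, hω.1]
      congr 1
      field_simp
    rw [h2] at h1
    refine le_trans (lintegral_mono_ae ?_) h1
    filter_upwards [hae] with ω hω
    rw [← Finset.sum_mul, hω.1, Finset.sum_const, nsmul_eq_mul, mul_inv_cancel₀ hn.ne',
      div_eq_mul_inv]

end LawOfLargeNumbers

/-! ### The variance of the weighted sums, over the population -/

section PopulationVariance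

variable {𝒴 Ω : Type*} [MeasurableSpace 𝒴] [mΩ : MeasurableSpace Ω] {P : Measure Ω}
  [IsProbabilityMeasure P]
  {law : Measure 𝒴} {𝒰 : ℕ → MeasurableSpace Ω} {y : (N : ℕ) → Fin N → Ω → 𝒴}
  {π : (N : ℕ) → Fin N → Ω → unitInterval} {A : (N : ℕ) → Ω → Finset (Fin N)} {n₀ : ℕ → ℝ}

/-- The average `N⁻² ∑_i w_i g(y_i)²` over the whole population, whose mean is the variance of the
weighted sum of `g` over the sample when `g` is centered. -/
noncomputable def popVar {N : ℕ} (y : Fin N → 𝒴) (π : Fin N → unitInterval) (g : 𝒴 → ℝ) : ℝ :=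
  (N : ℝ)⁻¹ ^ 2 * ∑ i, weight π i * g (y i) ^ 2

lemma weight_nonneg {N : ℕ} (π : Fin N → unitInterval) (i : Fin N) : 0 ≤ weight π i :=
  inv_nonneg.2 (π i).2.1

omit [MeasurableSpace 𝒴] in
lemma popVar_nonneg {N : ℕ} (y : Fin N → 𝒴) (π : Fin N → unitInterval) (g : 𝒴 → ℝ) :
    0 ≤ popVar y π g :=
  mul_nonneg (by positivity) (Finset.sum_nonneg fun i _ =>
    mul_nonneg (weight_nonneg π i) (sq_nonneg _))

omit [IsProbabilityMeasure P] in
lemma IsPoissonSampling.measurable_popVar (hA : IsPoissonSampling P 𝒰 y π A) (N : ℕ) {g : 𝒴 → ℝ}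
    (hgm : Measurable g) : Measurable fun ω => popVar (y N · ω) (π N · ω) g :=
  (Finset.measurable_fun_sum Finset.univ fun i _ =>
    ((hA.measurable_weight_mul (hgm.pow_const 2) i).mono (hA.le N) le_rfl)).const_mul _

variable {N : ℕ} {C : ℝ}

omit [IsProbabilityMeasure P] in
lemma IsPoissonSampling.memLp_weight_mul (hA : IsPoissonSampling P 𝒰 y π A)
    (hy : IsSuperpopulation P law y)
    (hb : ∀ᵐ ω ∂P, ∀ i, 0 < (π N i ω : ℝ) ∧ weight (π N · ω) i ≤ C) {q : ℝ≥0∞} {g : 𝒴 → ℝ}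
    (hg : MemLp g q law) (i : Fin N) :
    MemLp (fun ω => weight (π N · ω) i * g (y N i ω)) q P := by
  refine (hy.memLp i hg).of_le_mul (c := C) (((hA.measurable_weight i).mono (hA.le N)
    le_rfl).aestronglyMeasurable.mul (hy.memLp i hg).aestronglyMeasurable) ?_
  filter_upwards [hb] with ω hω
  rw [norm_mul, Real.norm_eq_abs (weight _ _), abs_of_nonneg (weight_nonneg _ i)]
  gcongr
  exact (hω i).2

omit [IsProbabilityMeasure P] in
lemma IsPoissonSampling.integrable_popVar (hA : IsPoissonSampling P 𝒰 y π A)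
    (hy : IsSuperpopulation P law y)
    (hb : ∀ᵐ ω ∂P, ∀ i, 0 < (π N i ω : ℝ) ∧ weight (π N · ω) i ≤ C) {g : 𝒴 → ℝ}
    (hg : MemLp g 2 law) : Integrable (fun ω => popVar (y N · ω) (π N · ω) g) P :=
  (integrable_finsetSum _ fun i _ => memLp_one_iff_integrable.1 (hA.memLp_weight_mul hy hb
    (memLp_one_iff_integrable.2 hg.integrable_sq) i)).const_mul _

omit [IsProbabilityMeasure P] in
lemma IsPoissonSampling.memLp_wAvg (hA : IsPoissonSampling P 𝒰 y π A)
    (hy : IsSuperpopulation P law y)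
    (hb : ∀ᵐ ω ∂P, ∀ i, 0 < (π N i ω : ℝ) ∧ weight (π N · ω) i ≤ C) {g : 𝒴 → ℝ}
    (hgm : Measurable g) (hg : MemLp g 2 law) :
    MemLp (fun ω => wAvg (y N · ω) (A N ω) (weight (π N · ω)) g) 2 P := by
  have h1 : MemLp (fun ω => (N : ℝ)⁻¹ * ∑ i, |weight (π N · ω) i * g (y N i ω)|) 2 P :=
    (memLp_finsetSum _ fun i _ => (hA.memLp_weight_mul hy hb hg i).abs).const_mul _
  refine h1.mono (hA.measurable_wAvg N hgm).aestronglyMeasurable (Eventually.of_forall fun ω => ?_)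
  rw [Real.norm_eq_abs, Real.norm_eq_abs, wAvg, abs_mul, abs_mul]
  refine mul_le_mul_of_nonneg_left ?_ (abs_nonneg _)
  refine (Finset.abs_sum_le_sum_abs _ _).trans (le_trans ?_
    (le_abs_self (∑ i, |weight (π N · ω) i * g (y N i ω)|)))
  exact Finset.sum_le_sum_of_subset_of_nonneg
    (f := fun i => |weight (π N · ω) i * g (y N i ω)|) (Finset.subset_univ _)
    fun i _ _ => abs_nonneg _

lemma IsPoissonSampling.integral_wAvg (hA : IsPoissonSampling P 𝒰 y π A)
    (hy : IsSuperpopulation P law y)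
    (hb : ∀ᵐ ω ∂P, ∀ i, 0 < (π N i ω : ℝ) ∧ weight (π N · ω) i ≤ C) {g : 𝒴 → ℝ}
    (hgm : Measurable g) (hg : MemLp g 2 law) (h0 : ∫ x, g x ∂law = 0) :
    ∫ ω, wAvg (y N · ω) (A N ω) (weight (π N · ω)) g ∂P = 0 := by
  have hL := fun i => hA.memLp_weight_mul hy hb hg i
  have h1 := hA.integral_sum (fun i => hA.measurable_weight_mul hgm i)
    fun i => (hL i).integrable one_le_two
  simp_rw [wAvg]
  rw [integral_const_mul, h1]
  have h2 : ∫ ω, ∑ i, π N i ω * (weight (π N · ω) i * g (y N i ω)) ∂P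
      = ∫ ω, ∑ i, g (y N i ω) ∂P := by
    refine integral_congr_ae ?_
    filter_upwards [hb] with ω hω
    refine Finset.sum_congr rfl fun i _ => ?_
    rw [← mul_assoc, show (π N i ω : ℝ) * weight (π N · ω) i = 1 from
      mul_inv_cancel₀ (hω i).1.ne', one_mul]
  rw [h2, integral_finsetSum _ fun i _ => (hy.memLp i hg).integrable one_le_two]
  simp [hy.integral _ hgm, h0]

/-- For centered `g`, the variance of the weighted sum is the mean of `popVar`: the sampling
variance falls short of it by `N⁻¹ E g²`, which is the variance of the population mean. -/
lemma IsPoissonSampling.integral_wAvg_sq (hA : IsPoissonSampling P 𝒰 y π A)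
    (hy : IsSuperpopulation P law y)
    (hb : ∀ᵐ ω ∂P, ∀ i, 0 < (π N i ω : ℝ) ∧ weight (π N · ω) i ≤ C) {g : 𝒴 → ℝ}
    (hgm : Measurable g) (hg : MemLp g 2 law) (h0 : ∫ x, g x ∂law = 0) :
    ∫ ω, wAvg (y N · ω) (A N ω) (weight (π N · ω)) g ^ 2 ∂P
      = ∫ ω, popVar (y N · ω) (π N · ω) g ∂P := by
  have hL := fun i => hA.memLp_weight_mul hy hb hg i
  have hZ := fun i : Fin N => hA.measurable_weight_mul hgm i
  have h1 := hA.integral N (F := fun s ω => (∑ i ∈ s, weight (π N · ω) i * g (y N i ω)) ^ 2)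
    (fun s => ((Finset.measurable_fun_sum s fun i _ => hZ i).pow_const 2).stronglyMeasurable)
    fun s => (memLp_finsetSum s fun i _ => hL i).integrable_sq
  simp_rw [smul_eq_mul, sum_poissonProb_mul_sum_sq] at h1
  have hg2 : ∀ i : Fin N, Integrable (fun ω => g (y N i ω) ^ 2) P := fun i =>
    hy.integrable i hg.integrable_sq
  have hw2 : ∀ i : Fin N, Integrable (fun ω => weight (π N · ω) i * g (y N i ω) ^ 2) P := fun i =>
    memLp_one_iff_integrable.1 (hA.memLp_weight_mul hy hb
      (memLp_one_iff_integrable.2 hg.integrable_sq) i)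
  have h2 : ∫ ω, (∑ i, π N i ω * (1 - π N i ω) * (weight (π N · ω) i * g (y N i ω)) ^ 2
      + (∑ i, π N i ω * (weight (π N · ω) i * g (y N i ω))) ^ 2) ∂P
      = ∫ ω, ((∑ i, weight (π N · ω) i * g (y N i ω) ^ 2 - ∑ i, g (y N i ω) ^ 2)
        + (∑ i, g (y N i ω)) ^ 2) ∂P := by
    refine integral_congr_ae ?_
    filter_upwards [hb] with ω hω
    have hw : ∀ i, (π N i ω : ℝ) * weight (π N · ω) i = 1 := fun i =>
      mul_inv_cancel₀ (hω i).1.ne'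
    rw [← Finset.sum_sub_distrib]
    congr 1
    · refine Finset.sum_congr rfl fun i _ => ?_
      calc _ = ((π N i ω : ℝ) * weight (π N · ω) i) * (weight (π N · ω) i
            - (π N i ω : ℝ) * weight (π N · ω) i) * g (y N i ω) ^ 2 := by ring
        _ = _ := by rw [hw]; ring
    · congr 1
      refine Finset.sum_congr rfl fun i _ => ?_
      rw [← mul_assoc, hw, one_mul]
  have i1 : Integrable (fun ω => ∑ i, weight (π N · ω) i * g (y N i ω) ^ 2) P :=
    integrable_finsetSum _ fun i _ => hw2 i
  have i2 : Integrable (fun ω => ∑ i, g (y N i ω) ^ 2) P :=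
    integrable_finsetSum _ fun i _ => hg2 i
  have i3 : Integrable (fun ω => ∑ i, weight (π N · ω) i * g (y N i ω) ^ 2
      - ∑ i, g (y N i ω) ^ 2) P := i1.sub i2
  simp_rw [popVar, wAvg, mul_pow]
  rw [integral_const_mul, integral_const_mul, h1, h2, integral_add i3
    (memLp_finsetSum _ fun i _ => hy.memLp i hg).integrable_sq, integral_sub i1 i2, hy.integral_sum_sq N hgm hg h0,
    integral_finsetSum _ fun i _ => hg2 i]
  simp [hy.integral _ (hgm.pow_const 2)]

lemma min_sq_le_exp_neg (u : ℝ) : min (u ^ 2 / 4) 1 ≤ Real.exp (-u) - 1 + u := by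
  rcases le_total u 2 with hu | hu
  · refine (min_le_left _ _).trans ?_
    have h1 : 1 - u / 2 ≤ Real.exp (-(u / 2)) := by
      linarith [Real.add_one_le_exp (-(u / 2))]
    have h2 : Real.exp (-u) = Real.exp (-(u / 2)) ^ 2 := by
      rw [← Real.exp_nat_mul]; congr 1; push_cast; ring
    have h3 : (1 - u / 2) ^ 2 ≤ Real.exp (-(u / 2)) ^ 2 := by gcongr; linarith
    rw [h2]
    nlinarith
  · refine (min_le_right _ _).trans ?_
    linarith [Real.exp_pos (-u)]

/-- Strict convexity of the exponential: convergence of the means and of the Laplace transforms at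
one point, to those of a constant, forces convergence in probability to the constant. -/
lemma tendsto_probFilter_of_integral_exp {V : ℕ → Ω → ℝ} {s : ℝ}
    (hV0 : ∀ N ω, 0 ≤ V N ω) (hm : ∀ N, Measurable (V N))
    (hint : ∀ᶠ N in atTop, Integrable (V N) P)
    (h1 : Tendsto (fun N => ∫ ω, V N ω ∂P) atTop (𝓝 s))
    (h2 : Tendsto (fun N => ∫ ω, Real.exp (-(V N ω / 2)) ∂P) atTop (𝓝 (Real.exp (-(s / 2))))) :
    Tendsto (fun k : Σ _ : ℕ, Ω => V k.1 k.2) (probFilter atTop fun _ => P) (𝓝 s) := by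
  -- the nonnegative gap between the exponential and its tangent at `s`, which vanishes only at `s`
  set D : ℝ → ℝ := fun x => Real.exp (-((x - s) / 2)) - 1 + (x - s) / 2 with hD
  have hD0 : ∀ x, 0 ≤ D x := fun x => by
    have := Real.add_one_le_exp (-((x - s) / 2))
    simp only [hD]; linarith
  have hDm : Measurable D := by fun_prop
  have hexp : ∀ N, Integrable (fun ω => Real.exp (-(V N ω / 2))) P := fun N =>
    Integrable.of_bound (((hm N).div_const 2).neg.exp).aestronglyMeasurable 1
      (Eventually.of_forall fun ω => by
        rw [Real.norm_eq_abs, abs_of_pos (Real.exp_pos _), Real.exp_le_one_iff]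
        linarith [hV0 N ω])
  have hDV : ∀ N ω, D (V N ω)
      = Real.exp (s / 2) * Real.exp (-(V N ω / 2)) + (V N ω / 2 - (1 + s / 2)) := by
    intro N ω
    rw [← Real.exp_add]
    simp only [hD]
    rw [show -((V N ω - s) / 2) = s / 2 + -(V N ω / 2) by ring]
    ring
  have hlim : Tendsto (fun N => ∫ ω, D (V N ω) ∂P) atTop (𝓝 0) := by
    have e : Tendsto (fun N => Real.exp (s / 2) * ∫ ω, Real.exp (-(V N ω / 2)) ∂P
        + ((∫ ω, V N ω ∂P) / 2 - (1 + s / 2))) atTop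
        (𝓝 (Real.exp (s / 2) * Real.exp (-(s / 2)) + (s / 2 - (1 + s / 2)))) :=
      (h2.const_mul _).add ((h1.div_const 2).sub_const _)
    rw [← Real.exp_add, add_neg_cancel, Real.exp_zero,
      show (1 : ℝ) + (s / 2 - (1 + s / 2)) = 0 by ring] at e
    refine e.congr' ?_
    filter_upwards [hint] with N hN
    simp_rw [hDV]
    have i1 : Integrable (fun ω => V N ω / 2 - (1 + s / 2)) P :=
      (hN.div_const 2).sub (integrable_const _)
    rw [integral_add ((hexp N).const_mul _) i1,
      integral_const_mul, integral_sub (hN.div_const 2) (integrable_const _), integral_div]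
    simp
  have hDlim : Tendsto (fun k : Σ _ : ℕ, Ω => D (V k.1 k.2)) (probFilter atTop fun _ => P)
      (𝓝 0) := by
    refine tendsto_probFilter_of_lintegral (Eventually.of_forall fun N =>
      (hDm.comp (hm N)).enorm.aemeasurable) ?_
    rw [← ENNReal.ofReal_zero]
    refine (ENNReal.tendsto_ofReal hlim).congr' ?_
    filter_upwards [hint] with N hN
    rw [ofReal_integral_eq_lintegral_ofReal _ (Eventually.of_forall fun ω => hD0 _)]
    · refine lintegral_congr fun ω => ?_
      rw [← ofReal_norm, Real.norm_eq_abs, abs_of_nonneg (hD0 _)]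
    · simp_rw [hDV]
      exact ((hexp N).const_mul _).add ((hN.div_const 2).sub (integrable_const _))
  rw [Metric.tendsto_nhds]
  intro ε hε
  have hpos : 0 < min ((ε / 2) ^ 2 / 4) 1 := by positivity
  filter_upwards [hDlim.eventually (gt_mem_nhds hpos)] with k hk
  by_contra hcon
  rw [not_lt, Real.dist_eq] at hcon
  refine absurd hk (not_lt.2 (le_trans ?_ (min_sq_le_exp_neg ((V k.1 k.2 - s) / 2))))
  refine min_le_min ?_ le_rfl
  rw [← sq_abs ((V k.1 k.2 - s) / 2), abs_div, abs_two]
  gcongr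

end PopulationVariance

/-! ### The conditional characteristic function given the population -/

section ConditionalVariance

variable {𝒴 Ω : Type*} [MeasurableSpace 𝒴] [mΩ : MeasurableSpace Ω] {P : Measure Ω}
  [IsProbabilityMeasure P]
  {law : Measure 𝒴} {𝒰 : ℕ → MeasurableSpace Ω} {y : (N : ℕ) → Fin N → Ω → 𝒴}
  {π : (N : ℕ) → Fin N → Ω → unitInterval} {A : (N : ℕ) → Ω → Finset (Fin N)} {n₀ : ℕ → ℝ}

omit [MeasurableSpace 𝒴] in
/-- The conditional characteristic function of `√n` times the weighted sum, given the population,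
is close to `exp (-n popVar / 2)`. The last term of the bound comes from the conditional mean, which
is the mean of `g` over the population and contributes a phase `√n N⁻¹ ∑ g(y_i)`; it is negligible
for centered `g` because `n / N` is small. -/
lemma norm_prod_sub_exp_popVar_le {N : ℕ} (hN : 0 < N) {y : Fin N → 𝒴}
    {π : Fin N → unitInterval} {n C : ℝ} (hn : 0 < n) (hC : 0 < C)
    (hπ : ∀ i, 0 < (π i : ℝ)) (hw : ∀ i, weight π i ≤ C * (N / n)) (g : 𝒴 → ℝ) :
    ‖∏ i, (1 + (π i : ℝ) * (Complex.exp
        ((√n * ((N : ℝ)⁻¹ * (weight π i * g (y i))) : ℝ) * Complex.I) - 1))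
      - Complex.exp ((-(n * popVar y π g / 2) : ℝ))‖
      ≤ (4 * C ^ 2 / √n + 6 * (n / N) + 2 * C ^ 3 / n)
          * ((N : ℝ)⁻¹ * ∑ i, (|g (y i)| ^ 3 + g (y i) ^ 2 + g (y i) ^ 4))
        + √(n / N) * (1 + (N : ℝ)⁻¹ * (∑ i, g (y i)) ^ 2) := by
  have hN' : (0 : ℝ) < N := by exact_mod_cast hN
  have hsn : 0 < √n := Real.sqrt_pos.2 hn
  have hsq : √n ^ 2 = n := Real.sq_sqrt hn.le
  have hwπ : ∀ i, (π i : ℝ) * weight π i = 1 := fun i => mul_inv_cancel₀ (hπ i).ne'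
  have hw0 := weight_nonneg π
  set a : Fin N → ℝ := fun i => √n * ((N : ℝ)⁻¹ * (weight π i * g (y i))) with ha
  set b : Fin N → ℂ := fun i => Complex.exp ((π i : ℝ) * (a i * Complex.I - a i ^ 2 / 2)) with hb
  have hexpa : ∀ i, ‖Complex.exp (a i * Complex.I)‖ = 1 := fun i =>
    Complex.norm_exp_ofReal_mul_I _
  have h1 : ∀ i ∈ Finset.univ,
      ‖1 + (π i : ℝ) * (Complex.exp (a i * Complex.I) - 1)‖ ≤ 1 := by
    intro i _
    rw [show (1 : ℂ) + (π i : ℝ) * (Complex.exp (a i * Complex.I) - 1)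
      = ((1 - (π i : ℝ) : ℝ) : ℂ) + ((π i : ℝ) : ℂ) * Complex.exp (a i * Complex.I) by
        push_cast; ring]
    refine (norm_add_le _ _).trans ?_
    rw [norm_mul, hexpa, Complex.norm_real, Complex.norm_real, Real.norm_eq_abs, Real.norm_eq_abs,
      abs_of_nonneg (sub_nonneg.2 (π i).2.2), abs_of_nonneg (π i).2.1]
    linarith
  have hbre : ∀ i, b i = Complex.exp ((-(π i * (a i ^ 2 / 2)) : ℝ) + (π i * a i : ℝ) * Complex.I) := by
    intro i
    simp only [hb]
    congr 1
    push_cast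
    ring
  have h2 : ∀ i ∈ Finset.univ, ‖b i‖ ≤ 1 := by
    intro i _
    rw [hbre, Complex.exp_add, norm_mul, Complex.norm_exp_ofReal_mul_I, mul_one,
      Complex.norm_exp_ofReal, Real.exp_le_one_iff]
    have := (π i).2.1
    have : 0 ≤ (π i : ℝ) * (a i ^ 2 / 2) := by positivity
    linarith
  have h3 := norm_prod_sub_prod_le Finset.univ _ _ h1 h2
  have h4 : ∀ i, ‖1 + (π i : ℝ) * (Complex.exp (a i * Complex.I) - 1) - b i‖
      ≤ (4 * C ^ 2 / √n + 6 * (n / N) + 2 * C ^ 3 / n)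
          * ((N : ℝ)⁻¹ * (|g (y i)| ^ 3 + g (y i) ^ 2 + g (y i) ^ 4)) := by
    intro i
    refine (norm_thinned_sub_exp_le (π i).2.1 (π i).2.2).trans ?_
    have e1 : (π i : ℝ) * |a i| ^ 3 ≤ C ^ 2 / √n * ((N : ℝ)⁻¹ * |g (y i)| ^ 3) := by
      calc (π i : ℝ) * |a i| ^ 3
          = ((π i : ℝ) * weight π i) * (√n ^ 3 * (N : ℝ)⁻¹ ^ 3 * |g (y i)| ^ 3)
            * weight π i ^ 2 := by
            simp only [ha, abs_mul, abs_of_pos hsn, abs_of_pos (inv_pos.2 hN'),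
              abs_of_nonneg (hw0 i)]
            ring
        _ ≤ 1 * (√n ^ 3 * (N : ℝ)⁻¹ ^ 3 * |g (y i)| ^ 3) * (C * (N / n)) ^ 2 := by
            rw [hwπ]; gcongr
            · exact hw0 i
            · exact hw i
        _ = _ := by
            have aux : ∀ s M G : ℝ, s ≠ 0 → M ≠ 0 →
                1 * (s ^ 3 * M⁻¹ ^ 3 * G) * (C * (M / s ^ 2)) ^ 2 = C ^ 2 / s * (M⁻¹ * G) := by
              intro s M G hs hM; field_simp
            rw [← aux _ _ _ hsn.ne' hN'.ne', hsq]
    have e2 : (π i : ℝ) ^ 2 * a i ^ 2 = n / N * ((N : ℝ)⁻¹ * g (y i) ^ 2) := by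
      calc (π i : ℝ) ^ 2 * a i ^ 2
          = ((π i : ℝ) * weight π i) ^ 2 * (√n ^ 2 * (N : ℝ)⁻¹ ^ 2 * g (y i) ^ 2) := by
            simp only [ha]; ring
        _ = _ := by rw [hwπ, hsq]; field_simp
    have e3 : (π i : ℝ) * a i ^ 4 ≤ C ^ 3 / n * ((N : ℝ)⁻¹ * g (y i) ^ 4) := by
      calc (π i : ℝ) * a i ^ 4
          = ((π i : ℝ) * weight π i) * ((√n ^ 2) ^ 2 * (N : ℝ)⁻¹ ^ 4 * g (y i) ^ 4)
            * weight π i ^ 3 := by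
            simp only [ha]; ring
        _ ≤ 1 * ((√n ^ 2) ^ 2 * (N : ℝ)⁻¹ ^ 4 * g (y i) ^ 4) * (C * (N / n)) ^ 3 := by
            rw [hwπ]; gcongr
            · exact hw0 i
            · exact hw i
        _ = _ := by rw [hsq]; field_simp
    rw [e2]
    have p1 : 0 ≤ (N : ℝ)⁻¹ * |g (y i)| ^ 3 := by positivity
    have p2 : 0 ≤ (N : ℝ)⁻¹ * g (y i) ^ 2 := by positivity
    have p3 : 0 ≤ (N : ℝ)⁻¹ * g (y i) ^ 4 := by positivity
    have q1 : 0 ≤ C ^ 2 / √n := by positivity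
    have q2 : 0 ≤ n / N := by positivity
    have q3 : 0 ≤ C ^ 3 / n := by positivity
    rw [mul_div_assoc, mul_div_assoc]
    generalize C ^ 2 / √n = c1 at *
    generalize n / (N : ℝ) = c2 at *
    generalize C ^ 3 / n = c3 at *
    rw [mul_add (N : ℝ)⁻¹, mul_add (N : ℝ)⁻¹]
    generalize (N : ℝ)⁻¹ * |g (y i)| ^ 3 = r1 at *
    generalize (N : ℝ)⁻¹ * g (y i) ^ 2 = r2 at *
    generalize (N : ℝ)⁻¹ * g (y i) ^ 4 = r3 at *
    nlinarith [mul_nonneg q1 p2, mul_nonneg q1 p3, mul_nonneg q2 p1, mul_nonneg q2 p3,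
      mul_nonneg q3 p1, mul_nonneg q3 p2]
  have h5 : ‖∏ i, b i - Complex.exp ((-(n * popVar y π g / 2) : ℝ))‖
      ≤ √(n / N) * (1 + (N : ℝ)⁻¹ * (∑ i, g (y i)) ^ 2) := by
    set m : ℝ := √n * ((N : ℝ)⁻¹ * ∑ i, g (y i)) with hm
    have e1 : ∏ i, b i = Complex.exp ((-(n * popVar y π g / 2) : ℝ))
        * Complex.exp (m * Complex.I) := by
      simp_rw [hbre]
      rw [← Complex.exp_sum, ← Complex.exp_add, Finset.sum_add_distrib, ← Finset.sum_mul,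
        ← Complex.ofReal_sum, ← Complex.ofReal_sum]
      congr 3
      · rw [popVar, Finset.sum_neg_distrib, Finset.mul_sum, Finset.mul_sum, Finset.sum_div]
        congr 1
        refine Finset.sum_congr rfl fun i _ => ?_
        calc (π i : ℝ) * (a i ^ 2 / 2) = ((π i : ℝ) * weight π i)
              * (√n ^ 2 * ((N : ℝ)⁻¹ ^ 2 * (weight π i * g (y i) ^ 2)) / 2) := by
              simp only [ha]; ring
          _ = _ := by rw [hwπ, hsq, one_mul]
      · congr 1
        rw [hm, Finset.mul_sum, Finset.mul_sum]
        refine Finset.sum_congr rfl fun i _ => ?_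
        calc (π i : ℝ) * a i = ((π i : ℝ) * weight π i) * (√n * ((N : ℝ)⁻¹ * g (y i))) := by
              simp only [ha]; ring
          _ = _ := by rw [hwπ, one_mul]
    have e2 : ‖Complex.exp (m * Complex.I) - 1‖ ≤ |m| := by
      have := Real.norm_exp_I_mul_ofReal_sub_one_le (x := m)
      rwa [mul_comm, Real.norm_eq_abs] at this
    have e3 : ‖Complex.exp ((-(n * popVar y π g / 2) : ℝ))‖ ≤ 1 := by
      rw [Complex.norm_exp_ofReal, Real.exp_le_one_iff]
      have : 0 ≤ n * popVar y π g / 2 := by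
        have := popVar_nonneg y π g
        positivity
      linarith
    rw [e1, ← mul_sub_one, norm_mul]
    refine (mul_le_of_le_one_left (norm_nonneg _) e3).trans (e2.trans ?_)
    set r := √(n / N)
    have hr : 0 < r := Real.sqrt_pos.2 (by positivity)
    have hr2 : r ^ 2 = n / N := Real.sq_sqrt (by positivity)
    have hm2 : m ^ 2 = r ^ 2 * ((N : ℝ)⁻¹ * (∑ i, g (y i)) ^ 2) := by
      rw [hm, mul_pow, hsq, hr2]; field_simp
    have key : 2 * (r * |m|) ≤ r ^ 2 + m ^ 2 := by
      nlinarith [sq_nonneg (r - |m|), sq_abs m]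
    have p : 0 ≤ (N : ℝ)⁻¹ * (∑ i, g (y i)) ^ 2 := by positivity
    refine le_of_mul_le_mul_left ?_ hr
    have : 0 ≤ r * |m| := by positivity
    nlinarith
  calc _ ≤ ‖∏ i, (1 + (π i : ℝ) * (Complex.exp (a i * Complex.I) - 1)) - ∏ i, b i‖
        + ‖∏ i, b i - Complex.exp ((-(n * popVar y π g / 2) : ℝ))‖ := norm_sub_le_norm_sub_add_norm_sub _ _ _
    _ ≤ _ := by
      refine add_le_add (h3.trans ?_) h5
      rw [Finset.mul_sum, Finset.mul_sum]
      exact Finset.sum_le_sum fun i _ => h4 i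

end ConditionalVariance

/-! ### Convergence of the conditional variance -/

section ConditionalVarianceLimit

variable {𝒴 Ω : Type*} [MeasurableSpace 𝒴] [mΩ : MeasurableSpace Ω] {P : Measure Ω}
  [IsProbabilityMeasure P]
  {law : Measure 𝒴} [IsProbabilityMeasure law]
  {𝒰 : ℕ → MeasurableSpace Ω} {y : (N : ℕ) → Fin N → Ω → 𝒴}
  {π : (N : ℕ) → Fin N → Ω → unitInterval} {A : (N : ℕ) → Ω → Finset (Fin N)} {n₀ : ℕ → ℝ}

/-- The central limit theorem for the weighted sum of a centered function, together with the
convergence of its variance, forces the conditional variance given the population to converge in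
probability: the conditional characteristic function is `exp (-n₀ popVar / 2)` up to `o(1)`, so
that the mean and the Laplace transform of `n₀ popVar` have the limits `s` and `exp (-s / 2)`, those
of a constant. The positive part of `n₀` matters only for small `N`; it makes the variable
nonnegative throughout. -/
theorem IsPoissonSampling.tendsto_popVar (hA : IsPoissonSampling P 𝒰 y π A)
    (hy : IsSuperpopulation P law y) (hπ : InclusionRates P π n₀) {g : 𝒴 → ℝ}
    (hgm : Measurable g) (hg : MemLp g 4 law) (h0 : ∫ x, g x ∂law = 0) {s : ℝ}
    (h1 : Tendsto (fun N => n₀ N *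
      ∫ ω, wAvg (y N · ω) (A N ω) (weight (π N · ω)) g ^ 2 ∂P) atTop (𝓝 s))
    (h2 : Tendsto (fun N => ∫ ω, Complex.exp ((√(n₀ N) *
      wAvg (y N · ω) (A N ω) (weight (π N · ω)) g : ℝ) * Complex.I) ∂P) atTop
      (𝓝 (Complex.exp ((-(s / 2) : ℝ))))) :
    Tendsto (fun k : Σ _ : ℕ, Ω => max (n₀ k.1) 0 * popVar (y k.1 · k.2) (π k.1 · k.2) g)
      (probFilter atTop fun _ => P) (𝓝 s) := by
  obtain ⟨C, hC, hb⟩ := hπ.exists_bound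
  have hg2 : MemLp g 2 law := hg.mono_exponent (by norm_num)
  have hg3 : MemLp g 3 law := hg.mono_exponent (by norm_num)
  have i2 : Integrable (fun x => g x ^ 2) law := hg2.integrable_sq
  have i3 : Integrable (fun x => |g x| ^ 3) law := by
    simpa using hg3.integrable_norm_pow (p := 3) (by norm_num)
  have i4 : Integrable (fun x => g x ^ 4) law := by
    have := hg.integrable_norm_pow (p := 4) (by norm_num)
    refine this.congr (Eventually.of_forall fun x => ?_)
    simp only [Real.norm_eq_abs]
    exact (by decide : Even 4).pow_abs _
  have iq : Integrable (fun x => |g x| ^ 3 + g x ^ 2 + g x ^ 4) law := (i3.add i2).add i4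
  have hqm : Measurable fun x => |g x| ^ 3 + g x ^ 2 + g x ^ 4 := by fun_prop
  have hVm : ∀ N, Measurable fun ω => max (n₀ N) 0 * popVar (y N · ω) (π N · ω) g := fun N =>
    (hA.measurable_popVar N hgm).const_mul _
  have hV0 : ∀ N ω, 0 ≤ max (n₀ N) 0 * popVar (y N · ω) (π N · ω) g := fun N ω =>
    mul_nonneg (le_max_right _ _) (popVar_nonneg _ _ _)
  have hb' : ∀ᶠ N in atTop, ∀ᵐ ω ∂P, ∀ i, 0 < (π N i ω : ℝ) ∧
      weight (π N · ω) i ≤ C * (N / n₀ N) := by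
    filter_upwards [hb] with N hN
    filter_upwards [hN.2.2] with ω hω i using ⟨(hω.2 i).1, (hω.2 i).2.1⟩
  have hint : ∀ᶠ N in atTop, Integrable (fun ω => max (n₀ N) 0 *
      popVar (y N · ω) (π N · ω) g) P := by
    filter_upwards [hb'] with N hN using (hA.integrable_popVar hy hN hg2).const_mul _
  refine tendsto_probFilter_of_integral_exp
    (V := fun N ω => max (n₀ N) 0 * popVar (y N · ω) (π N · ω) g) hV0 hVm hint ?_ ?_
  · refine h1.congr' ?_
    filter_upwards [hb, hb'] with N hN hN'
    rw [integral_const_mul, hA.integral_wAvg_sq hy hN' hgm hg2 h0, max_eq_left hN.1.le]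
  · set K : ℕ → ℝ := fun N => 4 * C ^ 2 / √(n₀ N) + 6 * (n₀ N / N) + 2 * C ^ 3 / n₀ N with hK
    set q : ℝ := ∫ x, (|g x| ^ 3 + g x ^ 2 + g x ^ 4) ∂law with hq
    set q2 : ℝ := ∫ x, g x ^ 2 ∂law with hq2
    have hsqrt : Tendsto (fun N => √(n₀ N)) atTop atTop :=
      Real.tendsto_sqrt_atTop.comp hπ.tendsto_atTop
    have hKlim : Tendsto (fun N => K N * q + √(n₀ N / N) * (1 + q2)) atTop (𝓝 0) := by
      have e1 : Tendsto K atTop (𝓝 0) := by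
        simpa using ((hsqrt.const_div_atTop (4 * C ^ 2)).add (hπ.tendsto_div.const_mul 6)).add
          (hπ.tendsto_atTop.const_div_atTop (2 * C ^ 3))
      have e2 : Tendsto (fun N : ℕ => √(n₀ N / N)) atTop (𝓝 0) := by
        simpa using hπ.tendsto_div.sqrt
      simpa using (e1.mul_const q).add (e2.mul_const (1 + q2))
    have hdiff : Tendsto (fun N => (∫ ω, Complex.exp ((√(n₀ N) *
        wAvg (y N · ω) (A N ω) (weight (π N · ω)) g : ℝ) * Complex.I) ∂P)
        - ∫ ω, Complex.exp ((-(max (n₀ N) 0 * popVar (y N · ω) (π N · ω) g / 2) : ℝ)) ∂P)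
        atTop (𝓝 0) := by
      refine squeeze_zero_norm' ?_ hKlim
      filter_upwards [hb, hb'] with N ⟨hn, hN, hae⟩ hN'
      have hsum : ∀ ω, √(n₀ N) * wAvg (y N · ω) (A N ω) (weight (π N · ω)) g
          = ∑ i ∈ A N ω, √(n₀ N) * ((N : ℝ)⁻¹ * (weight (π N · ω) i * g (y N i ω))) := by
        intro ω; rw [wAvg, Finset.mul_sum, Finset.mul_sum]
      have hZ : ∀ i : Fin N, Measurable[𝒰 N] fun ω =>
          √(n₀ N) * ((N : ℝ)⁻¹ * (weight (π N · ω) i * g (y N i ω))) := fun i =>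
        ((hA.measurable_weight_mul hgm i).const_mul _).const_mul _
      simp_rw [hsum]
      rw [hA.integral_exp_mul_I hZ, max_eq_left hn.le]
      have m1 : Measurable fun ω => ∏ i, (1 + (π N i ω : ℝ) * (Complex.exp
          ((√(n₀ N) * ((N : ℝ)⁻¹ * (weight (π N · ω) i * g (y N i ω))) : ℝ)
            * Complex.I) - 1)) := by
        refine Finset.measurable_fun_prod _ fun i _ => ?_
        have a1 : Measurable fun ω => ((π N i ω : ℝ) : ℂ) :=
          Complex.measurable_ofReal.comp ((hA.measurable_prob i).mono (hA.le N) le_rfl)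
        have a2 := Complex.measurable_exp.comp ((Complex.measurable_ofReal.comp
          ((hZ i).mono (hA.le N) le_rfl)).mul_const Complex.I)
        exact (a1.mul (a2.sub_const 1)).const_add 1
      have hbd := hN'.mono fun ω hω => norm_prod_sub_exp_popVar_le hN (y := (y N · ω)) hn hC
        (fun i => (hω i).1) (fun i => (hω i).2) g
      have m2 : Measurable fun ω => Complex.exp
          ((-(n₀ N * popVar (y N · ω) (π N · ω) g / 2) : ℝ)) :=
        Complex.measurable_exp.comp (Complex.measurable_ofReal.comp
          (((hA.measurable_popVar N hgm).const_mul (n₀ N)).div_const 2).neg)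
      have hnorm2 : ∀ ω, ‖Complex.exp ((-(n₀ N * popVar (y N · ω) (π N · ω) g / 2) : ℝ))‖
          ≤ 1 := by
        intro ω
        rw [Complex.norm_exp_ofReal, Real.exp_le_one_iff]
        have := popVar_nonneg (y N · ω) (π N · ω) g
        have : 0 ≤ n₀ N * popVar (y N · ω) (π N · ω) g / 2 := by positivity
        linarith
      have j2 : Integrable (fun ω => Complex.exp
          ((-(n₀ N * popVar (y N · ω) (π N · ω) g / 2) : ℝ))) P :=
        Integrable.of_bound m2.aestronglyMeasurable 1 (Eventually.of_forall hnorm2)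
      have jA : Integrable (fun ω => (N : ℝ)⁻¹ * (∑ i, g (y N i ω)) ^ 2) P :=
        (memLp_finsetSum _ fun i _ => hy.memLp i hg2).integrable_sq.const_mul _
      have jB : Integrable (fun ω => 1 + (N : ℝ)⁻¹ * (∑ i, g (y N i ω)) ^ 2) P :=
        (integrable_const 1).add jA
      have jC : Integrable (fun ω => (N : ℝ)⁻¹ *
          ∑ i, (|g (y N i ω)| ^ 3 + g (y N i ω) ^ 2 + g (y N i ω) ^ 4)) P :=
        (integrable_finsetSum _ fun i _ => hy.integrable i iq).const_mul _
      have jR : Integrable (fun ω => K N * ((N : ℝ)⁻¹ *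
          ∑ i, (|g (y N i ω)| ^ 3 + g (y N i ω) ^ 2 + g (y N i ω) ^ 4))
          + √(n₀ N / N) * (1 + (N : ℝ)⁻¹ * (∑ i, g (y N i ω)) ^ 2)) P :=
        (jC.const_mul _).add (jB.const_mul _)
      have jD : Integrable (fun ω => ∏ i, (1 + (π N i ω : ℝ) * (Complex.exp
          ((√(n₀ N) * ((N : ℝ)⁻¹ * (weight (π N · ω) i * g (y N i ω))) : ℝ)
            * Complex.I) - 1))
          - Complex.exp ((-(n₀ N * popVar (y N · ω) (π N · ω) g / 2) : ℝ))) P :=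
        jR.mono' (m1.sub m2).aestronglyMeasurable hbd
      have j1 := (jD.add j2).congr (Eventually.of_forall fun ω => sub_add_cancel _ _)
      rw [← integral_sub j1 j2]
      refine (norm_integral_le_of_norm_le jR hbd).trans (le_of_eq ?_)
      have hN0 : (N : ℝ) ≠ 0 := by positivity
      rw [integral_add (jC.const_mul _) (jB.const_mul _), integral_const_mul, integral_const_mul,
        integral_const_mul, integral_finsetSum _ fun i _ => hy.integrable i iq,
        integral_add (integrable_const 1) jA, integral_const_mul,
        hy.integral_sum_sq N hgm hg2 h0, Finset.sum_congr rfl fun i _ => hy.integral i hqm]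
      simp only [Finset.sum_const, Finset.card_univ, Fintype.card_fin, nsmul_eq_mul,
        inv_mul_cancel_left₀ hN0, integral_const, probReal_univ, smul_eq_mul, mul_one, hq, hq2]
    -- the Laplace transform inherits the limit of the unconditional characteristic function
    have hcomb := h2.sub hdiff
    simp only [sub_sub_cancel, sub_zero] at hcomb
    have hre := (Complex.continuous_re.tendsto _).comp hcomb
    rw [← Complex.ofReal_exp, Complex.ofReal_re] at hre
    refine hre.congr fun N => ?_
    simp only [Function.comp_apply, ← Complex.ofReal_exp]
    rw [integral_complex_ofReal, Complex.ofReal_re]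

omit [IsProbabilityMeasure law] in
/-- The sums of squares over the sample inherit the limit of the conditional variance. -/
lemma IsPoissonSampling.tendsto_sum_sq (hA : IsPoissonSampling P 𝒰 y π A)
    (hy : IsSuperpopulation P law y) (hπ : InclusionRates P π n₀) {g : 𝒴 → ℝ}
    (hgm : Measurable g) (hg : MemLp g 4 law) {s : ℝ}
    (h : Tendsto (fun k : Σ _ : ℕ, Ω => max (n₀ k.1) 0 * popVar (y k.1 · k.2) (π k.1 · k.2) g)
      (probFilter atTop fun _ => P) (𝓝 s)) :
    Tendsto (fun k : Σ _ : ℕ, Ω => ∑ i ∈ A k.1 k.2,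
      (√(n₀ k.1) * ((k.1 : ℝ)⁻¹ * (weight (π k.1 · k.2) i * g (y k.1 i k.2)))) ^ 2)
      (probFilter atTop fun _ => P) (𝓝 s) := by
  obtain ⟨C, hC, hb⟩ := hπ.exists_bound
  have i4 : Integrable (fun x => g x ^ 4) law := by
    have := hg.integrable_norm_pow (p := 4) (by norm_num)
    refine this.congr (Eventually.of_forall fun x => ?_)
    simp only [Real.norm_eq_abs]
    exact (by decide : Even 4).pow_abs _
  have hZ : ∀ N (i : Fin N), Measurable[𝒰 N] fun ω =>
      (√(n₀ N) * ((N : ℝ)⁻¹ * (weight (π N · ω) i * g (y N i ω)))) ^ 2 := fun N i =>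
    (((hA.measurable_weight_mul hgm i).const_mul _).const_mul _).pow_const 2
  have hmeas : ∀ N : ℕ, Measurable fun ω => ∑ i ∈ A N ω,
      (√(n₀ N) * ((N : ℝ)⁻¹ * (weight (π N · ω) i * g (y N i ω)))) ^ 2
        - max (n₀ N) 0 * popVar (y N · ω) (π N · ω) g := fun N =>
    (hA.measurable_comp (F := fun s ω => ∑ i ∈ s,
      (√(n₀ N) * ((N : ℝ)⁻¹ * (weight (π N · ω) i * g (y N i ω)))) ^ 2) fun s =>
      Finset.measurable_fun_sum s fun i _ => (hZ N i).mono (hA.le N) le_rfl).sub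
      ((hA.measurable_popVar N hgm).const_mul _)
  have hdiff : Tendsto (fun k : Σ _ : ℕ, Ω => ∑ i ∈ A k.1 k.2,
      (√(n₀ k.1) * ((k.1 : ℝ)⁻¹ * (weight (π k.1 · k.2) i * g (y k.1 i k.2)))) ^ 2
        - max (n₀ k.1) 0 * popVar (y k.1 · k.2) (π k.1 · k.2) g)
      (probFilter atTop fun _ => P) (𝓝 0) := by
    refine tendsto_probFilter_of_lintegral_sq
      (Eventually.of_forall fun N => (hmeas N).enorm.aemeasurable) ?_
    have hlim : Tendsto (fun N => ENNReal.ofReal (C ^ 3 / n₀ N) *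
        ∫⁻ x, ENNReal.ofReal (g x ^ 4) ∂law) atTop (𝓝 0) := by
      have h1 : Tendsto (fun N => ENNReal.ofReal (C ^ 3 / n₀ N)) atTop (𝓝 0) := by
        rw [← ENNReal.ofReal_zero]
        exact ENNReal.tendsto_ofReal (hπ.tendsto_atTop.const_div_atTop _)
      simpa using ENNReal.Tendsto.mul_const h1 (Or.inr i4.lintegral_lt_top.ne)
    refine tendsto_of_tendsto_of_tendsto_of_le_of_le' tendsto_const_nhds hlim
      (Eventually.of_forall fun _ => zero_le) ?_
    filter_upwards [hb] with N ⟨hn, hN, hae⟩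
    have hN' : (0 : ℝ) < N := by exact_mod_cast hN
    have hsq : √(n₀ N) ^ 2 = n₀ N := Real.sq_sqrt hn.le
    have hb2 := hA.lintegral_sum_sub_sq_le_of_le hy (hZ N) (g := fun x => g x ^ 4)
      (hgm.pow_const 4) (fun x => by positivity) (K := C ^ 3 / (n₀ N * N)) (by positivity) (by
        filter_upwards [hae] with ω hω i
        obtain ⟨hpos, hw, -⟩ := hω.2 i
        have hw1 : (π N i ω : ℝ) * weight (π N · ω) i = 1 := mul_inv_cancel₀ hpos.ne'
        have hw0 := weight_nonneg (π N · ω) i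
        calc (π N i ω : ℝ) *
              ((√(n₀ N) * ((N : ℝ)⁻¹ * (weight (π N · ω) i * g (y N i ω)))) ^ 2) ^ 2
            = ((π N i ω : ℝ) * weight (π N · ω) i) * weight (π N · ω) i ^ 3 *
              ((√(n₀ N) ^ 2) ^ 2 * (N : ℝ)⁻¹ ^ 4 * g (y N i ω) ^ 4) := by ring
          _ ≤ 1 * (C * (N / n₀ N)) ^ 3 * ((√(n₀ N) ^ 2) ^ 2 * (N : ℝ)⁻¹ ^ 4 * g (y N i ω) ^ 4) := by
            rw [hw1]; gcongr
          _ = _ := by rw [hsq]; field_simp)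
    rw [show (N : ℝ) * (C ^ 3 / (n₀ N * N)) = C ^ 3 / n₀ N by field_simp] at hb2
    refine le_trans (lintegral_mono_ae ?_) hb2
    filter_upwards [hae] with ω hω
    refine le_of_eq ?_
    rw [max_eq_left hn.le, popVar, Finset.mul_sum, Finset.mul_sum]
    congr 3
    refine Finset.sum_congr rfl fun i _ => ?_
    have hw1 : (π N i ω : ℝ) * weight (π N · ω) i = 1 := mul_inv_cancel₀ (hω.2 i).1.ne'
    calc n₀ N * ((N : ℝ)⁻¹ ^ 2 * (weight (π N · ω) i * g (y N i ω) ^ 2))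
        = ((π N i ω : ℝ) * weight (π N · ω) i) * (√(n₀ N) ^ 2 *
          ((N : ℝ)⁻¹ ^ 2 * (weight (π N · ω) i * g (y N i ω) ^ 2))) := by
          rw [hw1, one_mul, hsq]
      _ = _ := by ring
  simpa using hdiff.add h

end ConditionalVarianceLimit

/-! ### From the standardized to the scaled weighted score -/

section Standardization

open scoped Matrix

variable {p : ℕ}

lemma isHermitian_invSqrt (V : Matrix (Fin p) (Fin p) ℝ) : (invSqrt V).IsHermitian :=
  cfc_predicate (p := IsSelfAdjoint) (fun x : ℝ => (√x)⁻¹) V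

lemma commute_invSqrt {V : Matrix (Fin p) (Fin p) ℝ} (hV : V.PosDef) :
    Commute (invSqrt V) V := by
  have hsa : IsSelfAdjoint V := hV.isHermitian
  have h := cfc_commute_cfc (p := IsSelfAdjoint) (fun x : ℝ => (√x)⁻¹) id V
  rwa [cfc_id ℝ V hsa] at h

lemma invSqrt_mul_mul_invSqrt {V : Matrix (Fin p) (Fin p) ℝ} (hV : V.PosDef) :
    invSqrt V * (V * invSqrt V) = 1 := by
  have hsa : IsSelfAdjoint V := hV.isHermitian
  have hc : ∀ g : ℝ → ℝ, ContinuousOn g (spectrum ℝ V) := fun g =>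
    (Matrix.finite_real_spectrum (A := V)).continuousOn g
  have h1 : V * invSqrt V = cfc (fun x : ℝ => x * (√x)⁻¹) V := by
    rw [cfc_mul (fun x : ℝ => x) (fun x : ℝ => (√x)⁻¹) V (hc _) (hc _), cfc_id' ℝ V hsa, invSqrt]
  rw [h1, invSqrt, ← cfc_mul _ _ V (hc _) (hc _), ← cfc_const_one ℝ V hsa]
  refine cfc_congr fun x hx => ?_
  rw [hV.isHermitian.spectrum_real_eq_range_eigenvalues] at hx
  obtain ⟨i, rfl⟩ := hx
  have hpos := hV.eigenvalues_pos i
  have hs : √(hV.isHermitian.eigenvalues i) ≠ 0 := (Real.sqrt_pos.2 hpos).ne'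
  have h2 := Real.mul_self_sqrt hpos.le
  field_simp
  nlinarith

/-- For each `t` there is a `u` with `inner t x = inner u (V^(-1/2) x)`, and then
`‖u‖² = tᵀ V t`. -/
lemma exists_inner_eq_inner_invSqrt {V : Matrix (Fin p) (Fin p) ℝ} (hV : V.PosDef) (t : Param p) :
    ∃ u : Param p, ‖u‖ ^ 2 = t.ofLp ⬝ᵥ V *ᵥ t.ofLp ∧
      ∀ x, inner ℝ t x = inner ℝ u (Matrix.toEuclideanCLM (𝕜 := ℝ) (invSqrt V) x) := by
  set W := invSqrt V with hW
  have hWs : star W = W := isHermitian_invSqrt V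
  have hVs : star V = V := hV.isHermitian
  have h1 : W * (V * W) = 1 := invSqrt_mul_mul_invSqrt hV
  have hcomm : W * V = V * W := commute_invSqrt hV
  refine ⟨Matrix.toEuclideanCLM (𝕜 := ℝ) (V * W) t, ?_, fun x => ?_⟩
  · rw [← real_inner_self_eq_norm_sq, ← ContinuousLinearMap.adjoint_inner_right,
      ← ContinuousLinearMap.star_eq_adjoint, ← map_star, ← mul_apply_eq_comp,
      ← map_mul, star_mul, hWs, hVs, hcomm, mul_assoc, h1, mul_one, Matrix.inner_toEuclideanCLM]
  · rw [← ContinuousLinearMap.adjoint_inner_left, ← ContinuousLinearMap.star_eq_adjoint,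
      ← map_star, hWs, ← mul_apply_eq_comp, ← map_mul, h1, map_one]
    rfl

variable {Ω : Type*} [MeasurableSpace Ω] {P : Measure Ω} [IsProbabilityMeasure P]

/-- If `X N` is asymptotically standard normal, then inner products with vectors `u N` whose norms
converge have the characteristic functions of a centered normal in the limit, even though the
vectors themselves need not converge. -/
lemma tendsto_integral_exp_inner {X : ℕ → Ω → Param p}
    (h : TendstoInDistribution X atTop id (fun _ => P) (stdGaussian (Param p)))
    {u : ℕ → Param p} {s : ℝ} (hu : Tendsto (fun N => ‖u N‖ ^ 2) atTop (𝓝 s)) :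
    Tendsto (fun N => ∫ ω, Complex.exp ((inner ℝ (u N) (X N ω) : ℝ) * Complex.I) ∂P) atTop
      (𝓝 (Complex.exp ((-(s / 2) : ℝ)))) := by
  -- along a subsequence the vectors converge, and Slutsky's lemma applies
  refine tendsto_of_subseq_tendsto fun ns hns => ?_
  obtain ⟨K, hK⟩ := hu.bddAbove_range
  have hbdd : ∀ n, u (ns n) ∈ Metric.closedBall (0 : Param p) √K := fun n => by
    rw [mem_closedBall_zero_iff]
    exact Real.le_sqrt_of_sq_le (hK ⟨ns n, rfl⟩)
  obtain ⟨u₀, -, φ, hφ, hlim⟩ := tendsto_subseq_of_bounded Metric.isBounded_closedBall hbdd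
  refine ⟨φ, ?_⟩
  have hsub : Tendsto (fun n => ns (φ n)) atTop atTop := hns.comp hφ.tendsto_atTop
  have hs : ‖u₀‖ ^ 2 = s := tendsto_nhds_unique ((hlim.norm).pow 2) (hu.comp hsub)
  have h1 : TendstoInDistribution (fun n => X (ns (φ n))) atTop id (fun _ => P)
      (stdGaussian (Param p)) :=
    { forall_aemeasurable := fun n => h.forall_aemeasurable _
      aemeasurable_limit := h.aemeasurable_limit
      tendsto := h.tendsto.comp hsub }
  have h2 := h1.continuous_comp_prodMk_of_tendstoInMeasure_const
    (g := fun z : Param p × Param p => (inner ℝ z.2 z.1 : ℝ)) (by fun_prop)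
    (Y := fun n _ => u (ns (φ n))) (c := u₀)
    (by rw [tendstoInMeasure_const_iff]; exact hlim.comp tendsto_fst_probFilter)
    (fun _ => aemeasurable_const)
  have h3 := (ProbabilityMeasure.tendsto_iff_tendsto_charFun.1 h2.tendsto) 1
  have e1 : ∀ n, charFun (P.map fun ω => (inner ℝ (u (ns (φ n))) (X (ns (φ n)) ω) : ℝ)) 1
      = ∫ ω, Complex.exp ((inner ℝ (u (ns (φ n))) (X (ns (φ n)) ω) : ℝ) * Complex.I) ∂P := by
    intro n
    rw [charFun_apply_real, integral_map (h2.forall_aemeasurable n)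
      (by fun_prop : Continuous fun x : ℝ => Complex.exp ((1 : ℝ) * x * Complex.I)).aestronglyMeasurable]
    simp
  have e2 : charFun ((stdGaussian (Param p)).map fun z => (inner ℝ u₀ (id z) : ℝ)) 1
      = Complex.exp ((-(s / 2) : ℝ)) := by
    rw [charFun_apply_real, integral_map (by fun_prop)
      (by fun_prop : Continuous fun x : ℝ => Complex.exp ((1 : ℝ) * x * Complex.I)).aestronglyMeasurable]
    have e3 := charFun_stdGaussian (E := Param p) u₀
    rw [charFun_apply] at e3
    simp only [Complex.ofReal_one, one_mul, id]
    simp_rw [real_inner_comm _ u₀]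
    rw [e3, ← hs]
    congr 1
    push_cast
    ring
  simp only [ProbabilityMeasure.coe_mk, e1, e2] at h3
  exact h3

lemma dotProduct_covMat_mulVec {X : Ω → Param p} (hX : ∀ j, MemLp (fun ω => X ω j) 2 P)
    (t : Param p) : t.ofLp ⬝ᵥ covMat P X *ᵥ t.ofLp = Var[fun ω => inner ℝ t (X ω); P] := by
  have h1 : ∀ ω, (inner ℝ t (X ω) : ℝ) = ∑ j, t j * X ω j := fun ω => by
    simp [PiLp.inner_apply, mul_comm]
  have h2 : ∀ j, MemLp (fun ω => t j * X ω j) 2 P := fun j => (hX j).const_mul _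
  simp_rw [h1]
  rw [← covariance_self (memLp_finsetSum _ fun j _ => h2 j).aestronglyMeasurable.aemeasurable,
    covariance_fun_sum_fun_sum h2 h2]
  simp only [dotProduct, Matrix.mulVec, covMat, Matrix.of_apply, Finset.mul_sum,
    covariance_const_mul_left, covariance_const_mul_right]
  exact Finset.sum_congr rfl fun j _ => Finset.sum_congr rfl fun k _ => by ring

lemma posSemidef_covMat {X : Ω → Param p} (hX : ∀ j, MemLp (fun ω => X ω j) 2 P) :
    (covMat P X).PosSemidef := by
  rw [Matrix.posSemidef_iff_dotProduct_mulVec]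
  refine ⟨?_, fun x => ?_⟩
  · ext j k
    simp [covMat, Matrix.conjTranspose_apply, covariance_comm]
  · have := dotProduct_covMat_mulVec hX (WithLp.toLp 2 x)
    simp only [star_trivial]
    rw [this]
    exact variance_nonneg _ _

/-- Asymptotic normality of the standardized vectors, with `n₀` times their covariance matrices
converging, gives asymptotic normality of the vectors scaled by `√n₀`. -/
theorem tendsto_integral_exp_inner_of_covMat {X : ℕ → Ω → Param p} {n₀ : ℕ → ℝ}
    {S : Matrix (Fin p) (Fin p) ℝ} (hS : S.PosDef) (hn₀ : Tendsto n₀ atTop atTop)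
    (hX : ∀ᶠ N in atTop, ∀ j, MemLp (fun ω => X N ω j) 2 P)
    (hV : Tendsto (fun N => n₀ N • covMat P (X N)) atTop (𝓝 S))
    (hclt : TendstoInDistribution (fun N ω => Matrix.toEuclideanCLM (𝕜 := ℝ)
      (invSqrt (covMat P (X N))) (X N ω)) atTop id (fun _ => P) (stdGaussian (Param p)))
    (t : Param p) :
    Tendsto (fun N => ∫ ω, Complex.exp ((√(n₀ N) * inner ℝ t (X N ω) : ℝ) * Complex.I) ∂P) atTop
      (𝓝 (Complex.exp ((-((t.ofLp ⬝ᵥ S *ᵥ t.ofLp) / 2) : ℝ)))) := by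
  -- the covariance matrix itself tends to `0`; that it is invertible is seen after scaling by `n₀`
  have hdet : ∀ᶠ N in atTop, (n₀ N • covMat P (X N)).det ≠ 0 := by
    have h1 : Tendsto (fun N => (n₀ N • covMat P (X N)).det) atTop (𝓝 S.det) :=
      ((continuous_id.matrix_det).tendsto S).comp hV
    exact h1.eventually_ne hS.det_pos.ne'
  have hpd : ∀ᶠ N in atTop, (covMat P (X N)).PosDef := by
    filter_upwards [hdet, hX] with N h1 h2
    refine (posSemidef_covMat h2).posDef_iff_det_ne_zero.2 fun h0 => h1 ?_
    rcases isEmpty_or_nonempty (Fin p) with hp | hp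
    · simp at h0
    · rw [Matrix.det_smul, h0, mul_zero]
  have hex : ∀ N, ∃ u : Param p, (covMat P (X N)).PosDef →
      ‖u‖ ^ 2 = t.ofLp ⬝ᵥ covMat P (X N) *ᵥ t.ofLp ∧ ∀ x, inner ℝ t x
        = inner ℝ u (Matrix.toEuclideanCLM (𝕜 := ℝ) (invSqrt (covMat P (X N))) x) := by
    intro N
    by_cases h : (covMat P (X N)).PosDef
    · obtain ⟨u, hu⟩ := exists_inner_eq_inner_invSqrt h t
      exact ⟨u, fun _ => hu⟩
    · exact ⟨0, fun h' => absurd h' h⟩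
  choose u hu using hex
  have hnorm : Tendsto (fun N => ‖√(n₀ N) • u N‖ ^ 2) atTop (𝓝 (t.ofLp ⬝ᵥ S *ᵥ t.ofLp)) := by
    have hc : Continuous fun M : Matrix (Fin p) (Fin p) ℝ => t.ofLp ⬝ᵥ M *ᵥ t.ofLp := by fun_prop
    refine ((hc.tendsto S).comp hV).congr' ?_
    filter_upwards [hpd, hn₀.eventually (eventually_ge_atTop 0)] with N h1 h2
    rw [norm_smul, mul_pow, (hu N h1).1, Real.norm_eq_abs, sq_abs, Real.sq_sqrt h2,
      Function.comp_apply, Matrix.smul_mulVec, dotProduct_smul, smul_eq_mul]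
  refine (tendsto_integral_exp_inner hclt hnorm).congr' ?_
  filter_upwards [hpd] with N h1
  refine integral_congr_ae (Eventually.of_forall fun ω => ?_)
  simp only
  rw [(hu N h1).2, real_inner_smul_left]

end Standardization

section Score

variable {𝒴 : Type*} [MeasurableSpace 𝒴] {p : ℕ} {μ : Measure 𝒴} {f : 𝒴 → Param p → ℝ}
  {Θ B : Set (Param p)} {θ₀ : Param p}

lemma ModelRegularity.measurable_score (hf : IsDensityFamily μ f Θ)
    (hreg : ModelRegularity μ f Θ B θ₀) : Measurable fun x => score f θ₀ x :=
  SurveyBootstrap.measurable_score isOpen_interior (fun y => hreg.contDiffOn_log hf y)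
    (fun t ht => hf.measurable t (interior_subset ht)) hreg.mem_interior

lemma ModelRegularity.memLp_score (hf : IsDensityFamily μ f Θ)
    (hreg : ModelRegularity μ f Θ B θ₀) : MemLp (fun x => score f θ₀ x) 4 (modelLaw μ f θ₀) := by
  have := isProbabilityMeasure_modelLaw hf (interior_subset hreg.mem_interior)
  obtain ⟨M, hM⟩ := hreg.score_moment
  have h6 : MemLp (fun x => score f θ₀ x) 6 (modelLaw μ f θ₀) := by
    refine ⟨(hreg.measurable_score hf).aestronglyMeasurable, ?_⟩
    rw [eLpNorm_lt_top_iff_lintegral_rpow_enorm_lt_top (by norm_num) (by norm_num)]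
    refine lt_of_le_of_lt (le_of_eq ?_)
      ((hM θ₀ (mem_of_mem_nhds hreg.nhds)).trans_lt ENNReal.coe_lt_top)
    refine lintegral_congr fun x => ?_
    rw [← ENNReal.rpow_natCast]
    norm_num
  exact h6.mono_exponent (by norm_num)

lemma ModelRegularity.memLp_inner_score (hf : IsDensityFamily μ f Θ)
    (hreg : ModelRegularity μ f Θ B θ₀) (t : Param p) :
    MemLp (fun x => (inner ℝ t (score f θ₀ x) : ℝ)) 4 (modelLaw μ f θ₀) :=
  (hreg.memLp_score hf).const_inner t

lemma ModelRegularity.measurable_inner_score (hf : IsDensityFamily μ f Θ)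
    (hreg : ModelRegularity μ f Θ B θ₀) (t : Param p) :
    Measurable fun x => (inner ℝ t (score f θ₀ x) : ℝ) :=
  measurable_const.inner (hreg.measurable_score hf)

lemma ModelRegularity.integral_inner_score (hf : IsDensityFamily μ f Θ)
    (hreg : ModelRegularity μ f Θ B θ₀) (t : Param p) :
    ∫ x, (inner ℝ t (score f θ₀ x) : ℝ) ∂(modelLaw μ f θ₀) = 0 := by
  have := isProbabilityMeasure_modelLaw hf (interior_subset hreg.mem_interior)
  exact integral_inner_score_eq_zero hf hreg (fun u =>
    (hreg.memLp_inner_score hf u).integrable (by norm_num)) t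

end Score

/-! ### Asymptotic normality of the weighted score and of its bootstrap version -/

lemma inner_single_one_left {p : ℕ} (j : Fin p) (x : Param p) :
    inner ℝ (EuclideanSpace.single j (1 : ℝ)) x = x j := by
  simp [EuclideanSpace.inner_single_left]

lemma norm_sq_eq_sum_inner {p : ℕ} (x : Param p) :
    ‖x‖ ^ 2 = ∑ j, (inner ℝ (EuclideanSpace.single j (1 : ℝ)) x : ℝ) ^ 2 := by
  simp [EuclideanSpace.norm_sq_eq, inner_single_one_left]

section Bootstrap

variable {𝒴 κ : Type*} [MeasurableSpace 𝒴] {p : ℕ} {μ : Measure 𝒴} {f : 𝒴 → Param p → ℝ}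
  {Θ B : Set (Param p)} {θ₀ : Param p} {𝓕 : Filter κ} {N : κ → ℕ} {y : ∀ k, Fin (N k) → 𝒴}
  {A : ∀ k, Finset (Fin (N k))} {π : ∀ k, Fin (N k) → unitInterval} {n₀ : κ → ℝ}

/-- The bootstrap version of `√n` times the weighted score, centered at its bootstrap mean. -/
noncomputable def bootScore {N : ℕ} (f : 𝒴 → Param p → ℝ) (θ₀ : Param p) (n : ℝ) (y : Fin N → 𝒴)
    (A : Finset (Fin N)) (π : Fin N → unitInterval) (m : Fin N → ℕ) : Param p :=
  √n • (wScore f y A (bootWeight π m) θ₀ - (N / weightSum A π) • wScore f y A (weight π) θ₀)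

omit [MeasurableSpace 𝒴] in
lemma inner_bootScore {N : ℕ} (n : ℝ) (y : Fin N → 𝒴) (A : Finset (Fin N))
    (π : Fin N → unitInterval) (m : Fin N → ℕ) (t : Param p) :
    inner ℝ t (bootScore f θ₀ n y A π m)
      = ∑ i ∈ A, (√n * ((N : ℝ)⁻¹ * (weight π i * inner ℝ t (score f θ₀ (y i))))) * m i
        - N / weightSum A π *
          ∑ i ∈ A, √n * ((N : ℝ)⁻¹ * (weight π i * inner ℝ t (score f θ₀ (y i)))) := by
  rw [bootScore, inner_smul_right, inner_sub_right, inner_smul_right, inner_wScore, inner_wScore,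
    wAvg, wAvg, mul_sub]
  simp only [Finset.mul_sum, bootWeight]
  congr 1 <;> exact Finset.sum_congr rfl fun i _ => by ring

variable (hf : IsDensityFamily μ f Θ) (hreg : ModelRegularity μ f Θ B θ₀)
  (h : RegularSamples 𝓕 (modelLaw μ f θ₀) N y A π n₀) {Q : Param p → ℝ}
  (hQ : ∀ t, Tendsto (fun k => ∑ i ∈ A k,
    (√(n₀ k) * ((N k : ℝ)⁻¹ * (weight (π k) i * inner ℝ t (score f θ₀ (y k i))))) ^ 2) 𝓕 (𝓝 (Q t)))
include hf hreg h hQ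

/-- The Lindeberg-type conditions of the bootstrap central limit theorem hold for the score. -/
lemma tendsto_charFun_bootScore (t : Param p) :
    Tendsto (fun k => charFun ((bootLaw (A k) (π k)).map
      (bootScore f θ₀ (n₀ k) (y k) (A k) (π k))) t) 𝓕 (𝓝 ((Real.exp (-(Q t / 2)) : ℝ) : ℂ)) := by
  have := isProbabilityMeasure_modelLaw hf (interior_subset hreg.mem_interior)
  obtain ⟨C, hC, hw⟩ := h.weight_le
  have hpos : ∀ᶠ k in 𝓕, 0 < n₀ k := h.tendsto_n₀.eventually (eventually_gt_atTop 0)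
  have hNpos : ∀ᶠ k in 𝓕, 0 < (N k : ℝ) := h.tendsto_N.eventually (eventually_gt_atTop 0)
  have hL := hreg.memLp_inner_score hf t
  have i3 : Integrable (fun x => |(inner ℝ t (score f θ₀ x) : ℝ)| ^ 3) (modelLaw μ f θ₀) := by
    have h3 : MemLp (fun x => (inner ℝ t (score f θ₀ x) : ℝ)) 3 (modelLaw μ f θ₀) :=
      hL.mono_exponent (by norm_num)
    simpa using h3.integrable_norm_pow (p := 3) (by norm_num)
  have l1 := h.lln.tendsto _ (hL.integrable (by norm_num))
  have l3 := h.lln.tendsto _ i3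
  rw [hreg.integral_inner_score hf] at l1
  set c : ∀ k, Fin (N k) → ℝ := fun k i =>
    √(n₀ k) * ((N k : ℝ)⁻¹ * (weight (π k) i * inner ℝ t (score f θ₀ (y k i)))) with hc
  have h1 : Tendsto (fun k => (∑ i ∈ A k, c k i) ^ 2 / N k) 𝓕 (𝓝 0) := by
    have e := h.tendsto_div.mul (l1.pow 2)
    simp only [zero_mul] at e
    refine e.congr' ?_
    filter_upwards [hpos] with k hk
    simp only [hc, wAvg, ← Finset.mul_sum, mul_pow]
    rw [Real.sq_sqrt hk.le]
    ring
  have h3 : Tendsto (fun k => ∑ i ∈ A k, |c k i| ^ 3) 𝓕 (𝓝 0) := by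
    have e : Tendsto (fun k => C ^ 2 / √(n₀ k) * wAvg (y k) (A k) (weight (π k))
        fun x => |(inner ℝ t (score f θ₀ x) : ℝ)| ^ 3) 𝓕 (𝓝 0) := by
      simpa using ((Real.tendsto_sqrt_atTop.comp h.tendsto_n₀).const_div_atTop (C ^ 2)).mul l3
    refine squeeze_zero' (Eventually.of_forall fun k => Finset.sum_nonneg fun i _ => by positivity)
      ?_ e
    filter_upwards [hpos, hNpos, hw] with k hk hN hwk
    rw [wAvg, Finset.mul_sum, Finset.mul_sum]
    refine Finset.sum_le_sum fun i _ => ?_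
    have hs : 0 < √(n₀ k) := Real.sqrt_pos.2 hk
    have hw0 := weight_nonneg (π k) i
    have aux : ∀ s M G w : ℝ, s ≠ 0 → M ≠ 0 →
        s ^ 3 * M⁻¹ ^ 3 * G * w * (C * (M / s ^ 2)) ^ 2 = C ^ 2 / s * (M⁻¹ * (w * G)) := by
      intro s M G w hs hM; field_simp
    rw [← aux _ _ _ _ hs.ne' hN.ne', Real.sq_sqrt hk.le]
    simp only [hc, abs_mul, abs_of_pos hs, abs_of_pos (inv_pos.2 hN), abs_of_nonneg hw0]
    calc _ = √(n₀ k) ^ 3 * (N k : ℝ)⁻¹ ^ 3 * |(inner ℝ t (score f θ₀ (y k i)) : ℝ)| ^ 3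
          * weight (π k) i * weight (π k) i ^ 2 := by ring
      _ ≤ _ := by
        gcongr
        exact hwk i
  have key := tendsto_charFun_bootLaw h.tendsto_N h.pos h.nonempty h.tendsto_weightSum h1 (hQ t) h3
  refine key.congr fun k => ?_
  rw [charFun_apply, integral_map (measurable_of_countable _).aemeasurable
    (by fun_prop : Continuous fun x : Param p =>
      Complex.exp ((inner ℝ x t : ℝ) * Complex.I)).aestronglyMeasurable]
  refine integral_congr_ae (Eventually.of_forall fun m => ?_)
  simp only
  rw [real_inner_comm, inner_bootScore]

lemma eventually_lintegral_bootScore_sq_le :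
    ∀ᶠ k in 𝓕, ∫⁻ m, ‖bootScore f θ₀ (n₀ k) (y k) (A k) (π k) m‖ₑ ^ 2 ∂(bootLaw (A k) (π k))
      ≤ ENNReal.ofReal (∑ j, Q (EuclideanSpace.single j 1) + 1) := by
  have := isProbabilityMeasure_modelLaw hf (interior_subset hreg.mem_interior)
  have hb := h.tendsto_weightSum.mul (tendsto_finsetSum Finset.univ fun j (_ : j ∈ Finset.univ) =>
    hQ (EuclideanSpace.single j (1 : ℝ)))
  rw [one_mul] at hb
  filter_upwards [hb.eventually (gt_mem_nhds (lt_add_one _)), h.pos, h.nonempty] with k hk hpos hne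
  have e1 : ∀ m, ‖bootScore f θ₀ (n₀ k) (y k) (A k) (π k) m‖ₑ ^ 2
      = ENNReal.ofReal (∑ j, (inner ℝ (EuclideanSpace.single j (1 : ℝ))
        (bootScore f θ₀ (n₀ k) (y k) (A k) (π k) m) : ℝ) ^ 2) := fun m => by
    rw [← norm_sq_eq_sum_inner, ENNReal.ofReal_pow (norm_nonneg _), ofReal_norm]
  simp_rw [e1]
  rw [← ofReal_integral_eq_lintegral_ofReal (integrable_bootLaw _)
    (Eventually.of_forall fun m => Finset.sum_nonneg fun j _ => sq_nonneg _)]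
  refine ENNReal.ofReal_le_ofReal (le_trans ?_ hk.le)
  rw [integral_finsetSum _ fun j _ => integrable_bootLaw _, Finset.mul_sum]
  refine Finset.sum_le_sum fun j _ => ?_
  simp_rw [inner_bootScore]
  exact integral_sq_bootLaw_le hpos hne _

end Bootstrap

section Sample

variable {𝒴 Ω : Type*} [MeasurableSpace 𝒴] [mΩ : MeasurableSpace Ω] {P : Measure Ω}
  [IsProbabilityMeasure P] {p : ℕ} {μ : Measure 𝒴} {f : 𝒴 → Param p → ℝ}
  {Θ B : Set (Param p)} {θ₀ : Param p} {𝒰 : ℕ → MeasurableSpace Ω} {y : (N : ℕ) → Fin N → Ω → 𝒴}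
  {π : (N : ℕ) → Fin N → Ω → unitInterval} {A : (N : ℕ) → Ω → Finset (Fin N)} {n₀ : ℕ → ℝ}
  {SigmaS : Param p → Matrix (Fin p) (Fin p) ℝ}

open scoped Matrix

lemma measurable_of_inner {α : Type*} [MeasurableSpace α] {X : α → Param p}
    (h : ∀ t, Measurable fun a => (inner ℝ t (X a) : ℝ)) : Measurable X := by
  have h1 : Measurable fun a => (X a).ofLp := measurable_pi_iff.mpr fun j => by
    simpa only [inner_single_one_left] using h (EuclideanSpace.single j 1)
  exact (WithLp.measurable_toLp 2 _).comp h1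

variable (hf : IsDensityFamily μ f Θ) (hreg : ModelRegularity μ f Θ B θ₀)
  (hA : IsPoissonSampling P 𝒰 y π A)
include hf hreg hA

omit [IsProbabilityMeasure P] in
lemma measurable_wScore_sample (N : ℕ) :
    Measurable fun ω => wScore f (y N · ω) (A N ω) (weight (π N · ω)) θ₀ := by
  refine measurable_of_inner fun t => ?_
  simp_rw [inner_wScore]
  exact hA.measurable_wAvg N (hreg.measurable_inner_score hf t)

variable (hy : IsSuperpopulation P (modelLaw μ f θ₀) y) (hπ : InclusionRates P π n₀)
include hy hπ

lemma eventually_memLp_inner_wScore : ∀ᶠ N in atTop, ∀ t : Param p,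
    MemLp (fun ω => (inner ℝ t (wScore f (y N · ω) (A N ω) (weight (π N · ω)) θ₀) : ℝ)) 2 P ∧
    ∫ ω, (inner ℝ t (wScore f (y N · ω) (A N ω) (weight (π N · ω)) θ₀) : ℝ) ∂P = 0 := by
  have := isProbabilityMeasure_modelLaw hf (interior_subset hreg.mem_interior)
  obtain ⟨C, hC, hb⟩ := hπ.exists_bound
  filter_upwards [hb] with N hN t
  have hb' : ∀ᵐ ω ∂P, ∀ i, 0 < (π N i ω : ℝ) ∧ weight (π N · ω) i ≤ C * (N / n₀ N) := by
    filter_upwards [hN.2.2] with ω hω i using ⟨(hω.2 i).1, (hω.2 i).2.1⟩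
  have h2 : MemLp (fun x => (inner ℝ t (score f θ₀ x) : ℝ)) 2 (modelLaw μ f θ₀) :=
    (hreg.memLp_inner_score hf t).mono_exponent (by norm_num)
  have hm := hreg.measurable_inner_score hf t
  simp_rw [inner_wScore]
  exact ⟨hA.memLp_wAvg hy hb' hm h2,
    hA.integral_wAvg hy hb' hm h2 (hreg.integral_inner_score hf t)⟩

variable (hS : SurveyRegularity P (modelLaw μ f θ₀) f B θ₀ y π A n₀ SigmaS)
include hS

lemma tendsto_integral_inner_wScore_sq (t : Param p) :
    Tendsto (fun N => n₀ N * ∫ ω,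
      (inner ℝ t (wScore f (y N · ω) (A N ω) (weight (π N · ω)) θ₀) : ℝ) ^ 2 ∂P) atTop
      (𝓝 (t.ofLp ⬝ᵥ SigmaS θ₀ *ᵥ t.ofLp)) := by
  have hc : Continuous fun M : Matrix (Fin p) (Fin p) ℝ => t.ofLp ⬝ᵥ M *ᵥ t.ofLp := by fun_prop
  refine ((hc.tendsto _).comp (hS.var_tendsto θ₀ (mem_of_mem_nhds hreg.nhds)).2).congr' ?_
  filter_upwards [eventually_memLp_inner_wScore hf hreg hA hy hπ] with N hN
  have h1 : ∀ j, MemLp (fun ω => wScore f (y N · ω) (A N ω) (weight (π N · ω)) θ₀ j) 2 P := by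
    intro j
    simpa only [inner_single_one_left] using (hN (EuclideanSpace.single j 1)).1
  rw [Function.comp_apply, Matrix.smul_mulVec, dotProduct_smul, smul_eq_mul,
    dotProduct_covMat_mulVec h1 t,
    variance_of_integral_eq_zero (hN t).1.aestronglyMeasurable.aemeasurable (hN t).2]

lemma tendsto_integral_exp_inner_wScore (t : Param p) :
    Tendsto (fun N => ∫ ω, Complex.exp ((√(n₀ N) *
      inner ℝ t (wScore f (y N · ω) (A N ω) (weight (π N · ω)) θ₀) : ℝ) * Complex.I) ∂P) atTop
      (𝓝 (Complex.exp ((-((t.ofLp ⬝ᵥ SigmaS θ₀ *ᵥ t.ofLp) / 2) : ℝ)))) := by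
  obtain ⟨hpd, hV⟩ := hS.var_tendsto θ₀ (mem_of_mem_nhds hreg.nhds)
  refine tendsto_integral_exp_inner_of_covMat hpd hπ.tendsto_atTop ?_ hV hS.clt t
  filter_upwards [eventually_memLp_inner_wScore hf hreg hA hy hπ] with N hN j
  simpa only [inner_single_one_left] using (hN (EuclideanSpace.single j 1)).1

/-- The sums of squares that form the bootstrap variance converge to the limit variance of the
score, although the survey conditions only speak about unconditional moments. -/
lemma tendsto_sum_sq_score (t : Param p) :
    Tendsto (fun k : Σ _ : ℕ, Ω => ∑ i ∈ A k.1 k.2, (√(n₀ k.1) * ((k.1 : ℝ)⁻¹ *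
      (weight (π k.1 · k.2) i * inner ℝ t (score f θ₀ (y k.1 i k.2))))) ^ 2)
      (probFilter atTop fun _ => P) (𝓝 (t.ofLp ⬝ᵥ SigmaS θ₀ *ᵥ t.ofLp)) := by
  have := isProbabilityMeasure_modelLaw hf (interior_subset hreg.mem_interior)
  have hm := hreg.measurable_inner_score hf t
  have h4 := hreg.memLp_inner_score hf t
  have h1 := tendsto_integral_inner_wScore_sq hf hreg hA hy hπ hS t
  have h2 := tendsto_integral_exp_inner_wScore hf hreg hA hy hπ hS t
  simp_rw [inner_wScore] at h1 h2
  exact hA.tendsto_sum_sq hy hπ hm h4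
    (hA.tendsto_popVar hy hπ hm h4 (hreg.integral_inner_score hf t) h1 h2)

lemma eventually_lintegral_wScore_sq_le :
    ∀ᶠ N in atTop, ∫⁻ ω, ‖√(n₀ N) • wScore f (y N · ω) (A N ω) (weight (π N · ω)) θ₀‖ₑ ^ 2 ∂P
      ≤ ENNReal.ofReal (∑ j, (EuclideanSpace.single j (1 : ℝ)).ofLp ⬝ᵥ
        SigmaS θ₀ *ᵥ (EuclideanSpace.single j (1 : ℝ)).ofLp + 1) := by
  have hb := tendsto_finsetSum Finset.univ fun j (_ : j ∈ Finset.univ) =>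
    tendsto_integral_inner_wScore_sq hf hreg hA hy hπ hS (EuclideanSpace.single j (1 : ℝ))
  filter_upwards [hb.eventually (gt_mem_nhds (lt_add_one _)),
    eventually_memLp_inner_wScore hf hreg hA hy hπ,
    hπ.tendsto_atTop.eventually (eventually_ge_atTop 0)] with N hN hL hn
  have e1 : ∀ ω, ‖√(n₀ N) • wScore f (y N · ω) (A N ω) (weight (π N · ω)) θ₀‖ₑ ^ 2
      = ENNReal.ofReal (∑ j, n₀ N * (inner ℝ (EuclideanSpace.single j (1 : ℝ))
        (wScore f (y N · ω) (A N ω) (weight (π N · ω)) θ₀) : ℝ) ^ 2) := fun ω => by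
    rw [← Finset.mul_sum, ← norm_sq_eq_sum_inner, ← ofReal_norm,
      ← ENNReal.ofReal_pow (norm_nonneg _), norm_smul, mul_pow, Real.norm_eq_abs, sq_abs,
      Real.sq_sqrt hn]
  simp_rw [e1]
  have hi : ∀ j, Integrable (fun ω => n₀ N * (inner ℝ (EuclideanSpace.single j (1 : ℝ))
        (wScore f (y N · ω) (A N ω) (weight (π N · ω)) θ₀) : ℝ) ^ 2) P := fun j =>
    (hL _).1.integrable_sq.const_mul _
  rw [← ofReal_integral_eq_lintegral_ofReal (integrable_finsetSum _ fun j _ => hi j)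
    (Eventually.of_forall fun m => Finset.sum_nonneg fun j _ => by positivity),
    integral_finsetSum _ fun j _ => hi j]
  simp_rw [integral_const_mul]
  exact ENNReal.ofReal_le_ofReal hN.le

end Sample

/-! ### Asymptotic normality of the estimator and of its bootstrap version -/

section Linearization

open Asymptotics

variable {κ E F : Type*} [NormedAddCommGroup E] [NormedSpace ℝ E] [NormedAddCommGroup F]
  [NormedSpace ℝ F] {𝓖 : Filter κ}

lemma TightAlong.tendsto_smul_of_isLittleO {a : κ → ℝ} {R : κ → F} {S : κ → E} (hR : R =o[𝓖] S)
    (hS : TightAlong 𝓖 fun k => a k • S k) : Tendsto (fun k => a k • R k) 𝓖 (𝓝 0) := by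
  obtain ⟨φ, hφ, he⟩ := hR.norm_norm.exists_eq_mul
  rw [tendsto_zero_iff_norm_tendsto_zero]
  refine (hS φ hφ).congr' ?_
  filter_upwards [he] with k hk
  rw [norm_smul, norm_smul, hk, Pi.mul_apply]
  ring

omit [NormedSpace ℝ E] in
lemma TightAlong.of_tendsto_zero {X : κ → E} (hX : Tendsto X 𝓖 (𝓝 0)) : TightAlong 𝓖 X := by
  intro ε hε
  simpa using hε.mul hX.norm

lemma TightAlong.clm {X : κ → E} (hX : TightAlong 𝓖 X) (L : E →L[ℝ] F) :
    TightAlong 𝓖 fun k => L (X k) :=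
  hX.of_le ‖L‖ (Eventually.of_forall fun _ => L.le_opNorm _)

/-- The random norming `√n` may be replaced by `√n₀` once `n / n₀ → 1`. -/
lemma tendsto_sqrt_smul_sub {c n₀ : κ → ℝ} {D Y : κ → E} (hn₀ : Tendsto n₀ 𝓖 atTop)
    (hc : Tendsto (fun k => c k / n₀ k) 𝓖 (𝓝 1)) (hY : TightAlong 𝓖 Y)
    (h : Tendsto (fun k => √(n₀ k) • D k - Y k) 𝓖 (𝓝 0)) :
    Tendsto (fun k => √(c k) • D k - Y k) 𝓖 (𝓝 0) := by
  have h1 : Tendsto (fun k => √(c k / n₀ k) - 1) 𝓖 (𝓝 0) := by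
    simpa using hc.sqrt.sub_const 1
  have h2 : TightAlong 𝓖 fun k => √(n₀ k) • D k := by
    simpa using (TightAlong.of_tendsto_zero h).add hY
  have h3 := (h2.smul_tendsto h1).add h
  rw [add_zero] at h3
  refine h3.congr' ?_
  filter_upwards [hn₀.eventually (eventually_gt_atTop 0)] with k hk
  have hs : √(n₀ k) ≠ 0 := (Real.sqrt_pos.2 hk).ne'
  rw [smul_smul, sub_mul, one_mul, Real.sqrt_div' _ hk.le, div_mul_cancel₀ _ hs, sub_smul]
  abel

end Linearization

section Gaussian

open scoped Matrix

variable {p : ℕ}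

lemma charFun_map_clm {M : Type*} [MeasurableSpace M] {ν : Measure M} {Y : M → Param p}
    (hY : AEMeasurable Y ν) (L : Param p →L[ℝ] Param p) (x : Param p) :
    charFun (ν.map fun m => L (Y m)) x
      = charFun (ν.map Y) (ContinuousLinearMap.adjoint L x) := by
  have hc : ∀ t : Param p, Continuous fun x : Param p =>
      Complex.exp ((inner ℝ x t : ℝ) * Complex.I) := fun t => by fun_prop
  have hLY : AEMeasurable (fun m => L (Y m)) ν := L.continuous.measurable.comp_aemeasurable hY
  rw [charFun_apply, charFun_apply, integral_map hLY (hc x).aestronglyMeasurable,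
    integral_map hY (hc _).aestronglyMeasurable]
  simp_rw [ContinuousLinearMap.adjoint_inner_right]

lemma charFun_multivariateGaussian_sandwich {S : Matrix (Fin p) (Fin p) ℝ} (hS : S.PosSemidef)
    (K : Matrix (Fin p) (Fin p) ℝ) (x : Param p) :
    charFun (multivariateGaussian 0 (K * S * K.transpose)) x = ((Real.exp
      (-(((ContinuousLinearMap.adjoint (Matrix.toEuclideanCLM (𝕜 := ℝ) K) x).ofLp ⬝ᵥ
        S *ᵥ (ContinuousLinearMap.adjoint (Matrix.toEuclideanCLM (𝕜 := ℝ) K) x).ofLp) / 2)) : ℝ)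
        : ℂ) := by
  have hpsd : (K * S * K.transpose).PosSemidef := by
    have := hS.mul_mul_conjTranspose_same K
    rwa [Matrix.conjTranspose_eq_transpose_of_trivial] at this
  rw [charFun_multivariateGaussian hpsd, ← Matrix.inner_toEuclideanCLM,
    ← Matrix.inner_toEuclideanCLM, ContinuousLinearMap.adjoint_inner_left,
    ← ContinuousLinearMap.star_eq_adjoint, ← map_star, ← mul_apply_eq_comp, ← mul_apply_eq_comp,
    ← map_mul, ← map_mul, Matrix.star_eq_conjTranspose,
    Matrix.conjTranspose_eq_transpose_of_trivial, mul_assoc, inner_zero_right]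
  push_cast
  congr 1
  ring

/-- The common last step for the estimator and its bootstrap version: a sequence that is
asymptotically linear, with the matrix `K`, in a score `Z` that is asymptotically `N(0, S)`, is
asymptotically `N(0, K S Kᵀ)`. -/
lemma tendsto_integral_sandwich {ι : Type*} {M : ι → Type*} [∀ i, MeasurableSpace (M i)]
    {l : Filter ι} {ν : ∀ i, Measure (M i)} (hν : ∀ᶠ i in l, IsProbabilityMeasure (ν i))
    {c n₀ : (Σ i, M i) → ℝ} {D Z : (Σ i, M i) → Param p} {S : Matrix (Fin p) (Fin p) ℝ}
    (hS : S.PosSemidef) (K : Matrix (Fin p) (Fin p) ℝ)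
    (hD : ∀ᶠ i in l, AEMeasurable (fun m => √(c ⟨i, m⟩) • D ⟨i, m⟩) (ν i))
    (hZ : ∀ᶠ i in l, AEMeasurable (fun m => Z ⟨i, m⟩) (ν i)) {C : ℝ} (hC : 0 ≤ C)
    (hZ2 : ∀ᶠ i in l, ∫⁻ m, ‖Z ⟨i, m⟩‖ₑ ^ 2 ∂ν i ≤ ENNReal.ofReal C)
    (hn₀ : Tendsto n₀ (probFilter l ν) atTop)
    (hc : Tendsto (fun k => c k / n₀ k) (probFilter l ν) (𝓝 1))
    (hlin : Tendsto (fun k => √(n₀ k) • D k - Matrix.toEuclideanCLM (𝕜 := ℝ) K (Z k))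
      (probFilter l ν) (𝓝 0))
    (hchar : ∀ t : Param p, Tendsto (fun i => charFun ((ν i).map fun m => Z ⟨i, m⟩) t) l
      (𝓝 ((Real.exp (-((t.ofLp ⬝ᵥ S *ᵥ t.ofLp) / 2)) : ℝ) : ℂ))) (g : Param p →ᵇ ℝ) :
    Tendsto (fun i => ∫ m, g (√(c ⟨i, m⟩) • D ⟨i, m⟩) ∂ν i) l
      (𝓝 (∫ x, g x ∂(multivariateGaussian 0 (K * S * K.transpose)))) := by
  set L := Matrix.toEuclideanCLM (𝕜 := ℝ) K with hL
  have htight : TightAlong (probFilter l ν) Z :=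
    (bddInProb_of_lintegral_sq (hZ.mono fun i hi => hi.enorm) C hZ2).tightAlong
  refine tendsto_integral_of_tendsto_charFun (Y := fun i m => L (Z ⟨i, m⟩)) hν hD
    (hZ.mono fun i hi => L.continuous.measurable.comp_aemeasurable hi)
    (C := ‖L‖ ^ 2 * C) (by positivity) ?_
    (tendsto_sqrt_smul_sub hn₀ hc (htight.clm L) hlin) (fun x => ?_) g
  · filter_upwards [hZ2] with i hi
    calc ∫⁻ m, ‖L (Z ⟨i, m⟩)‖ₑ ^ 2 ∂ν i
        ≤ ∫⁻ m, ‖L‖ₑ ^ 2 * ‖Z ⟨i, m⟩‖ₑ ^ 2 ∂ν i := by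
          refine lintegral_mono fun m => ?_
          rw [← mul_pow]
          gcongr
          exact L.le_opENorm _
      _ = ‖L‖ₑ ^ 2 * ∫⁻ m, ‖Z ⟨i, m⟩‖ₑ ^ 2 ∂ν i :=
          lintegral_const_mul' _ _ (by finiteness)
      _ ≤ ‖L‖ₑ ^ 2 * ENNReal.ofReal C := by gcongr
      _ = ENNReal.ofReal (‖L‖ ^ 2 * C) := by
          rw [ENNReal.ofReal_mul (by positivity), ENNReal.ofReal_pow (norm_nonneg _), ofReal_norm]
  · rw [charFun_multivariateGaussian_sandwich hS]
    refine (hchar _).congr' ?_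
    filter_upwards [hZ] with i hi
    rw [charFun_map_clm hi]

end Gaussian

section Main

open scoped Matrix

variable {𝒴 Ω : Type*} [MeasurableSpace 𝒴] [mΩ : MeasurableSpace Ω] {P : Measure Ω}
  [IsProbabilityMeasure P] {p : ℕ} {μ : Measure 𝒴} {f : 𝒴 → Param p → ℝ}
  {Θ B : Set (Param p)} {θ₀ : Param p} {𝒰 : ℕ → MeasurableSpace Ω} {y : (N : ℕ) → Fin N → Ω → 𝒴}
  {π : (N : ℕ) → Fin N → Ω → unitInterval} {A : (N : ℕ) → Ω → Finset (Fin N)} {n₀ : ℕ → ℝ}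
  {SigmaS : Param p → Matrix (Fin p) (Fin p) ℝ} {θhat : (N : ℕ) → Ω → Param p}
  {θstar : (N : ℕ) → Ω → (Fin N → ℕ) → Param p}

omit [IsProbabilityMeasure P] in
lemma measurable_sqrt_card_smul (hA : IsPoissonSampling P 𝒰 y π A) {N : ℕ} {X : Ω → Param p}
    (hX : Measurable X) : Measurable fun ω => √((A N ω).card : ℝ) • X ω :=
  hA.measurable_comp (F := fun s ω => √(s.card : ℝ) • X ω) fun s => hX.const_smul (√(s.card : ℝ))

lemma bddInProb_wScore (hf : IsDensityFamily μ f Θ) (hreg : ModelRegularity μ f Θ B θ₀)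
    (hy : IsSuperpopulation P (modelLaw μ f θ₀) y) (hA : IsPoissonSampling P 𝒰 y π A)
    (hπ : InclusionRates P π n₀)
    (hS : SurveyRegularity P (modelLaw μ f θ₀) f B θ₀ y π A n₀ SigmaS) :
    BddInProb atTop (fun _ : ℕ => P) fun k : Σ _ : ℕ, Ω =>
    √(n₀ k.1) • wScore f (y k.1 · k.2) (A k.1 k.2) (weight (π k.1 · k.2)) θ₀ := by
  have hm : ∀ N, Measurable fun ω =>
      √(n₀ N) • wScore f (y N · ω) (A N ω) (weight (π N · ω)) θ₀ := fun N =>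
    (measurable_wScore_sample hf hreg hA N).const_smul (√(n₀ N))
  have hb := eventually_lintegral_wScore_sq_le hf hreg hA hy hπ hS
  exact bddInProb_of_lintegral_sq (M := fun _ : ℕ => Ω)
    (Eventually.of_forall fun N => (hm N).enorm.aemeasurable) _ hb

variable (hf : IsDensityFamily μ f Θ) (hreg : ModelRegularity μ f Θ B θ₀)
  (hid : Identifiable μ f Θ θ₀) (hy : IsSuperpopulation P (modelLaw μ f θ₀) y)
  (hA : IsPoissonSampling P 𝒰 y π A) (hπ : InclusionRates P π n₀)
  (hS : SurveyRegularity P (modelLaw μ f θ₀) f B θ₀ y π A n₀ SigmaS)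
  (hθhat : Tendsto (fun N => P {ω | ¬ IsArgmax
      (logLik f (y N · ω) (A N ω) (weight (π N · ω))) Θ (θhat N ω)}) atTop (𝓝 0))
include hf hreg hid hy hA hπ hS hθhat

/-- The estimator is asymptotically linear in the weighted score. -/
lemma tendsto_sqrt_smul_estimator :
    Tendsto (fun k : Σ _ : ℕ, Ω => √(n₀ k.1) • (θhat k.1 k.2 - θ₀) -
      Matrix.toEuclideanCLM (𝕜 := ℝ) (info (modelLaw μ f θ₀) f θ₀)⁻¹ (√(n₀ k.1) •
        wScore f (y k.1 · k.2) (A k.1 k.2) (weight (π k.1 · k.2)) θ₀))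
      (probFilter atTop fun _ => P) (𝓝 0) := by
  have := isProbabilityMeasure_modelLaw hf (interior_subset hreg.mem_interior)
  have hlin := isLittleO_argmax_sub (θhat := fun k : Σ _ : ℕ, Ω => θhat k.1 k.2) hf hreg hid
    (hA.weightedLLN hy hπ) hθhat
  refine (TightAlong.tendsto_smul_of_isLittleO hlin
    (bddInProb_wScore hf hreg hy hA hπ hS).tightAlong).congr fun k => ?_
  rw [smul_sub, map_smul]

/-- The bootstrap estimator, centered at the estimator, is asymptotically linear in the centered
bootstrap score. -/
lemma tendsto_sqrt_smul_bootstrap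
    (hθstar : TendstoInMeasure P
      (fun N ω => (bootLaw (A N ω) (π N · ω)).real {m | ¬ IsArgmax
        (logLik f (y N · ω) (A N ω) (bootWeight (π N · ω) m)) Θ (θstar N ω m)})
      atTop (fun _ => 0)) :
    Tendsto (fun k : Σ k : (Σ _ : ℕ, Ω), (Fin k.1 → ℕ) =>
      √(n₀ k.1.1) • (θstar k.1.1 k.1.2 k.2 - θhat k.1.1 k.1.2) -
        Matrix.toEuclideanCLM (𝕜 := ℝ) (info (modelLaw μ f θ₀) f θ₀)⁻¹
          (bootScore f θ₀ (n₀ k.1.1) (y k.1.1 · k.1.2) (A k.1.1 k.1.2) (π k.1.1 · k.1.2) k.2))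
      (probFilter (probFilter atTop fun _ => P) fun k => bootLaw (A k.1 k.2) (π k.1 · k.2))
      (𝓝 0) ∧
    TightAlong (probFilter (probFilter atTop fun _ => P)
      fun k : Σ _ : ℕ, Ω => bootLaw (A k.1 k.2) (π k.1 · k.2)) fun k =>
        bootScore f θ₀ (n₀ k.1.1) (y k.1.1 · k.1.2) (A k.1.1 k.1.2) (π k.1.1 · k.1.2) k.2 := by
  have := isProbabilityMeasure_modelLaw hf (interior_subset hreg.mem_interior)
  set L := Matrix.toEuclideanCLM (𝕜 := ℝ) (info (modelLaw μ f θ₀) f θ₀)⁻¹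
  have hrs := hA.regularSamples hy hπ
  set 𝓕 : Filter (Σ _ : ℕ, Ω) := probFilter atTop fun _ => P with h𝓕
  set ν : ∀ k : (Σ _ : ℕ, Ω), Measure (Fin k.1 → ℕ) := fun k =>
    bootLaw (A k.1 k.2) (π k.1 · k.2) with hν
  have hfst : Tendsto Sigma.fst (probFilter 𝓕 ν) 𝓕 := tendsto_fst_probFilter
  have hmax : ∀ᶠ k : Σ k : (Σ _ : ℕ, Ω), (Fin k.1 → ℕ) in probFilter 𝓕 ν, IsArgmax
      (logLik f (y k.1.1 · k.1.2) (A k.1.1 k.1.2) (bootWeight (π k.1.1 · k.1.2) k.2)) Θ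
      (θstar k.1.1 k.1.2 k.2) := by
    rw [tendstoInMeasure_const_iff] at hθstar
    rw [eventually_probFilter, ← ENNReal.ofReal_zero]
    refine (ENNReal.tendsto_ofReal hθstar).congr fun k => ?_
    rw [measureReal_def, ENNReal.ofReal_toReal (measure_ne_top _ _)]
  have hlin := isLittleO_argmax_sub (θhat := fun k : Σ k : (Σ _ : ℕ, Ω), (Fin k.1 → ℕ) =>
    θstar k.1.1 k.1.2 k.2) hf hreg hid hrs.bootstrap_lln hmax
  have hbdd := bddInProb_wScore hf hreg hy hA hπ hS
  have htight := hbdd.tightAlong_fst ν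
  have hT : TightAlong (probFilter 𝓕 ν) fun k =>
      bootScore f θ₀ (n₀ k.1.1) (y k.1.1 · k.1.2) (A k.1.1 k.1.2) (π k.1.1 · k.1.2) k.2 :=
    (bddInProb_of_lintegral_sq (X := fun k : Σ k : (Σ _ : ℕ, Ω), (Fin k.1 → ℕ) =>
      bootScore f θ₀ (n₀ k.1.1) (y k.1.1 · k.1.2) (A k.1.1 k.1.2) (π k.1.1 · k.1.2) k.2)
      (Eventually.of_forall fun k => (measurable_of_countable _).aemeasurable) _
      (eventually_lintegral_bootScore_sq_le hf hreg hrs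
        (tendsto_sum_sq_score hf hreg hA hy hπ hS))).tightAlong
  have hNW : Tendsto (fun k : Σ k : (Σ _ : ℕ, Ω), (Fin k.1 → ℕ) =>
      (k.1.1 : ℝ) / weightSum (A k.1.1 k.1.2) (π k.1.1 · k.1.2) - 1) (probFilter 𝓕 ν) (𝓝 0) := by
    simpa using (hrs.tendsto_weightSum.comp hfst).sub_const 1
  have hcor := htight.smul_tendsto hNW
  -- the uncentered bootstrap score is the centered one plus a term governed by the sample score
  have hboot : TightAlong (probFilter 𝓕 ν) fun k => √(n₀ k.1.1) •
      wScore f (y k.1.1 · k.1.2) (A k.1.1 k.1.2) (bootWeight (π k.1.1 · k.1.2) k.2) θ₀ := by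
    have e := (hT.add (TightAlong.of_tendsto_zero hcor)).add htight
    convert e using 2 with k
    rw [bootScore]
    module
  refine ⟨?_, hT⟩
  -- expansions of `θ̂* - θ₀` and of `θ̂ - θ₀`, and the effect of centering at the bootstrap mean
  have h1 := TightAlong.tendsto_smul_of_isLittleO hlin hboot
  have h2 := (tendsto_sqrt_smul_estimator hf hreg hid hy hA hπ hS hθhat).comp hfst
  have h3 := (L.continuous.tendsto 0).comp hcor
  rw [map_zero] at h3
  have h4 := (h1.sub h2).add h3
  rw [sub_zero, add_zero] at h4
  refine h4.congr fun k => ?_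
  simp only [Function.comp_apply, bootScore, map_smul, map_sub, smul_sub]
  module

end Main

end SurveyBootstrap

theorem lemma1
    {𝒴 Ω : Type*} [MeasurableSpace 𝒴] [MeasurableSpace Ω]
    (P : Measure Ω) [IsProbabilityMeasure P] {p : ℕ}
    -- the parametric super-population model
    (μ : Measure 𝒴) [SigmaFinite μ] (f : 𝒴 → Param p → ℝ)
    (Θ B : Set (Param p)) (θ₀ : Param p)
    (hf : IsDensityFamily μ f Θ)
    (hreg : ModelRegularity μ f Θ B θ₀)
    (hid : Identifiable μ f Θ θ₀)
    -- the finite populations and the Poisson samples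
    (y : (N : ℕ) → Fin N → Ω → 𝒴)
    (hy : IsSuperpopulation P (modelLaw μ f θ₀) y)
    (𝒰 : ℕ → MeasurableSpace Ω)
    (π : (N : ℕ) → Fin N → Ω → unitInterval)
    (A : (N : ℕ) → Ω → Finset (Fin N))
    (hA : IsPoissonSampling P 𝒰 y π A)
    (n₀ : ℕ → ℝ) (hπ : InclusionRates P π n₀)
    (SigmaS : Param p → Matrix (Fin p) (Fin p) ℝ)
    (hS : SurveyRegularity P (modelLaw μ f θ₀) f B θ₀ y π A n₀ SigmaS)
    -- the pseudo maximum likelihood estimator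
    (θhat : (N : ℕ) → Ω → Param p)
    (hθhat_meas : ∀ N, Measurable (θhat N))
    (hθhat : Tendsto (fun N => P {ω | ¬ IsArgmax
      (logLik f (y N · ω) (A N ω) (weight (π N · ω))) Θ (θhat N ω)}) atTop (𝓝 0))
    -- the bootstrap estimator, as a function of the bootstrap counts
    (θstar : (N : ℕ) → Ω → (Fin N → ℕ) → Param p)
    (hθstar_meas : ∀ N m, Measurable fun ω => θstar N ω m)
    (hθstar : TendstoInMeasure P
      (fun N ω => (bootLaw (A N ω) (π N · ω)).real {m | ¬ IsArgmax
        (logLik f (y N · ω) (A N ω) (bootWeight (π N · ω) m)) Θ (θstar N ω m)})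
      atTop (fun _ => 0)) :
    TendstoWeaklyInProb P
      (fun N ω => (bootLaw (A N ω) (π N · ω)).map
        fun m => √((A N ω).card : ℝ) • (θstar N ω m - θhat N ω))
      (multivariateGaussian 0 (sandwich (modelLaw μ f θ₀) f SigmaS θ₀)) ∧
    TendstoInDistribution (fun N ω => √((A N ω).card : ℝ) • (θhat N ω - θ₀)) atTop id
      (fun _ => P) (multivariateGaussian 0 (sandwich (modelLaw μ f θ₀) f SigmaS θ₀)) := by
  have := isProbabilityMeasure_modelLaw hf (interior_subset hreg.mem_interior)
  have hpsd := (hS.var_tendsto θ₀ (mem_of_mem_nhds hreg.nhds)).1.posSemidef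
  have hquad : ∀ t : Param p, 0 ≤ t.ofLp ⬝ᵥ Matrix.mulVec (SigmaS θ₀) t.ofLp := fun t => by
    simpa using hpsd.dotProduct_mulVec_nonneg t.ofLp
  have hC : 0 ≤ ∑ j, (EuclideanSpace.single j (1 : ℝ)).ofLp ⬝ᵥ
      Matrix.mulVec (SigmaS θ₀) (EuclideanSpace.single j (1 : ℝ)).ofLp + 1 :=
    add_nonneg (Finset.sum_nonneg fun j _ => hquad (EuclideanSpace.single j (1 : ℝ))) zero_le_one
  have hrs := hA.regularSamples hy hπ
  have hcard := hA.tendsto_card_div hπ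
  have hn₀ : Tendsto (fun k : Σ _ : ℕ, Ω => n₀ k.1) (probFilter atTop fun _ => P) atTop :=
    hrs.tendsto_n₀
  refine ⟨fun g => ?_, ?_, ?_, ?_⟩
  · obtain ⟨hlin, -⟩ :=
      tendsto_sqrt_smul_bootstrap hf hreg hid hy hA hπ hS hθhat hθstar
    set Q : Param p → ℝ := fun t => t.ofLp ⬝ᵥ Matrix.mulVec (SigmaS θ₀) t.ofLp with hQdef
    have hQ : ∀ t : Param p, Tendsto (fun k : Σ _ : ℕ, Ω => ∑ i ∈ A k.1 k.2,
        (√(n₀ k.1) * ((k.1 : ℝ)⁻¹ *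
          (weight (π k.1 · k.2) i * inner ℝ t (score f θ₀ (y k.1 i k.2))))) ^ 2)
        (probFilter atTop fun _ => P) (𝓝 (Q t)) :=
      tendsto_sum_sq_score hf hreg hA hy hπ hS
    have hsq := eventually_lintegral_bootScore_sq_le hf hreg hrs hQ
    have hchar := tendsto_charFun_bootScore hf hreg hrs hQ
    have hfst : Tendsto Sigma.fst (probFilter (probFilter atTop fun _ : ℕ => P)
      fun k => bootLaw (A k.1 k.2) (π k.1 · k.2)) (probFilter atTop fun _ : ℕ => P) :=
      tendsto_fst_probFilter
    rw [tendstoInMeasure_const_iff]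
    have h := tendsto_integral_sandwich (l := probFilter atTop fun _ => P)
      (ν := fun k : Σ _ : ℕ, Ω => bootLaw (A k.1 k.2) (π k.1 · k.2))
      (c := fun k => ((A k.1.1 k.1.2).card : ℝ)) (n₀ := fun k => n₀ k.1.1)
      (D := fun k => θstar k.1.1 k.1.2 k.2 - θhat k.1.1 k.1.2)
      (Z := fun k => bootScore f θ₀ (n₀ k.1.1) (y k.1.1 · k.1.2) (A k.1.1 k.1.2)
        (π k.1.1 · k.1.2) k.2)
      hrs.isProbabilityMeasure hpsd (info (modelLaw μ f θ₀) f θ₀)⁻¹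
      (Eventually.of_forall fun k => (measurable_of_countable _).aemeasurable)
      (Eventually.of_forall fun k => (measurable_of_countable _).aemeasurable) hC
      hsq (hn₀.comp hfst) (hcard.comp hfst) hlin hchar g
    refine h.congr fun k => ?_
    rw [integral_map (measurable_of_countable _).aemeasurable
      g.continuous.aestronglyMeasurable]
  · exact fun N => (measurable_sqrt_card_smul hA ((hθhat_meas N).sub_const θ₀)).aemeasurable
  · exact aemeasurable_id
  · refine ProbabilityMeasure.tendsto_iff_forall_integral_tendsto.mpr fun g => ?_
    have hZ : ∀ N, Measurable fun ω =>
        √(n₀ N) • wScore f (y N · ω) (A N ω) (weight (π N · ω)) θ₀ := fun N =>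
      (measurable_wScore_sample hf hreg hA N).const_smul (√(n₀ N))
    have hsq := eventually_lintegral_wScore_sq_le hf hreg hA hy hπ hS
    have h := tendsto_integral_sandwich (l := atTop) (ν := fun _ : ℕ => P)
      (c := fun k => ((A k.1 k.2).card : ℝ)) (n₀ := fun k => n₀ k.1)
      (Eventually.of_forall fun _ => inferInstance) hpsd (info (modelLaw μ f θ₀) f θ₀)⁻¹
      (D := fun k => θhat k.1 k.2 - θ₀)
      (Z := fun k => √(n₀ k.1) • wScore f (y k.1 · k.2) (A k.1 k.2) (weight (π k.1 · k.2)) θ₀)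
      (Eventually.of_forall fun N =>
        (measurable_sqrt_card_smul hA ((hθhat_meas N).sub_const θ₀)).aemeasurable)
      (Eventually.of_forall fun N => (hZ N).aemeasurable) hC
      hsq hn₀ hcard
      (tendsto_sqrt_smul_estimator hf hreg hid hy hA hπ hS hθhat) (fun t => ?_) g
    · simp only [ProbabilityMeasure.coe_mk, Measure.map_id]
      refine h.congr fun N => ?_
      rw [integral_map
        (measurable_sqrt_card_smul hA ((hθhat_meas N).sub_const θ₀)).aemeasurable
        g.continuous.aestronglyMeasurable]
    · rw [Complex.ofReal_exp]
      refine (tendsto_integral_exp_inner_wScore hf hreg hA hy hπ hS t).congr fun N => ?_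
      rw [charFun_apply, integral_map (hZ N).aemeasurable (by fun_prop)]
      refine integral_congr_ae (Eventually.of_forall fun ω => ?_)
      simp only [real_inner_comm t, real_inner_smul_right]
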